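/- Let $g(t)=\frac1\pi\bigl(\sqrt{1-t^2}-t\arccos t\bigr)$ for $t\in[-1,1]$ and $$\Omega=\{(t,s)\in\mathbb R^2:\ -1\le t\le 1,\ \max(0,-t)\le s\le g(t)\},$$ let $|\Omega|$ be the area of $\Omega$, and for $\mu>0$ let $N_\Omega(\mu)=\#\bigl(\mu\Omega\cap(\mathbb Z^2+(0,-\tfrac14))\bigr)$. Put $\mathfrak C_0=\{(x_1,x_2)\in\mathbb R^2: x_1,x_2>0,\ 1<x_2/x_1<\infty\}$ and, for $\lambda>0$ and $\xi=(\xi_1,\xi_2)\in\mathbb R^2$, $$I(\lambda,\xi)=\int_{-1}^{1}e^{-i\lambda(\xi_1t+\xi_2g(t))}\bigl(\xi_2-\xi_1g'(t)\bigr)\,dt .$$ There is a constant $C>0$ (depending on nothing but the fixed domain $\Omega$) such that the following holds. Let $\rho\in C_0^\infty(\mathbb R^2)$ be a nonnegative, radial, real-valued function with $\int\rho=1$ and support in the closed unit ball, and let $\widehat\rho(\xi)=\int\rho(x)e^{-2\pi i\langle x,\xi\rangle}\,dx$. Then for all $\mu>0$ and all $\varepsilon>0$ the two series (one for each sign) $$S_{\pm}=\sum_{k\in\mathbb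 Z^2\cap\mathfrak C_0}|k|^{-1}\,I\!\left(2\pi\mu|k|,\frac{k}{|k|}\right)\widehat\rho(\varepsilon k)\,e^{-2\pi i(1/4\pm2\varepsilon)k_2}$$ converge absolutely, and $$\left|N_\Omega(\mu)-|\Omega|\mu^2+\frac{\mu}{2}\right|\le C\Bigl(\varepsilon^{-1}+\mu\varepsilon+\mu\max\bigl(|S_+|,|S_-|\bigr)\Bigr).$$ -/

import Mathlib

open scoped Pointwise ContDiff FourierTransform

noncomputable section

namespace DiskLattice

/-- The Euclidean plane. -/
abbrev Plane := EuclideanSpace ℝ (Fin 2)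

/-- The function `g(t) = (√(1 - t²) - t arccos t) / π` (used for `t ∈ [-1, 1]`). -/
def g (t : ℝ) : ℝ := (Real.sqrt (1 - t ^ 2) - t * Real.arccos t) / Real.pi

/-- The planar domain `Ω = {(t, s) : -1 ≤ t ≤ 1, max(0, -t) ≤ s ≤ g(t)}`. -/
def Omega : Set Plane :=
  {x | -1 ≤ x 0 ∧ x 0 ≤ 1 ∧ max 0 (-x 0) ≤ x 1 ∧ x 1 ≤ g (x 0)}

/-- A pair of integers as a point of the plane. -/
def intVec (k : ℤ × ℤ) : Plane := !₂[(k.1 : ℝ), (k.2 : ℝ)]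

/-- The translated lattice `ℤ² + (a, b)`. -/
def shiftedLattice (a b : ℝ) : Set Plane :=
  Set.range fun k : ℤ × ℤ => intVec k + !₂[a, b]

/-- The number of points of `ℤ² + (a, b)` in the dilate `μ D`. -/
def latticeCount (D : Set Plane) (a b μ : ℝ) : ℕ :=
  ((μ • D) ∩ shiftedLattice a b).ncard

/-- The open cone `{(x₁, x₂) : x₁, x₂ > 0, 1 < x₂ / x₁}`. -/
def cone : Set Plane := {x | 0 < x 0 ∧ 0 < x 1 ∧ 1 < x 1 / x 0}

/-- The oscillatory integral
`I(μ, ξ) = ∫_{-1}^{1} e^{-iμ(ξ₁ t + ξ₂ g(t))} (ξ₂ - ξ₁ g'(t)) dt`. -/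
def oscInt (μ : ℝ) (ξ : Plane) : ℂ :=
  ∫ t in (-1 : ℝ)..1,
    Complex.exp (-Complex.I * (μ * (ξ 0 * t + ξ 1 * g t) : ℝ)) *
      ((ξ 1 - ξ 0 * deriv g t : ℝ) : ℂ)

/-- The term `|k|⁻¹ I(2πμ|k|, k/|k|) ρ̂(εk) e^{-2πi (1/4 + 2δ) k₂}`; the shift `δ` will be `ε` or
`-ε`. The Fourier transform is `f̂(ξ) = ∫ f(x) e^{-2πi⟨x, ξ⟩} dx`. -/
def dualTerm (ρ : Plane → ℝ) (μ ε δ : ℝ) (k : ℤ × ℤ) : ℂ :=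
  ((‖intVec k‖⁻¹ : ℝ) : ℂ) *
    oscInt (2 * Real.pi * μ * ‖intVec k‖) (‖intVec k‖⁻¹ • intVec k) *
    𝓕 (fun x : Plane => (ρ x : ℂ)) (ε • intVec k) *
    Complex.exp (-(2 * Real.pi * (1 / 4 + 2 * δ) * k.2 : ℝ) * Complex.I)

/-- The sum of `dualTerm` over the integer points of the cone. -/
def dualSum (ρ : Plane → ℝ) (μ ε δ : ℝ) : ℂ :=
  ∑' k : {k : ℤ × ℤ // intVec k ∈ cone}, dualTerm ρ μ ε δ k

end DiskLattice

end

/-! Counting column by column, the number of points is the sum over integers |m| ≤ μ of ⌊μg(m/μ) +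
1/4⌋ − max(0, −m). Each floor is its argument minus 1/2 minus the sawtooth `saw`. The smooth part
sums to |Ω|μ² + O(1) because g is convex, the constant −1/4 per column yields −μ/2, and there
remains −`sawSum` at (0, −1/4) (`abs_latticeCount_add_sawSum_le`). Everything thus reduces to
bounding a sawtooth sum along the curve s = g(t) dilated by μ.

The sawtooth has slope one and jumps only downwards, and g has Lipschitz constant one. Hence the
sawtooth sum lies between its averages against the rescaled ρ about the points (0, −1/4 ∓ 2ε), up to
O(με + 1) (`sawSum_le_sawSum_add`). By Parseval such an average is a sum over k of `curveCoeff`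
times ρ̂(εk) and a character (`IsMollifier.integral_sawSum_eq`), where `curveCoeff` contains ∫
e(−μ(k₁t + k₂g(t))) dt with e(x) = e^{2πix}.

Since g' = −arccos(t)/π, the normal at t = cos πθ is (θ, 1) with 0 ≤ θ ≤ 1. For k₂ > 0 the phase is
therefore stationary somewhere exactly when 0 ≤ k₁ ≤ k₂; frequencies with k₂ < 0 are complex
conjugates of these. In the open cone the terms are those of the dual sums, up to end point terms
whose sum is bounded. On the two edges of the cone a bound (μk₂)^{-1/2} for the integral suffices.
Outside the closed cone one integrates by parts once.

The series left outside the cone do not converge absolutely with a bound uniform in ε, so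
oscillation in k must be used. Near the evaluation point both x₂ and x₁ + x₂ stay away from the
integers (`offLattice`), and Abel summation gives bounds for all rectangular partial sums:
`norm_endpoint_sum_le` for the end points, `norm_interior_sum_le` for the remaining integrals. The
factors ρ̂(εk) are then inserted by averaging over translates, at no cost
(`IsMollifier.norm_sum_le`). The total error is O(√μ), and √μ ≤ ε⁻¹ + με. -/

namespace DiskLattice

/-! ### Exponential sums and Abel summation -/

/-- The additive character `x ↦ e^{2πix}` of the real line. -/
noncomputable def cis (x : ℝ) : ℂ := Complex.exp (((2 * Real.pi * x : ℝ) : ℂ) * Complex.I)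

lemma norm_cis (x : ℝ) : ‖cis x‖ = 1 := Complex.norm_exp_ofReal_mul_I _

lemma cis_zero : cis 0 = 1 := by simp [cis]

lemma cis_add (x y : ℝ) : cis (x + y) = cis x * cis y := by
  rw [cis, cis, cis, ← Complex.exp_add]; congr 1; push_cast; ring

lemma cis_neg (x : ℝ) : cis (-x) = (starRingEnd ℂ) (cis x) := by
  rw [cis, cis, ← Complex.exp_conj, map_mul, Complex.conj_ofReal, Complex.conj_I]; congr 1
  push_cast; ring

lemma cis_int (n : ℤ) : cis n = 1 := by
  rw [cis, Complex.exp_eq_one_iff]; exact ⟨n, by push_cast; ring⟩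

lemma cis_add_int (x : ℝ) (n : ℤ) : cis (x + n) = cis x := by rw [cis_add, cis_int, mul_one]

lemma cis_nat_mul (n : ℕ) (x : ℝ) : cis (n * x) = cis x ^ n := by
  rw [cis, cis, ← Complex.exp_nat_mul]; congr 1; push_cast; ring

lemma continuous_cis : Continuous cis := by unfold cis; fun_prop

lemma _root_.HasDerivAt.cis {f : ℝ → ℝ} {f' x : ℝ} (hf : HasDerivAt f f' x) :
    HasDerivAt (fun t => cis (f t)) (2 * Real.pi * Complex.I * f' * cis (f x)) x := by
  have h : HasDerivAt (fun y : ℝ => ((2 * Real.pi * f y : ℝ) : ℂ) * Complex.I)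
      (((2 * Real.pi * f' : ℝ) : ℂ) * Complex.I) x :=
    (hf.const_mul (2 * Real.pi)).ofReal_comp.mul_const Complex.I
  refine h.cexp.congr_deriv ?_
  rw [DiskLattice.cis]
  push_cast; ring

lemma cis_eq_cos_add_sin (x : ℝ) :
    cis x = (Real.cos (2 * Real.pi * x) : ℂ) + (Real.sin (2 * Real.pi * x) : ℂ) * Complex.I := by
  rw [cis, Complex.exp_mul_I]; push_cast; rfl

lemma norm_cis_sub_cis_neg (x : ℝ) : ‖cis x - cis (-x)‖ = 2 * |Real.sin (2 * Real.pi * x)| := by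
  have : cis x - cis (-x) = ((2 * Real.sin (2 * Real.pi * x) : ℝ) : ℂ) * Complex.I := by
    rw [cis_eq_cos_add_sin, cis_eq_cos_add_sin]
    rw [show 2 * Real.pi * -x = -(2 * Real.pi * x) by ring, Real.cos_neg, Real.sin_neg]
    push_cast; ring
  rw [this, norm_mul, Complex.norm_I, mul_one, Complex.norm_real, Real.norm_eq_abs, abs_mul]
  norm_num

lemma norm_one_sub_cis (x : ℝ) : ‖1 - cis x‖ = 2 * |Real.sin (Real.pi * x)| := by
  have : 1 - cis x = -cis (x / 2) * (cis (x / 2) - cis (-(x / 2))) := by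
    rw [neg_mul, mul_sub, ← cis_add, ← cis_add]
    simp [cis_zero]
  rw [this, norm_mul, norm_neg, norm_cis, one_mul, norm_cis_sub_cis_neg]
  congr 3; ring

/-- Geometric sums of `cis` are bounded by `1 / |sin πy|`. -/
lemma norm_sum_cis_le (n : ℕ) (c y : ℝ) (hy : Real.sin (Real.pi * y) ≠ 0) :
    ‖∑ k ∈ Finset.range n, cis ((k + c) * y)‖ ≤ |Real.sin (Real.pi * y)|⁻¹ := by
  have hs : 0 < |Real.sin (Real.pi * y)| := abs_pos.mpr hy
  have h1 : cis y ≠ 1 := by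
    intro h
    have := norm_one_sub_cis y
    rw [h, sub_self, norm_zero] at this
    linarith
  have h2 : ∑ k ∈ Finset.range n, cis ((k + c) * y)
      = cis (c * y) * ∑ k ∈ Finset.range n, cis y ^ k := by
    rw [Finset.mul_sum]
    refine Finset.sum_congr rfl fun k _ => ?_
    rw [add_mul, cis_add, cis_nat_mul, mul_comm]
  rw [h2, geom_sum_eq h1, norm_mul, norm_cis, one_mul, norm_div, norm_sub_rev (cis y),
    norm_one_sub_cis, ← cis_nat_mul]
  rw [div_le_iff₀ (by positivity)]
  calc ‖cis (n * y) - 1‖ ≤ ‖cis (n * y)‖ + ‖(1 : ℂ)‖ := norm_sub_le _ _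
    _ = 2 := by rw [norm_cis, norm_one]; norm_num
    _ = _ := by field_simp

/-- Abel's inequality. -/
lemma norm_sum_mul_le_of_antitone {a : ℕ → ℝ} (ha : Antitone a) (ha0 : ∀ n, 0 ≤ a n)
    {z : ℕ → ℂ} {B : ℝ} (hB : ∀ n, ‖∑ k ∈ Finset.range n, z k‖ ≤ B) (n : ℕ) :
    ‖∑ k ∈ Finset.range n, (a k : ℂ) * z k‖ ≤ a 0 * B := by
  have hB0 : 0 ≤ B := (norm_nonneg _).trans (hB 0)
  have key : ∀ n, ∑ k ∈ Finset.range (n + 1), (a k : ℂ) * z k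
      = (a n : ℂ) * (∑ k ∈ Finset.range (n + 1), z k)
        + ∑ k ∈ Finset.range n, ((a k - a (k + 1) : ℝ) : ℂ) * ∑ j ∈ Finset.range (k + 1), z j := by
    intro n
    induction n with
    | zero => simp
    | succ n ih =>
      rw [Finset.sum_range_succ, ih, Finset.sum_range_succ z (n + 1), Finset.sum_range_succ
        (fun k => ((a k - a (k + 1) : ℝ) : ℂ) * ∑ j ∈ Finset.range (k + 1), z j) n]
      push_cast; ring
  rcases n with _ | n
  · simpa using mul_nonneg (ha0 0) hB0
  rw [key]
  calc _ ≤ ‖(a n : ℂ) * (∑ k ∈ Finset.range (n + 1), z k)‖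
        + ∑ k ∈ Finset.range n,
          ‖((a k - a (k + 1) : ℝ) : ℂ) * ∑ j ∈ Finset.range (k + 1), z j‖ :=
        (norm_add_le _ _).trans (add_le_add_right (norm_sum_le _ _) _)
    _ ≤ a n * B + ∑ k ∈ Finset.range n, (a k - a (k + 1)) * B := by
        gcongr with k hk
        · rw [norm_mul, Complex.norm_real, Real.norm_of_nonneg (ha0 n)]
          exact mul_le_mul_of_nonneg_left (hB _) (ha0 n)
        · have h : 0 ≤ a k - a (k + 1) := sub_nonneg.mpr (ha (Nat.le_succ k))
          rw [norm_mul, Complex.norm_real, Real.norm_of_nonneg h]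
          exact mul_le_mul_of_nonneg_left (hB _) h
    _ = a 0 * B := by
        rw [← Finset.sum_mul, Finset.sum_range_sub' (f := a)]; ring

/-- The form in which cancellation in the frequency sums is used: uniform in the length `n` and in
the offset `c`. -/
lemma norm_sum_mul_cis_le {a : ℕ → ℝ} (ha : Antitone a) (ha0 : ∀ n, 0 ≤ a n) (n : ℕ)
    (c y : ℝ) (hy : Real.sin (Real.pi * y) ≠ 0) :
    ‖∑ k ∈ Finset.range n, (a k : ℂ) * cis ((k + c) * y)‖ ≤ a 0 * |Real.sin (Real.pi * y)|⁻¹ :=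
  norm_sum_mul_le_of_antitone ha ha0 (fun n => norm_sum_cis_le n c y hy) n

lemma abs_sin_nat_mul_le (n : ℕ) (x : ℝ) : |Real.sin (n * x)| ≤ n * |Real.sin x| := by
  induction n with
  | zero => simp
  | succ n ih =>
    push_cast
    rw [add_mul, one_mul, Real.sin_add]
    calc _ ≤ |Real.sin (n * x) * Real.cos x| + |Real.cos (n * x) * Real.sin x| := abs_add_le _ _
      _ ≤ |Real.sin (n * x)| * 1 + 1 * |Real.sin x| := by
        rw [abs_mul, abs_mul]
        gcongr
        · exact Real.abs_cos_le_one _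
        · exact Real.abs_cos_le_one _
      _ ≤ _ := by linarith

/-- The partial sums of `∑ sin(2πkw)/k` are uniformly bounded. -/
lemma norm_sum_cis_sub_div_le (n : ℕ) (w : ℝ) :
    ‖∑ k ∈ Finset.range n, (((k : ℝ) + 1)⁻¹ : ℝ) * (cis ((k + 1) * w) - cis (-((k + 1) * w)))‖
      ≤ 6 := by
  set s := |Real.sin (Real.pi * w)| with hs
  have hs0 : 0 ≤ s := abs_nonneg _
  have hterm : ∀ k : ℕ, ‖((((k : ℝ) + 1)⁻¹ : ℝ) : ℂ) * (cis ((k + 1) * w) - cis (-((k + 1) * w)))‖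
      ≤ 4 * s := by
    intro k
    rw [norm_mul, norm_cis_sub_cis_neg, Complex.norm_real, Real.norm_of_nonneg (by positivity)]
    have h := abs_sin_nat_mul_le (2 * (k + 1)) (Real.pi * w)
    rw [show 2 * Real.pi * ((k + 1) * w) = ((2 * (k + 1) : ℕ) : ℝ) * (Real.pi * w) by
      push_cast; ring]
    calc _ ≤ ((k : ℝ) + 1)⁻¹ * (2 * (((2 * (k + 1) : ℕ) : ℝ) * s)) := by gcongr
      _ = 4 * s := by push_cast; field_simp; ring
  rcases hs0.eq_or_lt with h0 | hpos
  · rw [← h0] at hterm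
    calc _ ≤ ∑ k ∈ Finset.range n, (0 : ℝ) :=
          (norm_sum_le _ _).trans (Finset.sum_le_sum fun k _ => by simpa using hterm k)
      _ ≤ 6 := by simp
  have hy : Real.sin (Real.pi * w) ≠ 0 := abs_pos.mp hpos
  have hy' : Real.sin (Real.pi * -w) ≠ 0 := by
    rw [mul_neg, Real.sin_neg]; exact neg_ne_zero.mpr hy
  -- Cut at 1/s. Before the cut each term is at most 4s, so these add up to at most 4; after it
  -- Abel's inequality bounds each of the two exponential sums by s⁻¹/(K+1) ≤ 1.
  set K := ⌊s⁻¹⌋₊ with hK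
  have hK1 : (K : ℝ) * s ≤ 1 := by
    have := Nat.floor_le (inv_nonneg.mpr hs0)
    calc (K : ℝ) * s ≤ s⁻¹ * s := by gcongr
      _ = 1 := inv_mul_cancel₀ hpos.ne'
  have hK2 : s⁻¹ ≤ (K : ℝ) + 1 := (Nat.lt_floor_add_one _).le
  have hsmall : ∀ n ≤ K, ‖∑ k ∈ Finset.range n,
      (((k : ℝ) + 1)⁻¹ : ℝ) * (cis ((k + 1) * w) - cis (-((k + 1) * w)))‖ ≤ 4 := by
    intro n hn
    calc _ ≤ ∑ k ∈ Finset.range n, 4 * s :=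
          (norm_sum_le _ _).trans (Finset.sum_le_sum fun k _ => hterm k)
      _ = 4 * (n * s) := by simp; ring
      _ ≤ 4 * (K * s) := by gcongr
      _ ≤ 4 := by linarith
  rcases le_total n K with hn | hn
  · exact (hsmall n hn).trans (by norm_num)
  obtain ⟨m, rfl⟩ := Nat.exists_eq_add_of_le hn
  rw [Finset.sum_range_add]
  have htail : ∀ v : ℝ, Real.sin (Real.pi * v) ≠ 0 → |Real.sin (Real.pi * v)| = s →
      ‖∑ k ∈ Finset.range m, (((K + k : ℕ) : ℝ) + 1)⁻¹ * cis ((((K + k : ℕ) : ℝ) + 1) * v)‖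
        ≤ 1 := by
    intro v hv hvs
    have h := norm_sum_mul_cis_le (a := fun k => (((K + k : ℕ) : ℝ) + 1)⁻¹)
      (fun i j hij => by dsimp only; gcongr) (fun k => by positivity) m (K + 1) v hv
    rw [hvs] at h
    calc _ = ‖∑ k ∈ Finset.range m, (((((K + k : ℕ) : ℝ) + 1)⁻¹ : ℝ) : ℂ)
            * cis ((k + (K + 1)) * v)‖ := by
          congr 1
          refine Finset.sum_congr rfl fun k _ => ?_
          push_cast
          congr 2
          ring
      _ ≤ _ := h
      _ ≤ s * s⁻¹ := by
          gcongr
          rw [inv_le_comm₀ (by positivity) hpos]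
          simpa using hK2
      _ = 1 := mul_inv_cancel₀ hpos.ne'
  have e : ∑ k ∈ Finset.range m, ((((K + k : ℕ) : ℝ) + 1)⁻¹ : ℝ)
        * (cis ((((K + k : ℕ) : ℝ) + 1) * w) - cis (-((((K + k : ℕ) : ℝ) + 1) * w)))
      = ∑ k ∈ Finset.range m, (((K + k : ℕ) : ℝ) + 1)⁻¹ * cis ((((K + k : ℕ) : ℝ) + 1) * w)
        - ∑ k ∈ Finset.range m, (((K + k : ℕ) : ℝ) + 1)⁻¹ * cis ((((K + k : ℕ) : ℝ) + 1) * -w) := by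
    rw [← Finset.sum_sub_distrib]
    refine Finset.sum_congr rfl fun k _ => ?_
    rw [mul_neg]; push_cast; ring
  have h1 := htail w hy rfl
  have h2 := htail (-w) hy' (by rw [mul_neg, Real.sin_neg, abs_neg])
  rw [e]
  calc _ ≤ 4 + (1 + 1) := (norm_add_le _ _).trans
        (add_le_add (hsmall K le_rfl) ((norm_sub_le _ _).trans (add_le_add h1 h2)))
    _ = 6 := by norm_num


/-! ### The function g: slope, convexity, symmetry -/

lemma continuous_g : Continuous g := by
  unfold g
  have := Real.continuous_arccos
  fun_prop

/-- Outside [−1, 1] the conventions for square root and `arccos` continue g by 0 and by −t. The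
continuation is C¹ and convex on the whole line, so later arguments need no restriction to [−1, 1].
-/
lemma g_of_one_le {t : ℝ} (ht : 1 ≤ t) : g t = 0 := by
  rw [g, Real.arccos_of_one_le ht, Real.sqrt_eq_zero_of_nonpos (by nlinarith)]; simp

lemma g_of_le_neg_one {t : ℝ} (ht : t ≤ -1) : g t = -t := by
  rw [g, Real.arccos_of_le_neg_one ht, Real.sqrt_eq_zero_of_nonpos (by nlinarith)]
  field_simp; ring

/-- From arccos(−t) = π − arccos t. This symmetry exchanges the two ends of the curve and halves the
work for the integrals, the area and the column sums. -/
lemma g_neg (t : ℝ) : g (-t) = g t + t := by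
  rw [g, g, Real.arccos_neg]
  field_simp; ring

lemma hasDerivAt_g_of_ne {t : ℝ} (h1 : t ≠ -1) (h2 : t ≠ 1) :
    HasDerivAt g (-(Real.arccos t / Real.pi)) t := by
  rcases lt_or_gt_of_ne h1 with h | h
  · have : HasDerivAt (fun t : ℝ => -t) (-1) t := (hasDerivAt_id t).neg
    rw [Real.arccos_of_le_neg_one h.le, div_self Real.pi_ne_zero]
    refine this.congr_of_eventuallyEq ?_
    filter_upwards [Iio_mem_nhds h] with s hs
    exact g_of_le_neg_one (le_of_lt hs)
  rcases lt_or_gt_of_ne h2 with h' | h'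
  · have hpos : 0 < 1 - t ^ 2 := by nlinarith
    have hs : HasDerivAt (fun t : ℝ => Real.sqrt (1 - t ^ 2)) (-(2 * t) / (2 * √(1 - t ^ 2))) t := by
      have : HasDerivAt (fun t : ℝ => 1 - t ^ 2) (-(2 * t)) t := by
        simpa using ((hasDerivAt_id t).pow 2).const_sub 1
      exact this.sqrt hpos.ne'
    have hm := (hasDerivAt_id t).mul (Real.hasDerivAt_arccos h1 h2)
    have hd := (hs.sub hm).div_const Real.pi
    refine hd.congr_deriv ?_
    have : 0 < √(1 - t ^ 2) := Real.sqrt_pos.mpr hpos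
    have := Real.pi_ne_zero
    simp only [id]
    field_simp
    ring
  · have : HasDerivAt (fun _ : ℝ => (0 : ℝ)) 0 t := hasDerivAt_const t 0
    rw [Real.arccos_of_one_le h'.le, zero_div, neg_zero]
    refine this.congr_of_eventuallyEq ?_
    filter_upwards [Ioi_mem_nhds h'] with s hs
    exact g_of_one_le (le_of_lt hs)

/-- At ±1 neither the square root nor `arccos` is differentiable, so the formula is obtained there
by writing g as the integral of its continuous derivative, known off these two points. -/
lemma hasDerivAt_g (t : ℝ) : HasDerivAt g (-(Real.arccos t / Real.pi)) t := by
  have hc : Continuous fun t : ℝ => -(Real.arccos t / Real.pi) :=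
    (Real.continuous_arccos.div_const _).neg
  have key : ∀ x, g x = g 0 + ∫ s in (0 : ℝ)..x, -(Real.arccos s / Real.pi) := by
    intro x
    rw [MeasureTheory.integral_eq_of_hasDerivAt_off_countable g _
      (s := {-1, 1}) ((Set.countable_singleton _).insert _) continuous_g.continuousOn
      (fun t ht => ?_) (hc.intervalIntegrable _ _)]
    · ring
    · have := ht.2
      simp only [Set.mem_insert_iff, Set.mem_singleton_iff, not_or] at this
      exact hasDerivAt_g_of_ne this.1 this.2
  have h := (hc.integral_hasStrictDerivAt 0 t).hasDerivAt.const_add (g 0)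
  exact h.congr_of_eventuallyEq (Filter.Eventually.of_forall key)

lemma deriv_g (t : ℝ) : deriv g t = -(Real.arccos t / Real.pi) := (hasDerivAt_g t).deriv

lemma differentiable_g : Differentiable ℝ g := fun t => (hasDerivAt_g t).differentiableAt

lemma monotone_deriv_g : Monotone (deriv g) := by
  intro s t hst
  rw [deriv_g, deriv_g, neg_le_neg_iff]
  exact div_le_div_of_nonneg_right (Real.antitone_arccos hst) Real.pi_pos.le

lemma deriv_g_nonpos (t : ℝ) : deriv g t ≤ 0 := by
  rw [deriv_g, neg_nonpos]
  exact div_nonneg (Real.arccos_nonneg t) Real.pi_pos.le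

lemma neg_one_le_deriv_g (t : ℝ) : -1 ≤ deriv g t := by
  rw [deriv_g, neg_le_neg_iff, div_le_one Real.pi_pos]
  exact Real.arccos_le_pi t

lemma convexOn_g : ConvexOn ℝ Set.univ g :=
  monotone_deriv_g.convexOn_univ_of_deriv differentiable_g

lemma g_sub_le {s t : ℝ} (h : s ≤ t) : g t - g s ≤ 0 := by
  have := image_sub_le_mul_sub_of_deriv_le differentiable_g deriv_g_nonpos h
  simpa using this

lemma neg_le_g_sub {s t : ℝ} (h : s ≤ t) : -(t - s) ≤ g t - g s := by
  have := mul_sub_le_image_sub_of_le_deriv differentiable_g neg_one_le_deriv_g h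
  linarith

lemma abs_g_sub_le (s t : ℝ) : |g t - g s| ≤ |t - s| := by
  rcases le_total s t with h | h
  · rw [abs_of_nonpos (g_sub_le h), abs_of_nonneg (sub_nonneg.mpr h)]
    linarith [neg_le_g_sub h]
  · rw [abs_sub_comm, abs_sub_comm t, abs_of_nonpos (g_sub_le h), abs_of_nonneg (sub_nonneg.mpr h)]
    linarith [neg_le_g_sub h]

lemma g_nonneg (t : ℝ) : 0 ≤ g t := by
  rcases le_total t 1 with h | h
  · linarith [g_sub_le h, g_of_one_le (le_refl (1 : ℝ))]
  · exact (g_of_one_le h).ge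

lemma neg_le_g (t : ℝ) : -t ≤ g t := by linarith [g_nonneg (-t), g_neg t]

lemma g_zero : g 0 = 1 / Real.pi := by simp [g]

/-! ### Oscillatory integrals in the slope coordinate θ -/

/-- The second coordinate of the point of the curve `s = g(t)` whose normal is parallel to
`(θ, 1)`; the first coordinate is `cos πθ`. -/
noncomputable def height (θ : ℝ) : ℝ := Real.sin (Real.pi * θ) / Real.pi - θ * Real.cos (Real.pi * θ)

lemma g_cos {θ : ℝ} (h0 : 0 ≤ θ) (h1 : θ ≤ 1) : g (Real.cos (Real.pi * θ)) = height θ := by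
  have hpi := Real.pi_pos
  have ha : 0 ≤ Real.pi * θ := by positivity
  have hb : Real.pi * θ ≤ Real.pi := by nlinarith
  rw [g, height, Real.arccos_cos ha hb, ← Real.sin_sq_add_cos_sq (Real.pi * θ),
    add_sub_cancel_right, Real.sqrt_sq (Real.sin_nonneg_of_nonneg_of_le_pi ha hb)]
  field_simp

lemma hasDerivAt_pi_mul (θ : ℝ) : HasDerivAt (fun θ : ℝ => Real.pi * θ) Real.pi θ := by
  simpa using (hasDerivAt_id θ).const_mul Real.pi

lemma hasDerivAt_cos_pi_mul (θ : ℝ) :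
    HasDerivAt (fun θ => Real.cos (Real.pi * θ)) (-(Real.pi * Real.sin (Real.pi * θ))) θ := by
  convert (hasDerivAt_pi_mul θ).cos using 1; ring

lemma hasDerivAt_height (θ : ℝ) :
    HasDerivAt height (Real.pi * θ * Real.sin (Real.pi * θ)) θ := by
  have h := ((hasDerivAt_pi_mul θ).sin.div_const Real.pi).sub
    ((hasDerivAt_id θ).mul (hasDerivAt_cos_pi_mul θ))
  refine h.congr_deriv ?_
  simp only [id]
  have := Real.pi_ne_zero
  field_simp
  ring

lemma continuous_height : Continuous height := by unfold height; fun_prop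

lemma height_zero : height 0 = 0 := by simp [height]
lemma height_one : height 1 = 1 := by simp [height]

/-- The oscillatory integral `∫_{-1}^{1} e^{-2πiμ(at + bg(t))} dt`. -/
noncomputable def curveInt (μ a b : ℝ) : ℂ := ∫ t in (-1 : ℝ)..1, cis (-(μ * (a * t + b * g t)))

/-- The phase `a t + b g(t)` in the coordinate `t = cos πθ`. -/
noncomputable def curvePhase (a b θ : ℝ) : ℝ := a * Real.cos (Real.pi * θ) + b * height θ

lemma continuous_curvePhase (a b : ℝ) : Continuous (curvePhase a b) := by
  have := continuous_height
  unfold curvePhase; fun_prop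

lemma hasDerivAt_curvePhase (a b θ : ℝ) :
    HasDerivAt (curvePhase a b) (-(Real.pi * Real.sin (Real.pi * θ) * (a - b * θ))) θ := by
  have h := ((hasDerivAt_cos_pi_mul θ).const_mul a).add ((hasDerivAt_height θ).const_mul b)
  exact h.congr_deriv (by ring)

/-- The Jacobian π sin πθ of t = cos πθ also divides the derivative of the phase. What remains is
the linear factor a − bθ, and integration by parts divides by nothing else. -/
lemma hasDerivAt_cis_curvePhase (μ a b θ : ℝ) :
    HasDerivAt (fun θ => cis (-(μ * curvePhase a b θ)))
      (2 * Real.pi * Complex.I * μ * (((Real.pi * Real.sin (Real.pi * θ) : ℝ) : ℂ)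
        * cis (-(μ * curvePhase a b θ))) * ((a - b * θ : ℝ) : ℂ)) θ := by
  refine ((hasDerivAt_curvePhase a b θ).const_mul μ).neg.cis.congr_deriv ?_
  simp only [Pi.neg_apply]
  push_cast; ring

/-- Substitute −t and use `g_neg`. The map (a, b) ↦ (b − a, b) exchanges the two edges of the cone
and the two sectors outside it, so only one of each has to be estimated. -/
lemma curveInt_symm (μ a b : ℝ) : curveInt μ (b - a) b = curveInt μ a b := by
  unfold curveInt
  have h := intervalIntegral.integral_comp_neg (a := -1) (b := 1)
    (fun t => cis (-(μ * (a * t + b * g t))))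
  rw [neg_neg] at h
  rw [← h]
  refine intervalIntegral.integral_congr fun t _ => ?_
  simp only [g_neg]
  congr 1; ring

lemma curveInt_neg (μ a b : ℝ) :
    curveInt μ (-a) (-b) = (starRingEnd ℂ) (curveInt μ a b) := by
  unfold curveInt
  rw [intervalIntegral.intervalIntegral_eq_integral_uIoc,
    intervalIntegral.intervalIntegral_eq_integral_uIoc]
  simp only [Complex.real_smul, map_mul, Complex.conj_ofReal, ← integral_conj, ← cis_neg]
  congr 3; ext t; congr 1; ring

lemma norm_curveInt_le (μ a b : ℝ) : ‖curveInt μ a b‖ ≤ 2 := by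
  have := intervalIntegral.norm_integral_le_of_norm_le_const (a := (-1 : ℝ)) (b := 1) (C := 1)
    (f := fun t => cis (-(μ * (a * t + b * g t)))) (fun t _ => (norm_cis _).le)
  calc _ ≤ _ := this
    _ = 2 := by norm_num

lemma curveInt_eq (μ a b : ℝ) :
    curveInt μ a b = ∫ θ in (0 : ℝ)..1, ((Real.pi * Real.sin (Real.pi * θ) : ℝ) : ℂ)
        * cis (-(μ * curvePhase a b θ)) := by
  have hcont : Continuous fun t => cis (-(μ * (a * t + b * g t))) := by
    have := continuous_g
    have := continuous_cis
    fun_prop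
  have h := intervalIntegral.integral_deriv_smul_comp (a := (0 : ℝ)) (b := 1)
    (f := fun θ => Real.cos (Real.pi * θ)) (f' := fun θ => -(Real.pi * Real.sin (Real.pi * θ)))
    (g := fun t => cis (-(μ * (a * t + b * g t))))
    (fun θ _ => hasDerivAt_cos_pi_mul θ) (by fun_prop) hcont
  simp only [mul_zero, Real.cos_zero, mul_one, Real.cos_pi] at h
  rw [curveInt, intervalIntegral.integral_symm, ← h, ← intervalIntegral.integral_neg]
  refine intervalIntegral.integral_congr fun θ hθ => ?_
  rw [Set.uIcc_of_le zero_le_one] at hθ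
  simp only [Function.comp, curvePhase]
  rw [g_cos hθ.1 hθ.2, Complex.real_smul]
  push_cast; ring

/-- Integration by parts when the phase has no critical point. -/
lemma curveInt_eq_of_ne {μ a b : ℝ} (hne : ∀ θ ∈ Set.Icc (0 : ℝ) 1, a - b * θ ≠ 0) :
    2 * Real.pi * Complex.I * μ * curveInt μ a b =
      cis (-(μ * (b - a))) / ((a - b : ℝ) : ℂ) - cis (-(μ * a)) / (a : ℂ)
        - b * ∫ θ in (0 : ℝ)..1, cis (-(μ * curvePhase a b θ)) * ((((a - b * θ) ^ 2)⁻¹ : ℝ) : ℂ) := by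
  have hu : ∀ θ ∈ Set.uIcc (0 : ℝ) 1, HasDerivAt (fun θ : ℝ => (((a - b * θ)⁻¹ : ℝ) : ℂ))
      ((b * ((a - b * θ) ^ 2)⁻¹ : ℝ) : ℂ) θ := by
    intro θ hθ
    rw [Set.uIcc_of_le zero_le_one] at hθ
    have h1 : HasDerivAt (fun θ : ℝ => a - b * θ) (-b) θ := by
      simpa using ((hasDerivAt_id θ).const_mul b).const_sub a
    have h2 := (h1.inv (hne θ hθ)).ofReal_comp
    refine h2.congr_deriv ?_
    push_cast
    ring
  have hc1 : ContinuousOn (fun θ : ℝ => ((b * ((a - b * θ) ^ 2)⁻¹ : ℝ) : ℂ)) (Set.uIcc 0 1) := by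
    rw [Set.uIcc_of_le zero_le_one]
    refine Complex.continuous_ofReal.comp_continuousOn (continuousOn_const.mul
      (ContinuousOn.inv₀ (by fun_prop) fun θ hθ => pow_ne_zero 2 (hne θ hθ)))
  have hcc := continuous_cis
  have hcp := continuous_curvePhase a b
  have h := intervalIntegral.integral_mul_deriv_eq_deriv_mul hu
    (fun θ _ => hasDerivAt_cis_curvePhase μ a b θ) hc1.intervalIntegrable
    (Continuous.intervalIntegrable (by fun_prop) _ _)
  have e0 : curvePhase a b 0 = a := by simp [curvePhase, height_zero]
  have e1 : curvePhase a b 1 = b - a := by simp [curvePhase, height_one]; ring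
  rw [e0, e1] at h
  calc _ = ∫ θ in (0 : ℝ)..1, (((a - b * θ)⁻¹ : ℝ) : ℂ) *
        (2 * Real.pi * Complex.I * μ * (((Real.pi * Real.sin (Real.pi * θ) : ℝ) : ℂ)
        * cis (-(μ * curvePhase a b θ))) * ((a - b * θ : ℝ) : ℂ)) := by
        rw [curveInt_eq, ← intervalIntegral.integral_const_mul]
        refine intervalIntegral.integral_congr fun θ hθ => ?_
        rw [Set.uIcc_of_le zero_le_one] at hθ
        have : ((a - b * θ : ℝ) : ℂ) ≠ 0 := Complex.ofReal_ne_zero.mpr (hne θ hθ)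
        rw [Complex.ofReal_inv]
        set d := ((a - b * θ : ℝ) : ℂ)
        field_simp
    _ = _ := by
        rw [h, ← intervalIntegral.integral_const_mul]
        congr 1
        · simp; ring
        · refine intervalIntegral.integral_congr fun θ _ => ?_
          push_cast; ring

/-- For a = 0 the linear factor vanishes at the end θ = 0. With s = √(μb), the part below 1/s is
bounded trivially by π/s; above it integration by parts gives 1/(πs), and π + 1/π ≤ 4. -/
lemma norm_curveInt_zero_le {μ b : ℝ} (hμb : 1 ≤ μ * b) :
    ‖curveInt μ 0 b‖ ≤ 4 / √(μ * b) := by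
  have hs1 : 1 ≤ √(μ * b) := Real.one_le_sqrt.mpr hμb
  have hss : √(μ * b) * √(μ * b) = μ * b := Real.mul_self_sqrt (by linarith)
  set s := √(μ * b) with hs
  set δ := s⁻¹ with hδ
  have hδ0 : 0 < δ := by positivity
  have hδ1 : δ ≤ 1 := inv_le_one_of_one_le₀ hs1
  have hcc := continuous_cis
  have hcp := continuous_curvePhase 0 b
  set F : ℝ → ℂ := fun θ => ((Real.pi * Real.sin (Real.pi * θ) : ℝ) : ℂ)
        * cis (-(μ * curvePhase 0 b θ)) with hF
  have hFc : Continuous F := by fun_prop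
  have hint : ∀ x y, IntervalIntegrable F MeasureTheory.volume x y :=
    fun x y => hFc.intervalIntegrable x y
  rw [curveInt_eq, ← intervalIntegral.integral_add_adjacent_intervals (hint 0 δ) (hint δ 1)]
  have h1 : ‖∫ θ in (0 : ℝ)..δ, F θ‖ ≤ Real.pi * δ := by
    have := intervalIntegral.norm_integral_le_of_norm_le_const (a := 0) (b := δ) (C := Real.pi)
      (f := F) (fun θ _ => by
        rw [hF]
        simp only
        rw [norm_mul, norm_cis, mul_one, Complex.norm_real, Real.norm_eq_abs, abs_mul,
          abs_of_pos Real.pi_pos]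
        exact mul_le_of_le_one_right Real.pi_pos.le (Real.abs_sin_le_one _))
    simpa [abs_of_pos hδ0] using this
  have hne : ∀ θ ∈ Set.uIcc δ 1, θ ≠ 0 := by
    intro θ hθ
    rw [Set.uIcc_of_le hδ1] at hθ
    exact (hδ0.trans_le hθ.1).ne'
  have hu : ∀ θ ∈ Set.uIcc δ 1, HasDerivAt (fun θ : ℝ => ((θ⁻¹ : ℝ) : ℂ))
      ((-(θ ^ 2)⁻¹ : ℝ) : ℂ) θ := fun θ hθ => (hasDerivAt_inv (hne θ hθ)).ofReal_comp
  have hcont' : ContinuousOn (fun θ : ℝ => ((θ ^ 2)⁻¹ : ℝ)) (Set.uIcc δ 1) :=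
    ContinuousOn.inv₀ (by fun_prop) fun θ hθ => pow_ne_zero 2 (hne θ hθ)
  have hcont : ContinuousOn (fun θ : ℝ => (-(θ ^ 2)⁻¹ : ℝ)) (Set.uIcc δ 1) := hcont'.neg
  have h := intervalIntegral.integral_mul_deriv_eq_deriv_mul hu
    (fun θ _ => hasDerivAt_cis_curvePhase μ 0 b θ)
    (Complex.continuous_ofReal.comp_continuousOn hcont).intervalIntegrable
    (Continuous.intervalIntegrable (by fun_prop) _ _)
  have e : ∫ θ in δ..1, ((θ⁻¹ : ℝ) : ℂ) *
        (2 * Real.pi * Complex.I * μ * (((Real.pi * Real.sin (Real.pi * θ) : ℝ) : ℂ)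
        * cis (-(μ * curvePhase 0 b θ))) * ((0 - b * θ : ℝ) : ℂ))
      = -(2 * Real.pi * Complex.I * (μ * b : ℝ)) * ∫ θ in δ..1, F θ := by
    rw [← intervalIntegral.integral_const_mul]
    refine intervalIntegral.integral_congr fun θ hθ => ?_
    have : (θ : ℂ) ≠ 0 := Complex.ofReal_ne_zero.mpr (hne θ hθ)
    simp only [hF]
    push_cast
    field_simp
    ring
  have hI : ∫ θ in δ..1, (θ ^ 2)⁻¹ = δ⁻¹ - 1 := by
    have := intervalIntegral.integral_eq_sub_of_hasDerivAt (a := δ) (b := 1)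
      (f := fun θ : ℝ => θ⁻¹) (fun θ hθ => hasDerivAt_inv (hne θ hθ)) hcont.intervalIntegrable
    rw [intervalIntegral.integral_neg, inv_one] at this
    linarith
  have h3 : ‖∫ θ in δ..1, ((-(θ ^ 2)⁻¹ : ℝ) : ℂ) * cis (-(μ * curvePhase 0 b θ))‖ ≤ δ⁻¹ - 1 := by
    rw [← hI]
    refine intervalIntegral.norm_integral_le_of_norm_le hδ1 ?_ ?_
    · refine Filter.Eventually.of_forall fun θ _ => ?_
      rw [norm_mul, norm_cis, mul_one, Complex.norm_real, norm_neg, Real.norm_of_nonneg]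
      positivity
    · exact hcont'.intervalIntegrable
  have h2 : 2 * Real.pi * (μ * b) * ‖∫ θ in δ..1, F θ‖ ≤ 2 * s := by
    have hn : ‖-(2 * Real.pi * Complex.I * (μ * b : ℝ)) * ∫ θ in δ..1, F θ‖
        = 2 * Real.pi * (μ * b) * ‖∫ θ in δ..1, F θ‖ := by
      simp only [norm_mul, norm_neg, Complex.norm_I, Complex.norm_real, Complex.norm_ofNat,
        Real.norm_of_nonneg Real.pi_pos.le, mul_one]
      rw [← norm_mul, Real.norm_of_nonneg (show 0 ≤ μ * b by linarith)]
    rw [← hn, ← e, h]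
    calc _ ≤ (1 + δ⁻¹) + (δ⁻¹ - 1) := by
          refine (norm_sub_le _ _).trans (add_le_add ((norm_sub_le _ _).trans ?_) h3)
          rw [norm_mul, norm_mul, norm_cis, norm_cis, Complex.norm_real, Complex.norm_real]
          rw [Real.norm_of_nonneg (by positivity), Real.norm_of_nonneg (by positivity)]
          simp
      _ = 2 * s := by rw [hδ, inv_inv]; ring
  have h4 : ‖∫ θ in δ..1, F θ‖ ≤ (Real.pi * s)⁻¹ := by
    rw [← hss] at h2
    rw [← one_div, le_div_iff₀ (by positivity)]
    have : s * (‖∫ θ in δ..1, F θ‖ * (Real.pi * s)) ≤ s * 1 := by nlinarith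
    exact le_of_mul_le_mul_left this (by linarith)
  calc _ ≤ Real.pi * δ + (Real.pi * s)⁻¹ := (norm_add_le _ _).trans (add_le_add h1 h4)
    _ = (Real.pi + Real.pi⁻¹) / s := by rw [hδ]; field_simp
    _ ≤ 4 / s := by
      gcongr
      have h5 : Real.pi⁻¹ ≤ 3⁻¹ := by gcongr; exact Real.pi_gt_three.le
      linarith [Real.pi_lt_d2]

/-! ### The terms of the dual sum in terms of `curveInt` -/

lemma intVec_apply_zero (k : ℤ × ℤ) : intVec k 0 = k.1 := rfl
lemma intVec_apply_one (k : ℤ × ℤ) : intVec k 1 = k.2 := rfl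

lemma norm_intVec_sq (k : ℤ × ℤ) : ‖intVec k‖ ^ 2 = (k.1 : ℝ) ^ 2 + (k.2 : ℝ) ^ 2 := by
  rw [EuclideanSpace.norm_sq_eq, Fin.sum_univ_two, intVec_apply_zero, intVec_apply_one]
  simp

/-- The integral of the divergence theorem in terms of `curveInt` and end point terms. -/
lemma inv_norm_mul_oscInt {μ : ℝ} (hμ : μ ≠ 0) {k : ℤ × ℤ} (hk : k.2 ≠ 0) :
    ((‖intVec k‖⁻¹ : ℝ) : ℂ) *
      oscInt (2 * Real.pi * μ * ‖intVec k‖) (‖intVec k‖⁻¹ • intVec k) =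
    curveInt μ k.1 k.2 / k.2 + ((k.1 / (k.2 * (k.1 ^ 2 + k.2 ^ 2)) : ℝ) : ℂ)
      / (2 * Real.pi * Complex.I * μ) * (cis (-(μ * k.1)) - cis (-(μ * (k.2 - k.1)))) := by
  obtain ⟨a, b⟩ := k
  simp only at hk ⊢
  have hb : (b : ℝ) ≠ 0 := Int.cast_ne_zero.mpr hk
  have hr2 := norm_intVec_sq (a, b)
  simp only at hr2
  set r := ‖intVec (a, b)‖ with hr
  have hr0 : r ≠ 0 := by
    intro h
    rw [h] at hr2
    have : 0 < (b : ℝ) ^ 2 := by positivity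
    nlinarith [sq_nonneg (a : ℝ)]
  have hcg := continuous_g
  have hcc := continuous_cis
  have hdc : Continuous (deriv g) := by
    rw [show deriv g = fun t => -(Real.arccos t / Real.pi) from funext deriv_g]
    exact (Real.continuous_arccos.div_const _).neg
  set E : ℝ → ℂ := fun t => cis (-(μ * (a * t + b * g t))) with hE
  have hEc : Continuous E := by fun_prop
  have hderiv : ∀ t, HasDerivAt E
      (-(2 * Real.pi * Complex.I * μ) * (E t * ((a + b * deriv g t : ℝ) : ℂ))) t := by
    intro t
    have h1 : HasDerivAt (fun t => -(μ * (a * t + b * g t))) (-(μ * (a + b * deriv g t))) t := by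
      exact ((((hasDerivAt_id t).const_mul (a : ℝ)).add
        ((differentiable_g t).hasDerivAt.const_mul (b : ℝ))).const_mul μ).neg.congr_deriv (by simp)
    refine h1.cis.congr_deriv ?_
    simp only [hE]
    push_cast; ring
  have hftc := intervalIntegral.integral_eq_sub_of_hasDerivAt (a := (-1 : ℝ)) (b := 1)
    (fun t _ => hderiv t) (Continuous.intervalIntegrable (by fun_prop) _ _)
  rw [intervalIntegral.integral_const_mul] at hftc
  have e1 : E 1 = cis (-(μ * a)) := by simp [hE, g_of_one_le]
  have e2 : E (-1) = cis (-(μ * (b - a))) := by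
    simp only [hE, g_of_le_neg_one le_rfl]; congr 1; ring
  rw [e1, e2] at hftc
  have hosc : oscInt (2 * Real.pi * μ * r) (r⁻¹ • intVec (a, b)) =
      ((r⁻¹ : ℝ) : ℂ) * (((r ^ 2 / b : ℝ) : ℂ) * curveInt μ a b - ((a / b : ℝ) : ℂ) *
        ∫ t in (-1 : ℝ)..1, E t * ((a + b * deriv g t : ℝ) : ℂ)) := by
    rw [oscInt, curveInt, ← intervalIntegral.integral_const_mul,
      ← intervalIntegral.integral_const_mul,
      ← intervalIntegral.integral_sub (Continuous.intervalIntegrable (by fun_prop) _ _)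
        (Continuous.intervalIntegrable (by fun_prop) _ _),
      ← intervalIntegral.integral_const_mul]
    refine intervalIntegral.integral_congr fun t _ => ?_
    simp only [PiLp.smul_apply, smul_eq_mul, intVec_apply_zero, intVec_apply_one]
    have h1 : Complex.exp (-Complex.I * ((2 * Real.pi * μ * r *
        (r⁻¹ * a * t + r⁻¹ * b * g t) : ℝ) : ℂ)) = E t := by
      simp only [hE, cis]
      congr 1
      rw [show 2 * Real.pi * μ * r * (r⁻¹ * a * t + r⁻¹ * b * g t)
        = 2 * Real.pi * (μ * (a * t + b * g t)) by field_simp]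
      push_cast; ring
    rw [h1]
    -- Splits the normal factor into a constant, which produces `curveInt`, and a multiple of the
    -- derivative of the phase, which integrates exactly to the end point terms.
    have h2 : r⁻¹ * b - r⁻¹ * a * deriv g t
        = r⁻¹ * (r ^ 2 / b - a / b * (a + b * deriv g t)) := by
      rw [hr2]; field_simp; ring
    rw [h2]
    simp only [hE]
    push_cast; ring
  rw [hosc, ← hr2]
  set X := ∫ t in (-1 : ℝ)..1, E t * ((a + b * deriv g t : ℝ) : ℂ) with hX
  have hμ' : (μ : ℂ) ≠ 0 := Complex.ofReal_ne_zero.mpr hμ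
  have hb' : (b : ℂ) ≠ 0 := Int.cast_ne_zero.mpr hk
  have hr' : (r : ℂ) ≠ 0 := Complex.ofReal_ne_zero.mpr hr0
  have hpi : (Real.pi : ℂ) ≠ 0 := Complex.ofReal_ne_zero.mpr Real.pi_ne_zero
  rw [← hftc]
  push_cast
  field_simp
  ring


/-! ### Points away from the lattice and Fourier coefficients along the curve -/

lemma sum_range_inv_sq_le (n : ℕ) : ∑ i ∈ Finset.range n, (((i : ℝ) + 1) ^ 2)⁻¹ ≤ 2 := by
  have h : ∀ n : ℕ, ∑ i ∈ Finset.range (n + 1), (((i : ℝ) + 1) ^ 2)⁻¹ ≤ 2 - ((n : ℝ) + 1)⁻¹ := by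
    intro n
    induction n with
    | zero => norm_num
    | succ n ih =>
      rw [Finset.sum_range_succ]
      have : ((((n + 1 : ℕ) : ℝ) + 1) ^ 2)⁻¹ ≤ ((n : ℝ) + 1)⁻¹ - (((n + 1 : ℕ) : ℝ) + 1)⁻¹ := by
        push_cast
        rw [inv_sub_inv (by positivity) (by positivity), inv_eq_one_div, div_le_div_iff₀
          (by positivity) (by positivity)]
        nlinarith [(Nat.cast_nonneg n : (0 : ℝ) ≤ n)]
      linarith
  rcases n with _ | n
  · simp
  · have : 0 ≤ ((n : ℝ) + 1)⁻¹ := by positivity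
    linarith [h n]

/-- Jordan's inequality. The interval reaches below −3/8 to leave room for the shift by −μ `height
θ` in `sum_norm_kernel_height_le`. -/
lemma le_abs_sin_pi_mul {y : ℝ} (h1 : -7 / 8 ≤ y) (h2 : y ≤ -1 / 8) :
    1 / 4 ≤ |Real.sin (Real.pi * y)| := by
  have hpi := Real.pi_pos
  rcases le_total (-1 / 2) y with h | h
  · have := Real.mul_le_sin (x := Real.pi * -y) (by nlinarith) (by nlinarith)
    rw [mul_neg, Real.sin_neg] at this
    refine le_trans ?_ (this.trans (neg_le_abs _))
    have e : 2 / Real.pi * -(Real.pi * y) = -2 * y := by field_simp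
    rw [e]; linarith
  · have := Real.mul_le_sin (x := Real.pi * (1 + y)) (by nlinarith) (by nlinarith)
    rw [show Real.pi * (1 + y) = Real.pi * y + Real.pi by ring, Real.sin_add_pi] at this
    refine le_trans ?_ (this.trans (neg_le_abs _))
    have e : 2 / Real.pi * (Real.pi * y + Real.pi) = 2 * (y + 1) := by field_simp
    rw [e]; linarith

/-- The box of points `(x₁, x₂)` with both `x₂` and `x₁ + x₂` away from the integers. -/
def offLattice : Set (ℝ × ℝ) :=
  {x | -3 / 8 ≤ x.2 ∧ x.2 ≤ -1 / 8 ∧ -3 / 8 ≤ x.1 + x.2 ∧ x.1 + x.2 ≤ -1 / 8}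

/-- `⟨k, x⟩` for integers `k`. -/
def dot (k : ℤ × ℤ) (x : ℝ × ℝ) : ℝ := k.1 * x.1 + k.2 * x.2

/-- The Fourier coefficients of the sum of sawtooth functions along the curve. -/
noncomputable def curveCoeff (μ : ℝ) (k : ℤ × ℤ) : ℂ :=
  μ / (2 * Real.pi * Complex.I * k.2) * curveInt μ k.1 k.2

/-! ### Correction terms in the cone -/

/-- For fixed i the coefficient decreases in j and is at most (i+1)⁻² at j = 0, so Abel summation in
j leaves a convergent sum over i. -/
lemma norm_cone_sum_fst_le {y : ℝ} (hy : Real.sin (Real.pi * y) ≠ 0) (w : ℝ) (n m : ℕ) :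
    ‖∑ i ∈ Finset.range n, ∑ j ∈ Finset.range m,
      ((((i : ℝ) + 1) / (((i : ℝ) + j + 2) * (((i : ℝ) + 1) ^ 2 + ((i : ℝ) + j + 2) ^ 2)) : ℝ) : ℂ)
        * cis ((i + 1) * w + (i + j + 2) * y)‖ ≤ 2 * |Real.sin (Real.pi * y)|⁻¹ := by
  calc _ ≤ ∑ i ∈ Finset.range n, (((i : ℝ) + 1) ^ 2)⁻¹ * |Real.sin (Real.pi * y)|⁻¹ := by
        refine (norm_sum_le _ _).trans (Finset.sum_le_sum fun i _ => ?_)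
        have e : ∑ j ∈ Finset.range m, ((((i : ℝ) + 1) /
            (((i : ℝ) + j + 2) * (((i : ℝ) + 1) ^ 2 + ((i : ℝ) + j + 2) ^ 2)) : ℝ) : ℂ)
            * cis ((i + 1) * w + (i + j + 2) * y) = cis ((i + 1) * w) * ∑ j ∈ Finset.range m,
            ((((i : ℝ) + 1) /
            (((i : ℝ) + j + 2) * (((i : ℝ) + 1) ^ 2 + ((i : ℝ) + j + 2) ^ 2)) : ℝ) : ℂ)
            * cis ((j + (i + 2)) * y) := by
          rw [Finset.mul_sum]
          refine Finset.sum_congr rfl fun j _ => ?_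
          rw [show ((i : ℝ) + 1) * w + (i + j + 2) * y = (i + 1) * w + (j + (i + 2)) * y by ring,
            cis_add]
          ring
        rw [e, norm_mul, norm_cis, one_mul]
        refine (norm_sum_mul_cis_le (fun a b hab => ?_) (fun j => by positivity) m (i + 2) y
          hy).trans ?_
        · gcongr
        · refine mul_le_mul_of_nonneg_right ?_ (by positivity)
          rw [inv_eq_one_div, div_le_div_iff₀ (by positivity) (by positivity)]
          have : (0 : ℝ) ≤ i := Nat.cast_nonneg i
          push_cast
          nlinarith [mul_nonneg this this, mul_nonneg this (mul_nonneg this this)]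
    _ ≤ _ := by
        rw [← Finset.sum_mul]
        exact mul_le_mul_of_nonneg_right (sum_range_inv_sq_le n) (by positivity)

/-- Here the oscillation sits in i, where the coefficient is not monotone. It is a difference u − v
of two decreasing sequences, each at most (j+1)⁻² at i = 0; Abel summation applies to both. -/
lemma norm_cone_sum_snd_le {y : ℝ} (hy : Real.sin (Real.pi * y) ≠ 0) (w : ℝ) (n m : ℕ) :
    ‖∑ i ∈ Finset.range n, ∑ j ∈ Finset.range m,
      ((((i : ℝ) + 1) / (((i : ℝ) + j + 2) * (((i : ℝ) + 1) ^ 2 + ((i : ℝ) + j + 2) ^ 2)) : ℝ) : ℂ)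
        * cis ((i + 1) * y + (j + 1) * w)‖ ≤ 4 * |Real.sin (Real.pi * y)|⁻¹ := by
  rw [Finset.sum_comm]
  have hinner : ∀ j : ℕ, ‖∑ i ∈ Finset.range n, ((((i : ℝ) + 1) /
      (((i : ℝ) + j + 2) * (((i : ℝ) + 1) ^ 2 + ((i : ℝ) + j + 2) ^ 2)) : ℝ) : ℂ)
        * cis ((i + 1) * y + (j + 1) * w)‖
      ≤ (((j : ℝ) + 1) ^ 2)⁻¹ * (2 * |Real.sin (Real.pi * y)|⁻¹) := by
    intro j
    set u : ℕ → ℝ := fun i => (((i : ℝ) + 1) ^ 2 + ((i : ℝ) + j + 2) ^ 2)⁻¹ with hu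
    set v : ℕ → ℝ := fun i => ((j : ℝ) + 1) / ((i : ℝ) + j + 2) * u i with hv
    have hua : Antitone u := fun a b hab => by simp only [hu]; gcongr
    have hva : Antitone v := fun a b hab => by simp only [hv, hu]; gcongr
    have hu0 : ∀ i, 0 ≤ u i := fun i => by simp only [hu]; positivity
    have hv0 : ∀ i, 0 ≤ v i := fun i => by simp only [hv]; have := hu0 i; positivity
    have hub : u 0 ≤ (((j : ℝ) + 1) ^ 2)⁻¹ := by
      simp only [hu]
      have : (0 : ℝ) ≤ j := Nat.cast_nonneg j
      gcongr
      push_cast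
      nlinarith
    have hvb : v 0 ≤ (((j : ℝ) + 1) ^ 2)⁻¹ := by
      refine le_trans ?_ hub
      simp only [hv]
      refine mul_le_of_le_one_left (hu0 0) ?_
      rw [div_le_one (by positivity)]
      push_cast; linarith
    have e : ∑ i ∈ Finset.range n, ((((i : ℝ) + 1) /
        (((i : ℝ) + j + 2) * (((i : ℝ) + 1) ^ 2 + ((i : ℝ) + j + 2) ^ 2)) : ℝ) : ℂ)
        * cis ((i + 1) * y + (j + 1) * w) = cis ((j + 1) * w) *
        (∑ i ∈ Finset.range n, (u i : ℂ) * cis ((i + 1) * y)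
          - ∑ i ∈ Finset.range n, (v i : ℂ) * cis ((i + 1) * y)) := by
      rw [← Finset.sum_sub_distrib, Finset.mul_sum]
      refine Finset.sum_congr rfl fun i _ => ?_
      have : ((i : ℝ) + 1) / (((i : ℝ) + j + 2) * (((i : ℝ) + 1) ^ 2 + ((i : ℝ) + j + 2) ^ 2))
          = u i - v i := by
        simp only [hu, hv]
        field_simp
        ring
      rw [this, cis_add]
      push_cast; ring
    rw [e, norm_mul, norm_cis, one_mul]
    have h1 := norm_sum_mul_cis_le hua hu0 n 1 y hy
    have h2 := norm_sum_mul_cis_le hva hv0 n 1 y hy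
    refine (norm_sub_le _ _).trans ((add_le_add h1 h2).trans ?_)
    rw [← add_mul]
    have h3 : u 0 + v 0 ≤ (((j : ℝ) + 1) ^ 2)⁻¹ * 2 := by linarith
    calc _ ≤ (((j : ℝ) + 1) ^ 2)⁻¹ * 2 * |Real.sin (Real.pi * y)|⁻¹ :=
          mul_le_mul_of_nonneg_right h3 (by positivity)
      _ = _ := by ring
  calc _ ≤ ∑ j ∈ Finset.range m, (((j : ℝ) + 1) ^ 2)⁻¹ * (2 * |Real.sin (Real.pi * y)|⁻¹) :=
        (norm_sum_le _ _).trans (Finset.sum_le_sum fun j _ => hinner j)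
    _ ≤ 2 * (2 * |Real.sin (Real.pi * y)|⁻¹) := by
        rw [← Finset.sum_mul]
        exact mul_le_mul_of_nonneg_right (sum_range_inv_sq_le m) (by positivity)
    _ = _ := by ring

/-! ### End point terms outside the cone -/

/-- Each of the two inner sums alone may grow logarithmically when w is near an integer. Together
they form a bounded sine sum, independent of j, minus blocks of j + 1 terms. Exchanging the sums
turns the blocks into tails of the j-sum, which Abel summation bounds by a multiple of 1/(i+1); with
the size 1/(i+1) of the block terms the sum over i converges. -/
lemma norm_endpoint_sum_le {y : ℝ} (hy : Real.sin (Real.pi * y) ≠ 0) (w : ℝ) (n m : ℕ) :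
    ‖∑ j ∈ Finset.range m, (((j : ℝ) + 1)⁻¹ : ℝ) * cis ((j + 1) * y) * ∑ i ∈ Finset.range n,
      ((((i : ℝ) + j + 2)⁻¹ : ℝ) * cis ((i + j + 2) * w)
        - (((i : ℝ) + 1)⁻¹ : ℝ) * cis (-((i + 1) * w)))‖ ≤ 10 * |Real.sin (Real.pi * y)|⁻¹ := by
  set s := |Real.sin (Real.pi * y)|⁻¹ with hs
  have hs0 : 0 ≤ s := by positivity
  set h : ℕ → ℂ := fun i => (((i : ℝ) + 1)⁻¹ : ℝ) * cis ((i + 1) * w) with hh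
  set α : ℕ → ℂ := fun j => (((j : ℝ) + 1)⁻¹ : ℝ) * cis ((j + 1) * y) with hα
  set S := ∑ i ∈ Finset.range n, (((i : ℝ) + 1)⁻¹ : ℝ) * (cis ((i + 1) * w) - cis (-((i + 1) * w)))
    with hS
  have hSn : ‖S‖ ≤ 6 := norm_sum_cis_sub_div_le n w
  have hhn : ∀ i, ‖h i‖ = ((i : ℝ) + 1)⁻¹ := fun i => by
    simp only [hh]
    rw [norm_mul, norm_cis, mul_one, Complex.norm_real, Real.norm_of_nonneg (by positivity)]
  have htail : ∀ i, ‖∑ j ∈ Finset.Ico i m, α j‖ ≤ ((i : ℝ) + 1)⁻¹ * s := by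
    intro i
    rw [Finset.sum_Ico_eq_sum_range]
    have := norm_sum_mul_cis_le (a := fun k => ((i : ℝ) + k + 1)⁻¹)
      (fun a b hab => by dsimp only; gcongr) (fun k => by positivity) (m - i) (i + 1) y hy
    simp only [Nat.cast_zero, add_zero] at this
    refine le_of_eq_of_le ?_ this
    congr 1
    refine Finset.sum_congr rfl fun k _ => ?_
    simp only [hα]
    push_cast
    congr 2; ring
  -- A window of length n shifted by j + 1 is the unshifted window, less its first j + 1 terms, plus
  -- the j + 1 terms past its end.
  have hbr : ∀ j : ℕ, ∑ i ∈ Finset.range n,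
      ((((i : ℝ) + j + 2)⁻¹ : ℝ) * cis ((i + j + 2) * w)
        - (((i : ℝ) + 1)⁻¹ : ℝ) * cis (-((i + 1) * w)))
      = S - ∑ i ∈ Finset.range (j + 1), (h i - h (n + i)) := by
    intro j
    have h1 := Finset.sum_range_add h (j + 1) n
    rw [add_comm, Finset.sum_range_add h n (j + 1)] at h1
    have h2 : ∑ i ∈ Finset.range n, ((((i : ℝ) + j + 2)⁻¹ : ℝ) : ℂ) * cis ((i + j + 2) * w)
        = ∑ i ∈ Finset.range n, h (j + 1 + i) := by
      refine Finset.sum_congr rfl fun i _ => ?_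
      simp only [hh]
      have : (i : ℝ) + j + 2 = ((j + 1 + i : ℕ) : ℝ) + 1 := by push_cast; ring
      rw [this]
    have h3 : S = ∑ i ∈ Finset.range n, h i
        - ∑ i ∈ Finset.range n, (((i : ℝ) + 1)⁻¹ : ℝ) * cis (-((i + 1) * w)) := by
      rw [hS, ← Finset.sum_sub_distrib]
      refine Finset.sum_congr rfl fun i _ => ?_
      simp only [hh]; ring
    rw [Finset.sum_sub_distrib, Finset.sum_sub_distrib, h2, h3]
    linear_combination -h1
  have hswap : ∑ j ∈ Finset.range m, α j * ∑ i ∈ Finset.range (j + 1), (h i - h (n + i))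
      = ∑ i ∈ Finset.range m, (h i - h (n + i)) * ∑ j ∈ Finset.Ico i m, α j := by
    simp_rw [Finset.mul_sum]
    rw [Finset.sum_comm' (t' := Finset.range m) (s' := fun i => Finset.Ico i m)]
    · exact Finset.sum_congr rfl fun i _ => Finset.sum_congr rfl fun j _ => mul_comm _ _
    · intro a b
      simp only [Finset.mem_range, Finset.mem_Ico]
      omega
  have e : ∑ j ∈ Finset.range m, (((j : ℝ) + 1)⁻¹ : ℝ) * cis ((j + 1) * y) *
      ∑ i ∈ Finset.range n, ((((i : ℝ) + j + 2)⁻¹ : ℝ) * cis ((i + j + 2) * w)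
        - (((i : ℝ) + 1)⁻¹ : ℝ) * cis (-((i + 1) * w)))
      = S * ∑ j ∈ Finset.Ico 0 m, α j
        - ∑ i ∈ Finset.range m, (h i - h (n + i)) * ∑ j ∈ Finset.Ico i m, α j := by
    rw [← hswap, ← Finset.range_eq_Ico, Finset.mul_sum, ← Finset.sum_sub_distrib]
    refine Finset.sum_congr rfl fun j _ => ?_
    rw [hbr]
    simp only [hα]; ring
  rw [e]
  have h0 : ‖S * ∑ j ∈ Finset.Ico 0 m, α j‖ ≤ 6 * s := by
    rw [norm_mul]
    have := htail 0
    simp only [Nat.cast_zero, zero_add, inv_one, one_mul] at this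
    gcongr
  have h1 : ‖∑ i ∈ Finset.range m, (h i - h (n + i)) * ∑ j ∈ Finset.Ico i m, α j‖
      ≤ 2 * (2 * s) := by
    calc _ ≤ ∑ i ∈ Finset.range m, (((i : ℝ) + 1) ^ 2)⁻¹ * (2 * s) := by
          refine (norm_sum_le _ _).trans (Finset.sum_le_sum fun i _ => ?_)
          rw [norm_mul]
          have hd : ‖h i - h (n + i)‖ ≤ 2 * ((i : ℝ) + 1)⁻¹ := by
            refine (norm_sub_le _ _).trans ?_
            rw [hhn, hhn, two_mul]
            gcongr
            linarith [(Nat.cast_nonneg n : (0 : ℝ) ≤ n)]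
          calc _ ≤ (2 * ((i : ℝ) + 1)⁻¹) * (((i : ℝ) + 1)⁻¹ * s) := by
                gcongr
                exact htail i
            _ = _ := by field_simp
      _ ≤ _ := by
          rw [← Finset.sum_mul]
          exact mul_le_mul_of_nonneg_right (sum_range_inv_sq_le m) (by positivity)
  calc _ ≤ 6 * s + 2 * (2 * s) := (norm_sub_le _ _).trans (add_le_add h0 h1)
    _ = _ := by ring


/-! ### The weight |sin πu|^{-3/4} and the remaining integrals outside the cone -/

/-- The weight `|sin πu|^{-3/4}`. -/
noncomputable def sinWeight (u : ℝ) : ℝ := |Real.sin (Real.pi * u)| ^ (-(3 / 4) : ℝ)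

lemma sinWeight_nonneg (u : ℝ) : 0 ≤ sinWeight u := Real.rpow_nonneg (abs_nonneg _) _

lemma sinWeight_periodic : Function.Periodic sinWeight 1 := by
  intro u
  rw [sinWeight, sinWeight, mul_add, mul_one, Real.sin_add_pi, abs_neg]

lemma measurable_sinWeight : Measurable sinWeight := by
  unfold sinWeight
  fun_prop

lemma two_mul_min_le_sin {u : ℝ} (h0 : 0 ≤ u) (h1 : u ≤ 1) :
    2 * min u (1 - u) ≤ Real.sin (Real.pi * u) := by
  have hpi := Real.pi_pos
  rcases le_total u (1 / 2) with h | h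
  · have := Real.mul_le_sin (x := Real.pi * u) (by positivity) (by nlinarith)
    have e : 2 / Real.pi * (Real.pi * u) = 2 * u := by field_simp
    rw [e] at this
    rw [min_eq_left (by linarith)]; exact this
  · have := Real.mul_le_sin (x := Real.pi * (1 - u)) (by nlinarith) (by nlinarith)
    have e : 2 / Real.pi * (Real.pi * (1 - u)) = 2 * (1 - u) := by field_simp
    rw [e, show Real.pi * (1 - u) = Real.pi - Real.pi * u by ring, Real.sin_pi_sub] at this
    rw [min_eq_right (by linarith)]; exact this

lemma sinWeight_le {u : ℝ} (h0 : 0 < u) (h1 : u < 1) :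
    sinWeight u ≤ u ^ (-(3 / 4) : ℝ) + (1 - u) ^ (-(3 / 4) : ℝ) := by
  have hs := two_mul_min_le_sin h0.le h1.le
  have h1u : 0 < 1 - u := by linarith
  have hm : 0 < min u (1 - u) := lt_min h0 h1u
  have hle : min u (1 - u) ≤ |Real.sin (Real.pi * u)| := by
    refine le_trans ?_ (le_abs_self _); linarith
  have h2 : sinWeight u ≤ (min u (1 - u)) ^ (-(3 / 4) : ℝ) :=
    Real.rpow_le_rpow_of_nonpos hm hle (by norm_num)
  refine h2.trans ?_
  rcases min_choice u (1 - u) with h | h <;> rw [h]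
  · exact le_add_of_nonneg_right (Real.rpow_nonneg h1u.le _)
  · exact le_add_of_nonneg_left (Real.rpow_nonneg h0.le _)

lemma intervalIntegrable_sinWeight_zero_one :
    IntervalIntegrable sinWeight MeasureTheory.volume 0 1 := by
  have h1 : IntervalIntegrable (fun u : ℝ => u ^ (-(3 / 4) : ℝ)) MeasureTheory.volume 0 1 :=
    intervalIntegral.intervalIntegrable_rpow' (by norm_num)
  have h2 : IntervalIntegrable (fun u : ℝ => (1 - u) ^ (-(3 / 4) : ℝ)) MeasureTheory.volume 0 1 := by
    have := h1.comp_sub_left 1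
    simpa using this.symm
  refine (h1.add h2).mono_fun measurable_sinWeight.aestronglyMeasurable ?_
  rw [Set.uIoc_of_le zero_le_one]
  have : ∀ᵐ u : ℝ, u ≠ 1 := by
    simp [MeasureTheory.ae_iff]
  rw [Filter.EventuallyLE, MeasureTheory.ae_restrict_iff' measurableSet_Ioc]
  filter_upwards [this] with u hu1 hu
  rw [Real.norm_of_nonneg (sinWeight_nonneg u)]
  exact (sinWeight_le hu.1 (lt_of_le_of_ne hu.2 hu1)).trans (Real.le_norm_self _)

lemma integral_sinWeight_le : ∫ u in (0 : ℝ)..1, sinWeight u ≤ 8 := by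
  have h1 : IntervalIntegrable (fun u : ℝ => u ^ (-(3 / 4) : ℝ)) MeasureTheory.volume 0 1 :=
    intervalIntegral.intervalIntegrable_rpow' (by norm_num)
  have h2 : IntervalIntegrable (fun u : ℝ => (1 - u) ^ (-(3 / 4) : ℝ)) MeasureTheory.volume 0 1 := by
    have := h1.comp_sub_left 1
    simpa using this.symm
  have hI : ∫ u in (0 : ℝ)..1, u ^ (-(3 / 4) : ℝ) = 4 := by
    rw [integral_rpow (Or.inl (by norm_num))]
    norm_num
  have hI2 : ∫ u in (0 : ℝ)..1, (1 - u) ^ (-(3 / 4) : ℝ) = 4 := by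
    have := intervalIntegral.integral_comp_sub_left (a := 0) (b := 1)
      (fun u : ℝ => u ^ (-(3 / 4) : ℝ)) 1
    rw [this]; simpa using hI
  calc _ ≤ ∫ u in (0 : ℝ)..1, (u ^ (-(3 / 4) : ℝ) + (1 - u) ^ (-(3 / 4) : ℝ)) := by
        refine intervalIntegral.integral_mono_on_of_le_Ioo zero_le_one
          intervalIntegrable_sinWeight_zero_one (h1.add h2) ?_
        intro u hu
        exact sinWeight_le hu.1 hu.2
    _ = 8 := by rw [intervalIntegral.integral_add h1 h2, hI, hI2]; norm_num

lemma intervalIntegrable_sinWeight (a b : ℝ) :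
    IntervalIntegrable sinWeight MeasureTheory.volume a b :=
  sinWeight_periodic.intervalIntegrable₀ one_ne_zero intervalIntegrable_sinWeight_zero_one a b

/-- The substitution sweeps an interval of length μ, covered by ⌈μ⌉ ≤ 2μ periods of mass at most 8
each; dividing by μ makes the bound uniform in μ and y. -/
lemma integral_sinWeight_sub_mul_le {μ : ℝ} (hμ : 1 ≤ μ) (y : ℝ) :
    IntervalIntegrable (fun u => sinWeight (y - μ * u)) MeasureTheory.volume 0 1 ∧
    ∫ u in (0 : ℝ)..1, sinWeight (y - μ * u) ≤ 16 := by
  have hμ0 : μ ≠ 0 := by linarith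
  constructor
  · have := ((intervalIntegrable_sinWeight (y - μ * 0) (y - μ * 1)).comp_sub_left y).comp_mul_left
      (c := μ)
    simpa [hμ0] using this
  rw [intervalIntegral.integral_comp_sub_mul _ hμ0, smul_eq_mul]
  simp only [mul_one, mul_zero, sub_zero]
  set n := ⌈μ⌉₊ with hn
  have hn1 : μ ≤ n := Nat.le_ceil μ
  have hn2 : (n : ℝ) ≤ 2 * μ := by
    have := Nat.ceil_lt_add_one (a := μ) (by linarith)
    linarith
  have h1 : ∫ v in (y - μ)..y, sinWeight v ≤ ∫ v in (y - n)..(y - n + (n : ℤ) • (1 : ℝ)), sinWeight v := by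
    have e : y - n + (n : ℤ) • (1 : ℝ) = y := by simp
    rw [e]
    refine intervalIntegral.integral_mono_interval (by linarith) (by linarith) le_rfl
      (Filter.Eventually.of_forall sinWeight_nonneg) (intervalIntegrable_sinWeight _ _)
  rw [sinWeight_periodic.intervalIntegral_add_zsmul_eq (n : ℤ) _ (intervalIntegrable_sinWeight)] at h1
  have h2 := integral_sinWeight_le
  rw [sinWeight_periodic.intervalIntegral_add_eq (y - n) 0, zero_add] at h1
  simp only [zsmul_eq_mul, Int.cast_natCast] at h1
  rw [inv_mul_le_iff₀ (by linarith)]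
  calc _ ≤ _ := h1
    _ ≤ (2 * μ) * 8 := by
      have : 0 ≤ ∫ u in (0 : ℝ)..1, sinWeight u :=
        intervalIntegral.integral_nonneg zero_le_one fun u _ => sinWeight_nonneg u
      gcongr
    _ = μ * 16 := by ring

lemma strictMonoOn_height : StrictMonoOn height (Set.Icc 0 1) := by
  refine strictMonoOn_of_deriv_pos (convex_Icc 0 1) continuous_height.continuousOn ?_
  intro θ hθ
  rw [interior_Icc] at hθ
  rw [(hasDerivAt_height θ).deriv]
  have hpi := Real.pi_pos
  have : 0 < Real.sin (Real.pi * θ) :=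
    Real.sin_pos_of_pos_of_lt_pi (mul_pos hpi hθ.1) (by nlinarith [hθ.2])
  have := hθ.1
  positivity

lemma height_mem {θ : ℝ} (h : θ ∈ Set.Icc (0 : ℝ) 1) : height θ ∈ Set.Icc (0 : ℝ) 1 := by
  have hm := strictMonoOn_height.monotoneOn
  constructor
  · rw [← height_zero]; exact hm (by simp) h h.1
  · rw [← height_one]; exact hm h (by simp) h.2

/-- The derivative πθ sin πθ is at most π²θ² ≤ 12θ². This cubic flatness keeps y − μ `height θ` away
from the integers for small θ. -/
lemma height_le {θ : ℝ} (h0 : 0 ≤ θ) : height θ ≤ 4 * θ ^ 3 := by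
  have hm : MonotoneOn (fun θ => 4 * θ ^ 3 - height θ) (Set.Ici 0) := by
    have hd : ∀ θ : ℝ, HasDerivAt (fun θ => 4 * θ ^ 3 - height θ)
        (4 * (3 * θ ^ 2) - Real.pi * θ * Real.sin (Real.pi * θ)) θ := fun θ => by
      exact (((hasDerivAt_pow 3 θ).const_mul 4).sub (hasDerivAt_height θ)).congr_deriv (by simp)
    refine monotoneOn_of_deriv_nonneg (convex_Ici 0)
      (fun θ _ => (hd θ).continuousAt.continuousWithinAt)
      (fun θ _ => (hd θ).differentiableAt.differentiableWithinAt) ?_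
    intro θ hθ
    rw [interior_Ici] at hθ
    have hθ0 : 0 < θ := hθ
    rw [(hd θ).deriv]
    have hpi := Real.pi_pos
    have h1 : Real.sin (Real.pi * θ) ≤ Real.pi * θ := Real.sin_le (by positivity)
    have h2 : Real.pi * θ * Real.sin (Real.pi * θ) ≤ Real.pi * θ * (Real.pi * θ) := by gcongr
    have h3 : Real.pi ^ 2 ≤ 12 := by nlinarith [Real.pi_lt_d2]
    nlinarith [sq_nonneg θ]
  have := hm (by simp : (0 : ℝ) ∈ Set.Ici 0) h0 h0
  simp only [height_zero] at this
  linarith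

/-- Change of variables `u = height θ` in the integral of `sinWeight`. -/
lemma integral_sinWeight_height_le {μ : ℝ} (hμ : 1 ≤ μ) (y : ℝ) :
    IntervalIntegrable (fun θ => Real.pi * θ * Real.sin (Real.pi * θ) *
      sinWeight (y - μ * height θ)) MeasureTheory.volume 0 1 ∧
    ∫ θ in (0 : ℝ)..1, Real.pi * θ * Real.sin (Real.pi * θ) * sinWeight (y - μ * height θ)
      ≤ 16 := by
  obtain ⟨hi, hle⟩ := integral_sinWeight_sub_mul_le hμ y
  have himg : height '' Set.Icc 0 1 = Set.Icc 0 1 := by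
    refine Set.Subset.antisymm (Set.image_subset_iff.mpr fun θ hθ => height_mem hθ) ?_
    have := intermediate_value_Icc (zero_le_one' ℝ) continuous_height.continuousOn
    rwa [height_zero, height_one] at this
  have hpos : ∀ θ ∈ Set.Icc (0 : ℝ) 1, 0 ≤ Real.pi * θ * Real.sin (Real.pi * θ) := by
    intro θ hθ
    have hpi := Real.pi_pos
    have := hθ.1
    have : 0 ≤ Real.sin (Real.pi * θ) :=
      Real.sin_nonneg_of_nonneg_of_le_pi (by positivity) (by nlinarith [hθ.2])
    positivity
  have hd : ∀ θ ∈ Set.Icc (0 : ℝ) 1, HasDerivWithinAt height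
      (Real.pi * θ * Real.sin (Real.pi * θ)) (Set.Icc 0 1) θ :=
    fun θ _ => (hasDerivAt_height θ).hasDerivWithinAt
  have hinj := strictMonoOn_height.injOn
  have hcongr : Set.EqOn
      (fun θ => |Real.pi * θ * Real.sin (Real.pi * θ)| • sinWeight (y - μ * height θ))
      (fun θ => Real.pi * θ * Real.sin (Real.pi * θ) * sinWeight (y - μ * height θ))
      (Set.Icc 0 1) := fun θ hθ => by
    simp only [abs_of_nonneg (hpos θ hθ), smul_eq_mul]
  rw [intervalIntegrable_iff_integrableOn_Icc_of_le zero_le_one] at hi ⊢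
  constructor
  · have := MeasureTheory.integrableOn_image_iff_integrableOn_abs_deriv_smul measurableSet_Icc hd
      hinj (fun u => sinWeight (y - μ * u))
    rw [himg] at this
    exact (this.mp hi).congr_fun hcongr measurableSet_Icc
  · have := MeasureTheory.integral_image_eq_integral_abs_deriv_smul measurableSet_Icc hd
      hinj (fun u => sinWeight (y - μ * u))
    rw [himg, MeasureTheory.setIntegral_congr_fun measurableSet_Icc hcongr] at this
    rw [intervalIntegral.integral_of_le zero_le_one,
      ← MeasureTheory.integral_Icc_eq_integral_Ioc] at hle ⊢
    rwa [← this]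

/-- For fixed `i`, the two bounds for the sum over `j` of the kernel `(i + 1 + (j+1)θ)^{-2}`. -/
lemma norm_kernel_sum_le {θ : ℝ} (hθ : 0 ≤ θ) (i m : ℕ) {y : ℝ}
    (hy : Real.sin (Real.pi * y) ≠ 0) :
    ‖∑ j ∈ Finset.range m, (((((i : ℝ) + 1 + (j + 1) * θ) ^ 2)⁻¹ : ℝ) : ℂ) * cis ((j + 1) * y)‖
      ≤ (((i : ℝ) + 1) ^ 2)⁻¹ * |Real.sin (Real.pi * y)|⁻¹ := by
  refine (norm_sum_mul_cis_le (fun a b hab => ?_) (fun j => by positivity) m 1 y hy).trans ?_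
  · gcongr
  · refine mul_le_mul_of_nonneg_right (inv_anti₀ (by positivity) ?_) (by positivity)
    have : 0 ≤ (((0 : ℕ) : ℝ) + 1) * θ := by positivity
    exact pow_le_pow_left₀ (by positivity) (by linarith) 2

/-- The bound without cancellation, by telescoping comparison with the integral of (i + 1 + uθ)⁻².
It does not see y, but degenerates as θ → 0. -/
lemma norm_kernel_sum_le' {θ : ℝ} (hθ : 0 < θ) (i m : ℕ) (y : ℝ) :
    ‖∑ j ∈ Finset.range m, (((((i : ℝ) + 1 + (j + 1) * θ) ^ 2)⁻¹ : ℝ) : ℂ) * cis ((j + 1) * y)‖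
      ≤ (((i : ℝ) + 1) * θ)⁻¹ := by
  have htel : ∀ m : ℕ, ∑ j ∈ Finset.range m, (((i : ℝ) + 1 + (j + 1) * θ) ^ 2)⁻¹
      ≤ θ⁻¹ * (((i : ℝ) + 1)⁻¹ - ((i : ℝ) + 1 + m * θ)⁻¹) := by
    intro m
    induction m with
    | zero => simp
    | succ m ih =>
      rw [Finset.sum_range_succ]
      have hA : 0 < (i : ℝ) + 1 + m * θ := by positivity
      set A := (i : ℝ) + 1 + m * θ with hAdef
      have hB : (i : ℝ) + 1 + (m + 1) * θ = A + θ := by rw [hAdef]; ring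
      push_cast
      rw [hB]
      have : ((A + θ) ^ 2)⁻¹ ≤ θ⁻¹ * (A⁻¹ - (A + θ)⁻¹) := by
        have e : θ⁻¹ * (A⁻¹ - (A + θ)⁻¹) = (A * (A + θ))⁻¹ := by field_simp; ring
        rw [e]
        gcongr
        nlinarith
      calc _ ≤ θ⁻¹ * (((i : ℝ) + 1)⁻¹ - A⁻¹) + θ⁻¹ * (A⁻¹ - (A + θ)⁻¹) := add_le_add ih this
        _ = _ := by ring
  calc _ ≤ ∑ j ∈ Finset.range m, (((i : ℝ) + 1 + (j + 1) * θ) ^ 2)⁻¹ := by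
        refine (norm_sum_le _ _).trans (Finset.sum_le_sum fun j _ => ?_)
        rw [norm_mul, norm_cis, mul_one, Complex.norm_real, Real.norm_of_nonneg (by positivity)]
    _ ≤ θ⁻¹ * (((i : ℝ) + 1)⁻¹ - ((i : ℝ) + 1 + m * θ)⁻¹) := htel m
    _ ≤ θ⁻¹ * ((i : ℝ) + 1)⁻¹ := by
        gcongr
        have : 0 ≤ ((i : ℝ) + 1 + m * θ)⁻¹ := by positivity
        linarith
    _ = _ := by rw [mul_inv, mul_comm]

/-- The constant `∑ (i+1)^{-5/4}`. -/
noncomputable def zetaConst : ℝ := ∑' i : ℕ, ((i : ℝ) + 1) ^ (-(5 / 4) : ℝ)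

lemma summable_zetaConst : Summable fun i : ℕ => ((i : ℝ) + 1) ^ (-(5 / 4) : ℝ) := by
  have := (summable_nat_add_iff 1).mpr (Real.summable_nat_rpow.mpr (by norm_num : (-(5 / 4) : ℝ) < -1))
  simpa using this

lemma zetaConst_nonneg : 0 ≤ zetaConst := tsum_nonneg fun i => by positivity

/-- Sum over `i` of the interpolated kernel bounds. -/
lemma sum_norm_kernel_le {θ : ℝ} (hθ0 : 0 < θ) (n m : ℕ) {y : ℝ}
    (hy : Real.sin (Real.pi * y) ≠ 0) :
    ∑ i ∈ Finset.range n, ‖∑ j ∈ Finset.range m,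
      (((((i : ℝ) + 1 + (j + 1) * θ) ^ 2)⁻¹ : ℝ) : ℂ) * cis ((j + 1) * y)‖
      ≤ zetaConst * (θ ^ (-(3 / 4) : ℝ) * |Real.sin (Real.pi * y)| ^ (-(1 / 4) : ℝ)) := by
  have hδ : 0 < |Real.sin (Real.pi * y)| := abs_pos.mpr hy
  set δ := |Real.sin (Real.pi * y)|
  calc _ ≤ ∑ i ∈ Finset.range n, ((i : ℝ) + 1) ^ (-(5 / 4) : ℝ) *
        (θ ^ (-(3 / 4) : ℝ) * δ ^ (-(1 / 4) : ℝ)) := by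
        refine Finset.sum_le_sum fun i _ => ?_
        have h1 := norm_kernel_sum_le hθ0.le i m hy
        have h2 := norm_kernel_sum_le' hθ0 i m y
        set X := ‖∑ j ∈ Finset.range m,
          (((((i : ℝ) + 1 + (j + 1) * θ) ^ 2)⁻¹ : ℝ) : ℂ) * cis ((j + 1) * y)‖
        have hX : 0 ≤ X := norm_nonneg _
        have hi : (0 : ℝ) < (i : ℝ) + 1 := by positivity
        -- Interpolation: weight 3/4 on the trivial bound and 1/4 on the Abel bound. The decay in i
        -- is then 3/4 + 2/4 = 5/4 > 1, while the singularity in y weakens to |sin πy|^{-1/4}.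
        calc X = X ^ (3 / 4 : ℝ) * X ^ (1 / 4 : ℝ) := by
              rw [← Real.rpow_add_of_nonneg hX (by norm_num) (by norm_num)]; norm_num
          _ ≤ ((((i : ℝ) + 1) * θ)⁻¹) ^ (3 / 4 : ℝ)
              * ((((i : ℝ) + 1) ^ 2)⁻¹ * δ⁻¹) ^ (1 / 4 : ℝ) := by
              gcongr
          _ = _ := by
              rw [mul_inv, Real.mul_rpow (by positivity) (by positivity),
                Real.mul_rpow (by positivity) (by positivity), ← inv_pow,
                ← Real.rpow_natCast, ← Real.rpow_mul (by positivity),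
                Real.inv_rpow hi.le, Real.inv_rpow hi.le, Real.inv_rpow hθ0.le,
                Real.inv_rpow hδ.le, ← Real.rpow_neg hi.le, ← Real.rpow_neg hi.le,
                ← Real.rpow_neg hθ0.le, ← Real.rpow_neg hδ.le,
                show (-(5 / 4) : ℝ) = -(3 / 4) + -(((2 : ℕ) : ℝ) * (1 / 4)) by norm_num,
                Real.rpow_add hi]
              ring
    _ ≤ _ := by
        rw [← Finset.sum_mul]
        refine mul_le_mul_of_nonneg_right ?_ (by positivity)
        exact summable_zetaConst.sum_le_tsum _ fun i _ => by positivity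

/-- Split according to whether √δ ≤ D. It is used with D = θ sin πθ, the Jacobian of `height` up to
π: the first term can then be integrated in the variable u = `height θ`, and the second no longer
involves δ. -/
lemma rpow_neg_quarter_le {δ D : ℝ} (hδ : 0 < δ) (hD : 0 < D) :
    δ ^ (-(1 / 4) : ℝ) ≤ D * δ ^ (-(3 / 4) : ℝ) + D ^ (-(1 / 2) : ℝ) := by
  have h0 : 0 < δ ^ (1 / 2 : ℝ) := Real.rpow_pos_of_pos hδ _
  have hA : 0 ≤ D ^ (-(1 / 2) : ℝ) := Real.rpow_nonneg hD.le _
  have hB : 0 ≤ δ ^ (-(3 / 4) : ℝ) := Real.rpow_nonneg hδ.le _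
  rcases le_total (δ ^ (1 / 2 : ℝ)) D with h | h
  · have e : δ ^ (-(1 / 4) : ℝ) = δ ^ (1 / 2 : ℝ) * δ ^ (-(3 / 4) : ℝ) := by
      rw [← Real.rpow_add hδ]; norm_num
    rw [e]
    exact (mul_le_mul_of_nonneg_right h hB).trans (le_add_of_nonneg_right hA)
  · have e : δ ^ (-(1 / 4) : ℝ) = (δ ^ (1 / 2 : ℝ)) ^ (-(1 / 2) : ℝ) := by
      rw [← Real.rpow_mul hδ.le]; norm_num
    rw [e]
    exact (Real.rpow_le_rpow_of_nonpos hD h (by norm_num)).trans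
      (le_add_of_nonneg_left (by positivity))


/-- Makes the exceptional θ, where Abel summation is not available, a null set: `height` is
injective on [0, 1], so each integer value is taken at most once. -/
lemma countable_setOf_sin_height_eq_zero {μ : ℝ} (hμ : 0 < μ) (y : ℝ) :
    {θ ∈ Set.Icc (0 : ℝ) 1 | Real.sin (Real.pi * (y - μ * height θ)) = 0}.Countable := by
  have hsub : {θ ∈ Set.Icc (0 : ℝ) 1 | Real.sin (Real.pi * (y - μ * height θ)) = 0}
      ⊆ ⋃ n : ℤ, {θ ∈ Set.Icc (0 : ℝ) 1 | y - μ * height θ = n} := by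
    rintro θ ⟨hθ, h⟩
    obtain ⟨n, hn⟩ := Real.sin_eq_zero_iff.mp h
    refine Set.mem_iUnion.mpr ⟨n, hθ, ?_⟩
    rw [mul_comm] at hn
    exact (mul_left_cancel₀ Real.pi_ne_zero hn).symm
  refine (Set.countable_iUnion fun n => Set.Subsingleton.countable ?_).mono hsub
  rintro θ ⟨hθ, h⟩ θ' ⟨hθ', h'⟩
  refine strictMonoOn_height.injOn hθ hθ' (mul_left_cancel₀ hμ.ne' ?_)
  linarith

/-- Pointwise bound for the kernel along the curve, split at `θ = μ^{-2/5}/4`. -/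
lemma sum_norm_kernel_height_le {μ : ℝ} (hμ : 1 ≤ μ) {y : ℝ} (hy1 : -3 / 8 ≤ y) (hy2 : y ≤ -1 / 8)
    {θ : ℝ} (hθ0 : 0 < θ) (hθ1 : θ < 1) (hs : Real.sin (Real.pi * (y - μ * height θ)) ≠ 0)
    (n m : ℕ) :
    ∑ i ∈ Finset.range n, ‖∑ j ∈ Finset.range m, (((((i : ℝ) + 1 + (j + 1) * θ) ^ 2)⁻¹ : ℝ) : ℂ)
      * cis ((j + 1) * (y - μ * height θ))‖ ≤ 8 + zetaConst * (8 * √μ) *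
      (Real.pi * θ * Real.sin (Real.pi * θ) * sinWeight (y - μ * height θ) + sinWeight θ) := by
  have hpi := Real.pi_pos
  have hμ0 : 0 < μ := by linarith
  have hsin : 0 < Real.sin (Real.pi * θ) :=
    Real.sin_pos_of_pos_of_lt_pi (mul_pos hpi hθ0) (by nlinarith)
  have hsum0 : 0 ≤ Real.pi * θ * Real.sin (Real.pi * θ) * sinWeight (y - μ * height θ)
      + sinWeight θ := by
    have := sinWeight_nonneg (y - μ * height θ)
    have := sinWeight_nonneg θ
    positivity
  have hZ := zetaConst_nonneg
  -- Any power of μ between −2/5 and −1/3 would do up to constants: below the cut μθ₀³ has to stay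
  -- small, above it θ^{-5/4} has to be O(√μ).
  set θ₀ : ℝ := 4⁻¹ * μ ^ (-(2 / 5) : ℝ) with hθ₀
  have hθ₀pos : 0 < θ₀ := by positivity
  rcases le_total θ θ₀ with h | h
  · refine le_add_of_le_of_nonneg ?_ (by positivity)
    have hh0 := (height_mem ⟨hθ0.le, hθ1.le⟩).1
    have hh : μ * height θ ≤ 1 / 16 := by
      have h3 : θ₀ ^ 3 = 1 / 64 * μ ^ (-(6 / 5) : ℝ) := by
        rw [hθ₀, mul_pow, ← Real.rpow_natCast, ← Real.rpow_natCast, ← Real.rpow_mul hμ0.le]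
        norm_num
      have h4 : μ * μ ^ (-(6 / 5) : ℝ) ≤ 1 := by
        nth_rewrite 1 [← Real.rpow_one μ]
        rw [← Real.rpow_add hμ0]
        exact Real.rpow_le_one_of_one_le_of_nonpos hμ (by norm_num)
      calc μ * height θ ≤ μ * (4 * θ₀ ^ 3) := by
            gcongr
            exact (height_le hθ0.le).trans (by gcongr)
        _ = (1 / 16) * (μ * μ ^ (-(6 / 5) : ℝ)) := by rw [h3]; ring
        _ ≤ 1 / 16 := by linarith
    have hlow : 1 / 4 ≤ |Real.sin (Real.pi * (y - μ * height θ))| := by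
      have : 0 ≤ μ * height θ := by positivity
      exact le_abs_sin_pi_mul (by linarith) (by linarith)
    calc _ ≤ ∑ i ∈ Finset.range n, (((i : ℝ) + 1) ^ 2)⁻¹ * 4 := by
          refine Finset.sum_le_sum fun i _ => (norm_kernel_sum_le hθ0.le i m hs).trans ?_
          gcongr
          rw [inv_le_comm₀ (by linarith) (by norm_num)]
          linarith
      _ ≤ 2 * 4 := by
          rw [← Finset.sum_mul]
          gcongr
          exact sum_range_inv_sq_le n
      _ = 8 := by norm_num
  · refine le_trans ?_ (le_add_of_nonneg_left (by norm_num : (0 : ℝ) ≤ 8))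
    refine (sum_norm_kernel_le hθ0 n m hs).trans ?_
    rw [mul_assoc]
    refine mul_le_mul_of_nonneg_left ?_ hZ
    set s := Real.sin (Real.pi * θ) with hsdef
    have hs1 : s ≤ 1 := Real.sin_le_one _
    have hδ : 0 < |Real.sin (Real.pi * (y - μ * height θ))| := abs_pos.mpr hs
    have hq := rpow_neg_quarter_le hδ (mul_pos hθ0 hsin)
    have hW : |Real.sin (Real.pi * (y - μ * height θ))| ^ (-(3 / 4) : ℝ)
      = sinWeight (y - μ * height θ) := rfl
    rw [hW] at hq
    set W := sinWeight (y - μ * height θ) with hWdef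
    have hW0 : 0 ≤ W := sinWeight_nonneg _
    have hθ₀le : θ₀ ^ (-(5 / 4) : ℝ) ≤ 8 * √μ := by
      rw [hθ₀, Real.mul_rpow (by norm_num) (by positivity), ← Real.rpow_mul hμ0.le,
        Real.sqrt_eq_rpow]
      have h1 : (4⁻¹ : ℝ) ^ (-(5 / 4) : ℝ) ≤ 8 := by
        rw [Real.inv_rpow (by norm_num), ← Real.rpow_neg (by norm_num)]
        calc (4 : ℝ) ^ (-(-(5 / 4)) : ℝ) ≤ (4 : ℝ) ^ (3 / 2 : ℝ) :=
              Real.rpow_le_rpow_of_exponent_le (by norm_num) (by norm_num)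
          _ = 8 := by
              rw [show (4 : ℝ) = 2 ^ (2 : ℝ) by norm_num, ← Real.rpow_mul (by norm_num)]
              norm_num
      have h2 : (-(2 / 5) : ℝ) * -(5 / 4) = 1 / 2 := by norm_num
      rw [h2]
      gcongr
    have hA : θ ^ (-(5 / 4) : ℝ) ≤ 8 * √μ :=
      (Real.rpow_le_rpow_of_nonpos hθ₀pos h (by norm_num)).trans hθ₀le
    have hB : θ ^ (-(3 / 4) : ℝ) ≤ 8 * √μ :=
      (Real.rpow_le_rpow_of_exponent_ge hθ0 hθ1.le (by norm_num)).trans hA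
    have hC : s ^ (-(1 / 2) : ℝ) ≤ sinWeight θ := by
      rw [sinWeight, abs_of_pos hsin]
      exact Real.rpow_le_rpow_of_exponent_ge hsin hs1 (by norm_num)
    calc _ ≤ θ ^ (-(3 / 4) : ℝ) * (θ * s * W + (θ * s) ^ (-(1 / 2) : ℝ)) := by gcongr
      _ = θ ^ (-(3 / 4) : ℝ) * (θ * s * W) + θ ^ (-(5 / 4) : ℝ) * s ^ (-(1 / 2) : ℝ) := by
          rw [Real.mul_rpow hθ0.le hsin.le,
            show (-(5 / 4) : ℝ) = -(3 / 4) + -(1 / 2) by norm_num, Real.rpow_add hθ0]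
          ring
      _ ≤ 8 * √μ * (Real.pi * θ * s * W) + 8 * √μ * sinWeight θ := by
          gcongr
          nlinarith [Real.pi_gt_three]
      _ = _ := by ring

/-- The terms left after one integration by parts outside the cone. -/
lemma norm_interior_sum_le {μ : ℝ} (hμ : 1 ≤ μ) {y : ℝ} (hy1 : -3 / 8 ≤ y) (hy2 : y ≤ -1 / 8)
    (x : ℝ) (n m : ℕ) :
    ‖∑ i ∈ Finset.range n, ∑ j ∈ Finset.range m, cis (-(i + 1) * x + (j + 1) * y) *
      ∫ θ in (0 : ℝ)..1, cis (-(μ * curvePhase (-(i + 1)) (j + 1) θ)) *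
        ((((-((i : ℝ) + 1) - (j + 1) * θ) ^ 2)⁻¹ : ℝ) : ℂ)‖ ≤ (8 + 192 * zetaConst) * √μ := by
  have hμ0 : 0 < μ := by linarith
  have hcc := continuous_cis
  set f : ℕ → ℕ → ℝ → ℂ := fun i j θ => cis (-(i + 1) * x + (j + 1) * y) *
    (cis (-(μ * curvePhase (-(i + 1)) (j + 1) θ)) *
        ((((-((i : ℝ) + 1) - (j + 1) * θ) ^ 2)⁻¹ : ℝ) : ℂ)) with hf
  have hfc : ∀ i j, ContinuousOn (f i j) (Set.uIcc 0 1) := by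
    intro i j
    have hcp := continuous_curvePhase (-((i : ℝ) + 1)) (j + 1)
    rw [Set.uIcc_of_le zero_le_one]
    refine continuousOn_const.mul (ContinuousOn.mul (by fun_prop)
      (Complex.continuous_ofReal.comp_continuousOn (ContinuousOn.inv₀ (by fun_prop) ?_)))
    intro θ hθ
    refine pow_ne_zero 2 (ne_of_lt ?_)
    have := hθ.1
    have : 0 ≤ ((j : ℝ) + 1) * θ := by positivity
    have : (0 : ℝ) ≤ i := Nat.cast_nonneg i
    linarith
  have hfi : ∀ i j, IntervalIntegrable (f i j) MeasureTheory.volume 0 1 :=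
    fun i j => (hfc i j).intervalIntegrable
  have hfs : ∀ i, IntervalIntegrable (fun θ => ∑ j ∈ Finset.range m, f i j θ)
      MeasureTheory.volume 0 1 := by
    intro i
    exact (continuousOn_finsetSum _ fun j _ => hfc i j).intervalIntegrable
  have e : ∑ i ∈ Finset.range n, ∑ j ∈ Finset.range m, cis (-(i + 1) * x + (j + 1) * y) *
      ∫ θ in (0 : ℝ)..1, cis (-(μ * curvePhase (-(i + 1)) (j + 1) θ)) *
        ((((-((i : ℝ) + 1) - (j + 1) * θ) ^ 2)⁻¹ : ℝ) : ℂ)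
      = ∫ θ in (0 : ℝ)..1, ∑ i ∈ Finset.range n, ∑ j ∈ Finset.range m, f i j θ := by
    rw [intervalIntegral.integral_finsetSum fun i _ => hfs i]
    refine Finset.sum_congr rfl fun i _ => ?_
    rw [intervalIntegral.integral_finsetSum fun j _ => hfi i j]
    refine Finset.sum_congr rfl fun j _ => ?_
    simp only [hf]
    rw [intervalIntegral.integral_const_mul]
  -- At fixed θ, both x and the term with cos πθ enter through a unimodular factor depending on i
  -- only; the sum over j oscillates with frequency y − μ `height θ`.
  have hptw : ∀ θ, ‖∑ i ∈ Finset.range n, ∑ j ∈ Finset.range m, f i j θ‖ ≤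
      ∑ i ∈ Finset.range n, ‖∑ j ∈ Finset.range m, (((((i : ℝ) + 1 + (j + 1) * θ) ^ 2)⁻¹ : ℝ) : ℂ)
      * cis ((j + 1) * (y - μ * height θ))‖ := by
    intro θ
    refine (norm_sum_le _ _).trans (Finset.sum_le_sum fun i _ => le_of_eq ?_)
    have : ∑ j ∈ Finset.range m, f i j θ
        = cis (-(i + 1) * x + μ * ((i + 1) * Real.cos (Real.pi * θ))) * ∑ j ∈ Finset.range m,
          (((((i : ℝ) + 1 + (j + 1) * θ) ^ 2)⁻¹ : ℝ) : ℂ)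
          * cis ((j + 1) * (y - μ * height θ)) := by
      rw [Finset.mul_sum]
      refine Finset.sum_congr rfl fun j _ => ?_
      simp only [hf]
      rw [← mul_assoc, ← cis_add, mul_left_comm, ← cis_add, mul_comm]
      rw [show (-((i : ℝ) + 1) - (j + 1) * θ) ^ 2 = ((i : ℝ) + 1 + (j + 1) * θ) ^ 2 by ring]
      congr 2
      rw [curvePhase]; ring
    rw [this, norm_mul, norm_cis, one_mul]
  rw [e]
  obtain ⟨hi1, hle1⟩ := integral_sinWeight_height_le hμ y
  have hi2 := intervalIntegrable_sinWeight_zero_one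
  have hle2 := integral_sinWeight_le
  have hZ := zetaConst_nonneg
  have hbound : ‖∫ θ in (0 : ℝ)..1, ∑ i ∈ Finset.range n, ∑ j ∈ Finset.range m, f i j θ‖ ≤
      ∫ θ in (0 : ℝ)..1, (8 + zetaConst * (8 * √μ) *
      (Real.pi * θ * Real.sin (Real.pi * θ) * sinWeight (y - μ * height θ) + sinWeight θ)) := by
    refine intervalIntegral.norm_integral_le_of_norm_le zero_le_one ?_
      (intervalIntegrable_const.add ((hi1.add hi2).const_mul _))
    have h1 := (countable_setOf_sin_height_eq_zero hμ0 y).ae_notMem MeasureTheory.volume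
    have h2 : ∀ᵐ θ : ℝ, θ ≠ 1 := by simp [MeasureTheory.ae_iff]
    filter_upwards [h1, h2] with θ hθ hθ1 hmem
    have hlt : θ < 1 := lt_of_le_of_ne hmem.2 hθ1
    refine (hptw θ).trans (sum_norm_kernel_height_le hμ hy1 hy2 hmem.1 hlt (fun h => ?_) n m)
    exact hθ ⟨⟨hmem.1.le, hmem.2⟩, h⟩
  refine hbound.trans ?_
  rw [intervalIntegral.integral_add intervalIntegrable_const ((hi1.add hi2).const_mul _),
    intervalIntegral.integral_const_mul, intervalIntegral.integral_add hi1 hi2]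
  have hs1 : 1 ≤ √μ := Real.one_le_sqrt.mpr hμ
  -- 16 bounds the integral in the variable `height θ`, 8 the integral of `sinWeight θ`; 192 = 8 ·
  -- 24.
  calc _ ≤ 8 + zetaConst * (8 * √μ) * (16 + 8) := by
        gcongr
        simp
    _ ≤ _ := by nlinarith


/-! ### Summation over the two sectors outside the cone -/

/-- The frequencies `(-(i+1), j+1)`. -/
def leftFreq (p : ℕ × ℕ) : ℤ × ℤ := (-((p.1 : ℤ) + 1), (p.2 : ℤ) + 1)

/-- The frequencies `(i+j+2, j+1)`. -/
def rightFreq (p : ℕ × ℕ) : ℤ × ℤ := ((p.1 : ℤ) + p.2 + 2, (p.2 : ℤ) + 1)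

/-- The frequencies `(i+1, i+j+2)` of the cone. -/
def coneFreq (p : ℕ × ℕ) : ℤ × ℤ := ((p.1 : ℤ) + 1, (p.1 : ℤ) + p.2 + 2)

lemma curveCoeff_rightFreq (μ : ℝ) (p : ℕ × ℕ) :
    curveCoeff μ (rightFreq p) = curveCoeff μ (leftFreq p) := by
  have h := curveInt_symm μ ((leftFreq p).1) ((leftFreq p).2)
  rw [curveCoeff, curveCoeff, ← h]
  simp only [rightFreq, leftFreq]
  congr 2
  push_cast; ring

/-- One integration by parts, legitimate because a − bθ ≤ −(i+1) on [0, 1]. The factor b in front of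
the remaining integral cancels the 1/k₂ of the coefficient. -/
lemma curveCoeff_leftFreq (μ : ℝ) (i j : ℕ) :
    curveCoeff μ (leftFreq (i, j)) = (((4 * Real.pi ^ 2)⁻¹ : ℝ) : ℂ) *
      ((((j : ℝ) + 1)⁻¹ : ℝ) * ((((i : ℝ) + j + 2)⁻¹ : ℝ) * cis (-(μ * (i + j + 2)))
        - (((i : ℝ) + 1)⁻¹ : ℝ) * cis (μ * (i + 1)))
        + ∫ θ in (0 : ℝ)..1, cis (-(μ * curvePhase (-(i + 1)) (j + 1) θ)) *
          ((((-((i : ℝ) + 1) - (j + 1) * θ) ^ 2)⁻¹ : ℝ) : ℂ)) := by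
  have hi : (0 : ℝ) ≤ i := Nat.cast_nonneg i
  have hj : (0 : ℝ) ≤ j := Nat.cast_nonneg j
  have h := curveInt_eq_of_ne (μ := μ) (a := -((i : ℝ) + 1)) (b := (j : ℝ) + 1) (fun θ hθ => by
    have := hθ.1
    have : 0 ≤ ((j : ℝ) + 1) * θ := by positivity
    linarith)
  set X := ∫ θ in (0 : ℝ)..1, cis (-(μ * curvePhase (-(i + 1)) (j + 1) θ)) *
          ((((-((i : ℝ) + 1) - (j + 1) * θ) ^ 2)⁻¹ : ℝ) : ℂ) with hX
  rw [show (j : ℝ) + 1 - -((i : ℝ) + 1) = i + j + 2 by ring,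
    show -(μ * -((i : ℝ) + 1)) = μ * (i + 1) by ring,
    show -((i : ℝ) + 1) - (j + 1) = -(i + j + 2) by ring] at h
  have e : curveCoeff μ (leftFreq (i, j)) = -(((4 * Real.pi ^ 2)⁻¹ : ℝ) : ℂ) *
      (((j : ℝ) + 1)⁻¹ : ℝ) * (2 * Real.pi * Complex.I * μ *
        curveInt μ (-((i : ℝ) + 1)) ((j : ℝ) + 1)) := by
    have hpi : (Real.pi : ℂ) ≠ 0 := Complex.ofReal_ne_zero.mpr Real.pi_ne_zero
    have hj1 : (j : ℂ) + 1 ≠ 0 := Nat.cast_add_one_ne_zero j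
    have hI := Complex.I_ne_zero
    simp only [curveCoeff, leftFreq]
    push_cast
    field_simp
    simp only [Complex.I_sq]
    ring
  rw [e, h]
  have hi1 : (i : ℂ) + 1 ≠ 0 := Nat.cast_add_one_ne_zero i
  have hj1 : (j : ℂ) + 1 ≠ 0 := Nat.cast_add_one_ne_zero j
  have hij : (i : ℂ) + j + 2 ≠ 0 := by
    have : ((i + j + 1 : ℕ) : ℂ) + 1 ≠ 0 := Nat.cast_add_one_ne_zero _
    intro h0; apply this; push_cast; linear_combination h0
  push_cast
  field_simp
  ring

/-- The two sectors have to be added before estimating. The end point t = 1 contributes exponentials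
in x − μ and t = −1 exponentials in −(x + μ), and for each of them one half of the difference
required by `norm_endpoint_sum_le` comes from the left sector and the other half from the right. -/
lemma norm_off_cone_sum_le {μ : ℝ} (hμ : 1 ≤ μ) {x : ℝ × ℝ} (hx : x ∈ offLattice) (n m : ℕ) :
    ‖∑ i ∈ Finset.range n, ∑ j ∈ Finset.range m, (curveCoeff μ (leftFreq (i, j)) *
      cis (dot (leftFreq (i, j)) x) + curveCoeff μ (rightFreq (i, j)) *
      cis (dot (rightFreq (i, j)) x))‖ ≤ (96 + 384 * zetaConst) * √μ := by
  obtain ⟨h1, h2, h3, h4⟩ := hx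
  obtain ⟨x, y⟩ := x
  simp only at h1 h2 h3 h4
  have hs1 : 1 ≤ √μ := Real.one_le_sqrt.mpr hμ
  set I : ℕ → ℕ → ℂ := fun i j => ∫ θ in (0 : ℝ)..1,
    cis (-(μ * curvePhase (-(i + 1)) (j + 1) θ)) *
          ((((-((i : ℝ) + 1) - (j + 1) * θ) ^ 2)⁻¹ : ℝ) : ℂ) with hI
  set E : ℝ → ℝ → ℂ := fun w y => ∑ j ∈ Finset.range m, (((j : ℝ) + 1)⁻¹ : ℝ) *
      cis ((j + 1) * y) * ∑ i ∈ Finset.range n, ((((i : ℝ) + j + 2)⁻¹ : ℝ) * cis ((i + j + 2) * w)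
        - (((i : ℝ) + 1)⁻¹ : ℝ) * cis (-((i + 1) * w))) with hE
  set Q : ℝ → ℝ → ℂ := fun x y => ∑ i ∈ Finset.range n, ∑ j ∈ Finset.range m,
    cis (-(i + 1) * x + (j + 1) * y) * I i j with hQ
  have hEb : ∀ w y, -3 / 8 ≤ y → y ≤ -1 / 8 → ‖E w y‖ ≤ 40 := by
    intro w y hy1 hy2
    have hl := le_abs_sin_pi_mul (y := y) (by linarith) (by linarith)
    have hne : Real.sin (Real.pi * y) ≠ 0 := abs_pos.mp (by linarith)
    refine (norm_endpoint_sum_le hne w n m).trans ?_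
    have : |Real.sin (Real.pi * y)|⁻¹ ≤ 4 := by
      rw [inv_le_comm₀ (by linarith) (by norm_num)]; linarith
    linarith
  have hc : ‖(((4 * Real.pi ^ 2)⁻¹ : ℝ) : ℂ)‖ ≤ 1 := by
    rw [Complex.norm_real, Real.norm_of_nonneg (by positivity)]
    refine inv_le_one_of_one_le₀ ?_
    nlinarith [Real.pi_gt_three]
  have key : ∑ i ∈ Finset.range n, ∑ j ∈ Finset.range m, (curveCoeff μ (leftFreq (i, j)) *
      cis (dot (leftFreq (i, j)) (x, y)) + curveCoeff μ (rightFreq (i, j)) *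
      cis (dot (rightFreq (i, j)) (x, y))) = (((4 * Real.pi ^ 2)⁻¹ : ℝ) : ℂ) *
      (E (x - μ) y + E (-(x + μ)) (x + y) + Q x y + Q (-x) (x + y)) := by
    have hE' : ∀ w y, E w y = ∑ i ∈ Finset.range n, ∑ j ∈ Finset.range m,
        (((j : ℝ) + 1)⁻¹ : ℝ) * cis ((j + 1) * y) * ((((i : ℝ) + j + 2)⁻¹ : ℝ) *
          cis ((i + j + 2) * w) - (((i : ℝ) + 1)⁻¹ : ℝ) * cis (-((i + 1) * w))) := by
      intro w y
      simp only [hE]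
      rw [Finset.sum_comm]
      exact Finset.sum_congr rfl fun j _ => Finset.mul_sum _ _ _
    rw [hE', hE']
    simp only [hQ, ← Finset.sum_add_distrib, Finset.mul_sum]
    refine Finset.sum_congr rfl fun i _ => Finset.sum_congr rfl fun j _ => ?_
    rw [curveCoeff_rightFreq, curveCoeff_leftFreq]
    simp only [dot, leftFreq, rightFreq]
    push_cast
    have e1 : cis (-((i : ℝ) + 1) * x + (j + 1) * y)
        = cis (-((i + 1) * (x - μ))) * cis ((j + 1) * y) * cis (-(μ * (i + 1))) := by
      rw [← cis_add, ← cis_add]; congr 1; ring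
    have e2 : cis (-((i : ℝ) + 1) * x + (j + 1) * y)
        = cis ((i + j + 2) * (-(x + μ))) * cis ((j + 1) * (x + y)) * cis (μ * (i + j + 2)) := by
      rw [← cis_add, ← cis_add]; congr 1; ring
    have e3 : cis (((i : ℝ) + j + 2) * x + (j + 1) * y)
        = cis ((i + j + 2) * (x - μ)) * cis ((j + 1) * y) * cis (μ * (i + j + 2)) := by
      rw [← cis_add, ← cis_add]; congr 1; ring
    have e4 : cis (((i : ℝ) + j + 2) * x + (j + 1) * y)
        = cis (-((i + 1) * (-(x + μ)))) * cis ((j + 1) * (x + y)) * cis (-(μ * (i + 1))) := by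
      rw [← cis_add, ← cis_add]; congr 1; ring
    have e5 : cis (-((i : ℝ) + 1) * -x + (j + 1) * (x + y))
        = cis (((i : ℝ) + j + 2) * x + (j + 1) * y) := by congr 1; ring
    have e6 : ∀ t, cis (-t) * cis t = 1 := fun t => by rw [← cis_add, neg_add_cancel, cis_zero]
    rw [e5]
    have e7 := e6 (μ * (i + 1))
    have e8 := e6 (μ * (i + j + 2))
    set A := cis (-((i : ℝ) + 1) * x + (j + 1) * y)
    set B := cis (((i : ℝ) + j + 2) * x + (j + 1) * y)
    set u := cis (μ * ((i : ℝ) + 1))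
    set u' := cis (-(μ * ((i : ℝ) + 1)))
    set v := cis (μ * ((i : ℝ) + j + 2))
    set v' := cis (-(μ * ((i : ℝ) + j + 2)))
    have f1 : cis (-((i + 1) * (x - μ))) * cis ((j + 1) * y) = A * u := by
      rw [e1, mul_assoc _ u' u, e7, mul_one]
    have f2 : cis ((i + j + 2) * (-(x + μ))) * cis ((j + 1) * (x + y)) = A * v' := by
      rw [e2, mul_assoc _ v v', mul_comm v v', e8, mul_one]
    have f3 : cis ((i + j + 2) * (x - μ)) * cis ((j + 1) * y) = B * v' := by
      rw [e3, mul_assoc _ v v', mul_comm v v', e8, mul_one]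
    have f4 : cis (-((i + 1) * (-(x + μ)))) * cis ((j + 1) * (x + y)) = B * u := by
      rw [e4, mul_assoc _ u' u, e7, mul_one]
    have hIij : (∫ θ in (0 : ℝ)..1, cis (-(μ * curvePhase (-(i + 1)) (j + 1) θ)) *
          (((-((i : ℂ) + 1) - (j + 1) * θ) ^ 2)⁻¹)) = I i j := by
      simp only [hI]; push_cast; rfl
    rw [hIij]
    linear_combination (4 * (Real.pi : ℂ) ^ 2)⁻¹ * ((j : ℂ) + 1)⁻¹ * (((i : ℂ) + 1)⁻¹ * (f1 + f4)
      - ((i : ℂ) + j + 2)⁻¹ * (f2 + f3))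
  rw [key, norm_mul]
  have hQ1 : ‖Q x y‖ ≤ (8 + 192 * zetaConst) * √μ := norm_interior_sum_le hμ h1 h2 x n m
  have hQ2 : ‖Q (-x) (x + y)‖ ≤ (8 + 192 * zetaConst) * √μ :=
    norm_interior_sum_le hμ h3 h4 (-x) n m
  calc _ ≤ 1 * (40 + 40 + (8 + 192 * zetaConst) * √μ + (8 + 192 * zetaConst) * √μ) := by
        gcongr
        refine (norm_add_le _ _).trans (add_le_add ((norm_add_le _ _).trans (add_le_add
          ((norm_add_le _ _).trans (add_le_add ?_ ?_)) hQ1)) hQ2)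
        · exact hEb _ _ h1 h2
        · exact hEb _ _ h3 h4
    _ ≤ _ := by linarith


/-! ### The mollifier and summability of ρ̂(εk) -/

/-- The properties of the mollifier that the argument uses. -/
structure IsMollifier (ρ : Plane → ℝ) : Prop where
  contDiff : ContDiff ℝ ∞ ρ
  hasCompactSupport : HasCompactSupport ρ
  nonneg : ∀ x, 0 ≤ ρ x
  integral_eq_one : ∫ x, ρ x = 1
  norm_le_one : ∀ x, ρ x ≠ 0 → ‖x‖ ≤ 1

/-- The values `ρ̂(εk)`. -/
noncomputable def rhoHat (ρ : Plane → ℝ) (ε : ℝ) (k : ℤ × ℤ) : ℂ :=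
  𝓕 (fun x : Plane => (ρ x : ℂ)) (ε • intVec k)

lemma rhoHat_eq (ρ : Plane → ℝ) (ε : ℝ) (k : ℤ × ℤ) :
    rhoHat ρ ε k = ∫ v : Plane, (ρ v : ℂ) * cis (-dot k (ε * v 0, ε * v 1)) := by
  rw [rhoHat, Real.fourier_eq']
  refine MeasureTheory.integral_congr_ae (Filter.Eventually.of_forall fun v => ?_)
  simp only [smul_eq_mul]
  rw [mul_comm, cis]
  congr 3
  rw [inner_smul_right, PiLp.inner_apply, Fin.sum_univ_two]
  simp only [intVec_apply_zero, intVec_apply_one, dot]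
  simp
  ring

lemma rhoHat_neg (ρ : Plane → ℝ) (ε : ℝ) (k : ℤ × ℤ) :
    rhoHat ρ ε (-k) = (starRingEnd ℂ) (rhoHat ρ ε k) := by
  rw [rhoHat_eq, rhoHat_eq, ← integral_conj]
  congr 1; ext v
  rw [map_mul, Complex.conj_ofReal, ← cis_neg]
  congr 2
  simp [dot]
  ring

lemma IsMollifier.integrable {ρ : Plane → ℝ} (hρ : IsMollifier ρ) : MeasureTheory.Integrable ρ :=
  hρ.contDiff.continuous.integrable_of_hasCompactSupport hρ.hasCompactSupport

lemma abs_apply_le_norm (v : Plane) (i : Fin 2) : |v i| ≤ ‖v‖ := by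
  have := PiLp.norm_apply_le v i
  rwa [Real.norm_eq_abs] at this

/-- Averaging a bounded trigonometric polynomial against `ρ` multiplies its coefficients
by `ρ̂(εk)` and keeps the bound. -/
lemma IsMollifier.norm_sum_le {ρ : Plane → ℝ} (hρ : IsMollifier ρ) {ε : ℝ} (hε : 0 < ε)
    {ι : Type*} (s : Finset ι) (a : ι → ℂ) (κ : ι → ℤ × ℤ) (z : ℝ × ℝ) {B : ℝ}
    (hB : ∀ u v : ℝ, |u| ≤ ε → |v| ≤ ε →
      ‖∑ i ∈ s, a i * cis (dot (κ i) (z.1 - u, z.2 - v))‖ ≤ B) :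
    ‖∑ i ∈ s, a i * rhoHat ρ ε (κ i) * cis (dot (κ i) z)‖ ≤ B := by
  have hcc := continuous_cis
  have hρi := hρ.integrable
  have hint : ∀ f : Plane → ℂ, Continuous f →
      MeasureTheory.Integrable (fun v => (ρ v : ℂ) * f v) := by
    intro f hf
    refine Continuous.integrable_of_hasCompactSupport
      ((Complex.continuous_ofReal.comp hρ.contDiff.continuous).mul hf) ?_
    exact (hρ.hasCompactSupport.comp_left (g := fun x : ℝ => (x : ℂ)) (by simp)).mul_right
  have e : ∑ i ∈ s, a i * rhoHat ρ ε (κ i) * cis (dot (κ i) z)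
      = ∫ v : Plane, (ρ v : ℂ) * ∑ i ∈ s, a i * cis (dot (κ i) (z.1 - ε * v 0, z.2 - ε * v 1)) := by
    simp_rw [Finset.mul_sum]
    rw [MeasureTheory.integral_finsetSum]
    · refine Finset.sum_congr rfl fun i _ => ?_
      rw [rhoHat_eq, mul_right_comm, ← MeasureTheory.integral_const_mul]
      congr 1; ext v
      rw [show dot (κ i) (z.1 - ε * v 0, z.2 - ε * v 1)
        = dot (κ i) z + -dot (κ i) (ε * v 0, ε * v 1) by simp only [dot]; ring, cis_add]
      ring
    · intro i _
      refine hint _ ?_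
      unfold dot
      fun_prop
  rw [e]
  have hρB : MeasureTheory.Integrable fun v => ρ v * B := hρi.mul_const B
  calc _ ≤ ∫ v, ρ v * B := by
        refine MeasureTheory.norm_integral_le_of_norm_le hρB (Filter.Eventually.of_forall fun v => ?_)
        rw [norm_mul, Complex.norm_real, Real.norm_of_nonneg (hρ.nonneg v)]
        by_cases h0 : ρ v = 0
        · simp [h0]
        refine mul_le_mul_of_nonneg_left (hB _ _ ?_ ?_) (hρ.nonneg v)
        · rw [abs_mul, abs_of_pos hε]
          exact mul_le_of_le_one_right hε.le ((abs_apply_le_norm v 0).trans (hρ.norm_le_one v h0))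
        · rw [abs_mul, abs_of_pos hε]
          exact mul_le_of_le_one_right hε.le ((abs_apply_le_norm v 1).trans (hρ.norm_le_one v h0))
    _ = B := by rw [MeasureTheory.integral_mul_const, hρ.integral_eq_one, one_mul]

lemma IsMollifier.norm_rhoHat_le {ρ : Plane → ℝ} (hρ : IsMollifier ρ) (ε : ℝ) (k : ℤ × ℤ) :
    ‖rhoHat ρ ε k‖ ≤ 1 := by
  rw [rhoHat_eq, ← hρ.integral_eq_one]
  refine MeasureTheory.norm_integral_le_of_norm_le hρ.integrable
    (Filter.Eventually.of_forall fun v => ?_)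
  rw [norm_mul, norm_cis, mul_one, Complex.norm_real, Real.norm_of_nonneg (hρ.nonneg v)]

/-- Fourth order decay of the Schwartz function ρ̂ dominates the product (1 + k₁²)⁻¹(1 + k₂²)⁻¹,
which is summable. The size of the sum depends on ε and ρ; it is used only for convergence, never in
an estimate. -/
lemma IsMollifier.summable_norm_rhoHat {ρ : Plane → ℝ} (hρ : IsMollifier ρ) {ε : ℝ} (hε : 0 < ε) :
    Summable fun k : ℤ × ℤ => ‖rhoHat ρ ε k‖ := by
  have hc : HasCompactSupport fun x : Plane => (ρ x : ℂ) :=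
    hρ.hasCompactSupport.comp_left (g := fun x : ℝ => (x : ℂ)) (by simp)
  have hd : ContDiff ℝ ∞ fun x : Plane => (ρ x : ℂ) := Complex.ofRealCLM.contDiff.comp hρ.contDiff
  set f : SchwartzMap Plane ℂ := hc.toSchwartzMap hd with hf
  obtain ⟨C, hC0, hC⟩ := (𝓕 f).decay 4 0
  have hdec : ∀ k : ℤ × ℤ, (ε * ‖intVec k‖) ^ 4 * ‖rhoHat ρ ε k‖ ≤ C := by
    intro k
    have := hC (ε • intVec k)
    rw [norm_iteratedFDeriv_zero, norm_smul, Real.norm_of_nonneg hε.le] at this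
    exact this
  have hs : Summable fun n : ℤ => (1 + (n : ℝ) ^ 2)⁻¹ := by
    refine Summable.of_norm_bounded_eventually (Real.summable_one_div_int_pow.mpr one_lt_two) ?_
    filter_upwards [(Set.finite_singleton (0 : ℤ)).compl_mem_cofinite] with n hn
    have hn0 : (n : ℝ) ≠ 0 := Int.cast_ne_zero.mpr hn
    rw [Real.norm_of_nonneg (by positivity), one_div]
    gcongr
    linarith
  have hs2 := (hs.mul_of_nonneg hs (fun _ => by positivity) (fun _ => by positivity)).mul_left
    (4 * (1 + C / ε ^ 4))
  refine Summable.of_nonneg_of_le (fun _ => norm_nonneg _) (fun k => ?_) hs2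
  have hr := norm_intVec_sq k
  have h1 := hρ.norm_rhoHat_le ε k
  have h2 : (‖intVec k‖ ^ 2) ^ 2 * ‖rhoHat ρ ε k‖ ≤ C / ε ^ 4 := by
    rw [le_div_iff₀ (by positivity)]
    calc _ = (ε * ‖intVec k‖) ^ 4 * ‖rhoHat ρ ε k‖ := by ring
      _ ≤ C := hdec k
  rw [hr] at h2
  have hX := norm_nonneg (rhoHat ρ ε k)
  set X := ‖rhoHat ρ ε k‖
  set a := (k.1 : ℝ) ^ 2
  set b := (k.2 : ℝ) ^ 2
  have ha : 0 ≤ a := sq_nonneg _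
  have hb : 0 ≤ b := sq_nonneg _
  rw [← mul_inv, ← div_eq_mul_inv, le_div_iff₀ (by positivity)]
  have h3 : (1 + a) * (1 + b) ≤ 4 * (1 + (a + b) ^ 2) := by
    nlinarith [sq_nonneg (a + b - 1), sq_nonneg (a - b), mul_nonneg ha hb]
  calc X * ((1 + a) * (1 + b)) ≤ X * (4 * (1 + (a + b) ^ 2)) := by gcongr
    _ = 4 * (X + (a + b) ^ 2 * X) := by ring
    _ ≤ 4 * (1 + C / ε ^ 4) := by gcongr

lemma norm_curveCoeff_le {μ : ℝ} (hμ : 0 ≤ μ) (k : ℤ × ℤ) : ‖curveCoeff μ k‖ ≤ μ := by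
  rw [curveCoeff, norm_mul, norm_div, norm_mul, norm_mul, norm_mul, Complex.norm_I,
    Complex.norm_real, Complex.norm_real, Real.norm_of_nonneg hμ, Complex.norm_ofNat,
    Real.norm_of_nonneg Real.pi_pos.le, mul_one, Complex.norm_intCast]
  rcases eq_or_ne k.2 0 with h | h
  · simp [h, hμ]
  have h1 : (1 : ℝ) ≤ |(k.2 : ℝ)| := by exact_mod_cast Int.one_le_abs h
  have h2 : 2 ≤ 2 * Real.pi * |(k.2 : ℝ)| := by nlinarith [Real.pi_gt_three]
  calc _ ≤ μ / (2 * Real.pi * |(k.2 : ℝ)|) * 2 := by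
        gcongr; exact norm_curveInt_le _ _ _
    _ ≤ μ / 2 * 2 := by gcongr
    _ = μ := by ring

lemma curveCoeff_neg (μ : ℝ) (k : ℤ × ℤ) :
    curveCoeff μ (-k) = (starRingEnd ℂ) (curveCoeff μ k) := by
  rw [curveCoeff, curveCoeff, map_mul, ← curveInt_neg, map_div₀]
  simp only [Prod.fst_neg, Prod.snd_neg, Int.cast_neg, map_mul, Complex.conj_ofReal, Complex.conj_I,
    map_ofNat, map_intCast]
  congr 2
  ring

/-- The Fourier coefficients of the mollified sum, evaluated at the point `z`. -/
noncomputable def mollTerm (ρ : Plane → ℝ) (μ ε : ℝ) (z : ℝ × ℝ) (k : ℤ × ℤ) : ℂ :=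
  curveCoeff μ k * rhoHat ρ ε k * cis (dot k z)

lemma mollTerm_neg (ρ : Plane → ℝ) (μ ε : ℝ) (z : ℝ × ℝ) (k : ℤ × ℤ) :
    mollTerm ρ μ ε z (-k) = (starRingEnd ℂ) (mollTerm ρ μ ε z k) := by
  rw [mollTerm, mollTerm, map_mul, map_mul, ← curveCoeff_neg, ← rhoHat_neg, ← cis_neg]
  congr 2
  simp [dot]; ring

lemma IsMollifier.summable_mul {ρ : Plane → ℝ} (hρ : IsMollifier ρ) {ε : ℝ} (hε : 0 < ε)
    {a : ℤ × ℤ → ℂ} {B : ℝ} (ha : ∀ k, ‖a k‖ ≤ B) (z : ℝ × ℝ) :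
    Summable fun k : ℤ × ℤ => a k * rhoHat ρ ε k * cis (dot k z) := by
  refine Summable.of_norm_bounded ((hρ.summable_norm_rhoHat hε).mul_left B) fun k => ?_
  rw [norm_mul, norm_mul, norm_cis, mul_one]
  exact mul_le_mul_of_nonneg_right (ha k) (norm_nonneg _)

lemma IsMollifier.summable_mollTerm {ρ : Plane → ℝ} (hρ : IsMollifier ρ) {ε : ℝ} (hε : 0 < ε)
    {μ : ℝ} (hμ : 0 ≤ μ) (z : ℝ × ℝ) : Summable (mollTerm ρ μ ε z) :=
  hρ.summable_mul hε (norm_curveCoeff_le hμ) z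

/-- Summability identifies the sum with the limit along squares, so bounds for square partial sums,
which use cancellation, pass to the full series. -/
lemma norm_tsum_prod_le {F : ℕ × ℕ → ℂ} (hF : Summable F) {B : ℝ}
    (hB : ∀ n : ℕ, ‖∑ p ∈ Finset.range n ×ˢ Finset.range n, F p‖ ≤ B) : ‖∑' p, F p‖ ≤ B := by
  have ht : Filter.Tendsto (fun n : ℕ => Finset.range n ×ˢ Finset.range n) Filter.atTop
      Filter.atTop := by
    refine Filter.tendsto_atTop_finset_of_monotone ?_ ?_
    · intro a b hab
      exact Finset.product_subset_product (Finset.range_mono hab) (Finset.range_mono hab)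
    · rintro ⟨a, b⟩
      refine ⟨max a b + 1, ?_⟩
      simp only [Finset.mem_product, Finset.mem_range]
      omega
  exact le_of_tendsto (hF.hasSum.comp ht).norm (Filter.Eventually.of_forall hB)

/-! ### Enumeration of the frequencies -/

lemma leftFreq_injective : Function.Injective leftFreq := by
  rintro ⟨a, b⟩ ⟨c, d⟩ h
  simp only [leftFreq, Prod.mk.injEq] at h ⊢
  omega

lemma rightFreq_injective : Function.Injective rightFreq := by
  rintro ⟨a, b⟩ ⟨c, d⟩ h
  simp only [rightFreq, Prod.mk.injEq] at h ⊢
  omega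

lemma coneFreq_injective : Function.Injective coneFreq := by
  rintro ⟨a, b⟩ ⟨c, d⟩ h
  simp only [coneFreq, Prod.mk.injEq] at h ⊢
  omega

/-- The frequencies `(0, j+1)`. -/
def axisFreq (j : ℕ) : ℤ × ℤ := (0, (j : ℤ) + 1)

/-- The frequencies `(j+1, j+1)`. -/
def diagFreq (j : ℕ) : ℤ × ℤ := ((j : ℤ) + 1, (j : ℤ) + 1)

lemma axisFreq_injective : Function.Injective axisFreq := by
  intro a b h
  simp only [axisFreq, Prod.mk.injEq] at h
  omega

lemma diagFreq_injective : Function.Injective diagFreq := by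
  intro a b h
  simp only [diagFreq, Prod.mk.injEq] at h
  omega

/-- An enumeration of the frequencies with positive second coordinate. -/
def upperFreq : (ℕ × ℕ) ⊕ ((ℕ × ℕ) ⊕ (ℕ × ℕ)) ⊕ (ℕ ⊕ ℕ) → ℤ × ℤ :=
  Sum.elim coneFreq (Sum.elim (Sum.elim leftFreq rightFreq) (Sum.elim axisFreq diagFreq))

lemma upperFreq_injective : Function.Injective upperFreq := by
  rintro (⟨a, b⟩ | (⟨a, b⟩ | ⟨a, b⟩) | a | a) (⟨c, d⟩ | (⟨c, d⟩ | ⟨c, d⟩) | c | c) h <;>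
  simp only [upperFreq, Sum.elim_inl, Sum.elim_inr, leftFreq, rightFreq, coneFreq, axisFreq,
    diagFreq, Prod.mk.injEq, Sum.inl.injEq, Sum.inr.injEq, reduceCtorEq] at h ⊢ <;> omega

lemma upperFreq_snd_pos (s) : 0 < (upperFreq s).2 := by
  rcases s with (⟨a, b⟩ | (⟨a, b⟩ | ⟨a, b⟩) | a | a) <;>
  simp only [upperFreq, Sum.elim_inl, Sum.elim_inr, leftFreq, rightFreq, coneFreq, axisFreq,
    diagFreq] <;> omega

lemma exists_upperFreq {k : ℤ × ℤ} (hk : 0 < k.2) : ∃ s, upperFreq s = k := by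
  obtain ⟨a, b⟩ := k
  simp only at hk
  rcases lt_trichotomy a 0 with h | h | h
  · refine ⟨.inr (.inl (.inl ((-a - 1).toNat, (b - 1).toNat))), ?_⟩
    simp only [upperFreq, Sum.elim_inl, Sum.elim_inr, leftFreq, Prod.mk.injEq]
    omega
  · refine ⟨.inr (.inr (.inl (b - 1).toNat)), ?_⟩
    simp only [upperFreq, Sum.elim_inl, Sum.elim_inr, axisFreq, Prod.mk.injEq]
    omega
  rcases lt_trichotomy a b with h' | h' | h'
  · refine ⟨.inl ((a - 1).toNat, (b - a - 1).toNat), ?_⟩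
    simp only [upperFreq, Sum.elim_inl, coneFreq, Prod.mk.injEq]
    omega
  · refine ⟨.inr (.inr (.inr (b - 1).toNat)), ?_⟩
    simp only [upperFreq, Sum.elim_inr, diagFreq, Prod.mk.injEq]
    omega
  · refine ⟨.inr (.inl (.inr ((a - b - 1).toNat, (b - 1).toNat))), ?_⟩
    simp only [upperFreq, Sum.elim_inl, Sum.elim_inr, rightFreq, Prod.mk.injEq]
    omega

lemma tsum_eq_upper_add_lower {f : ℤ × ℤ → ℂ} (hf : Summable f) (h0 : ∀ k : ℤ × ℤ, k.2 = 0 → f k = 0) :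
    ∑' k, f k = ∑' s, f (upperFreq s) + ∑' s, f (-upperFreq s) := by
  set Ψ := Sum.elim upperFreq (fun s => -upperFreq s) with hΨ
  have hinj : Function.Injective Ψ := by
    refine upperFreq_injective.sumElim (neg_injective.comp upperFreq_injective) ?_
    intro s t h
    have h1 := upperFreq_snd_pos s
    have h2 := upperFreq_snd_pos t
    rw [h, Prod.snd_neg] at h1
    omega
  rw [← hinj.tsum_eq, Summable.tsum_sum]
  · rfl
  · exact hf.comp_injective upperFreq_injective
  · exact hf.comp_injective (neg_injective.comp upperFreq_injective)
  · intro k hk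
    rcases lt_trichotomy k.2 0 with h | h | h
    · obtain ⟨s, hs⟩ := exists_upperFreq (k := -k) (by simpa using h)
      exact ⟨.inr s, by simp [hΨ, hs]⟩
    · exact absurd (h0 k h) hk
    · obtain ⟨s, hs⟩ := exists_upperFreq h
      exact ⟨.inl s, hs⟩

lemma tsum_upper {f : ℤ × ℤ → ℂ} (hf : Summable f) :
    ∑' s, f (upperFreq s) = ∑' p, f (coneFreq p) + (∑' p, (f (leftFreq p) + f (rightFreq p))
      + (∑' j, f (axisFreq j) + ∑' j, f (diagFreq j))) := by
  have hl : Summable fun p => f (leftFreq p) := hf.comp_injective leftFreq_injective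
  have hr : Summable fun p => f (rightFreq p) := hf.comp_injective rightFreq_injective
  have hc : Summable fun p => f (coneFreq p) := hf.comp_injective coneFreq_injective
  have ha : Summable fun j => f (axisFreq j) := hf.comp_injective axisFreq_injective
  have hd : Summable fun j => f (diagFreq j) := hf.comp_injective diagFreq_injective
  have h1 := HasSum.sum (f := fun s => f (Sum.elim leftFreq rightFreq s)) hl.hasSum hr.hasSum
  have h2 := HasSum.sum (f := fun s => f (Sum.elim axisFreq diagFreq s)) ha.hasSum hd.hasSum
  have h3 := HasSum.sum (f := fun s => f (Sum.elim (Sum.elim leftFreq rightFreq)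
    (Sum.elim axisFreq diagFreq) s)) h1 h2
  have h4 := HasSum.sum (f := fun s => f (upperFreq s)) hc.hasSum h3
  rw [h4.tsum_eq, hl.tsum_add hr]

/-- The frequencies with k₂ < 0 contribute the complex conjugate of those with k₂ > 0. -/
lemma norm_tsum_le_two_mul_upper {f : ℤ × ℤ → ℂ} (hf : Summable f)
    (h0 : ∀ k : ℤ × ℤ, k.2 = 0 → f k = 0) (hneg : ∀ k, f (-k) = (starRingEnd ℂ) (f k)) :
    ‖∑' k, f k‖ ≤ 2 * ‖∑' s, f (upperFreq s)‖ := by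
  rw [tsum_eq_upper_add_lower hf h0]
  simp_rw [hneg]
  rw [← Complex.conj_tsum]
  refine (norm_add_le _ _).trans (le_of_eq ?_)
  rw [RCLike.norm_conj]; ring


/-! ### The cone and its end point correction -/

lemma intVec_mem_cone {k : ℤ × ℤ} : intVec k ∈ cone ↔ 0 < k.1 ∧ k.1 < k.2 := by
  simp only [cone, Set.mem_ofPred_eq, intVec_apply_zero, intVec_apply_one]
  constructor
  · rintro ⟨h1, _, h3⟩
    rw [one_lt_div h1] at h3
    exact ⟨by exact_mod_cast h1, by exact_mod_cast h3⟩
  · rintro ⟨h1, h2⟩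
    have h1' : (0 : ℝ) < k.1 := by exact_mod_cast h1
    have h2' : (k.1 : ℝ) < k.2 := by exact_mod_cast h2
    exact ⟨h1', h1'.trans h2', (one_lt_div h1').mpr h2'⟩

/-- The integer points of the cone, enumerated by `coneFreq`. -/
noncomputable def coneEquiv : ℕ × ℕ ≃ {k : ℤ × ℤ // intVec k ∈ cone} :=
  Equiv.ofBijective (fun p => ⟨coneFreq p, intVec_mem_cone.mpr (by
    simp only [coneFreq]; omega)⟩) ⟨fun p q h => coneFreq_injective (Subtype.mk.inj h), by
    rintro ⟨⟨a, b⟩, h⟩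
    obtain ⟨h1, h2⟩ := intVec_mem_cone.mp h
    simp only at h1 h2
    refine ⟨((a - 1).toNat, (b - a - 1).toNat), Subtype.ext ?_⟩
    simp only [coneFreq, Prod.mk.injEq]
    omega⟩

/-- The difference between the divergence theorem terms and `curveCoeff`. -/
noncomputable def coneCorr (μ : ℝ) (p : ℕ × ℕ) : ℂ :=
  ((((p.1 : ℝ) + 1) / (((p.1 : ℝ) + p.2 + 2) * (((p.1 : ℝ) + 1) ^ 2 + ((p.1 : ℝ) + p.2 + 2) ^ 2))
    : ℝ) : ℂ) * (cis (-(μ * (p.1 + 1))) - cis (-(μ * (p.2 + 1))))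

lemma norm_coneCorr_le (μ : ℝ) (p : ℕ × ℕ) : ‖coneCorr μ p‖ ≤ 2 := by
  rw [coneCorr, norm_mul, Complex.norm_real, Real.norm_of_nonneg (by positivity)]
  have h1 : ‖cis (-(μ * (p.1 + 1))) - cis (-(μ * (p.2 + 1)))‖ ≤ 2 := by
    refine (norm_sub_le _ _).trans ?_
    rw [norm_cis, norm_cis]; norm_num
  have h2 : ((p.1 : ℝ) + 1) / (((p.1 : ℝ) + p.2 + 2) * (((p.1 : ℝ) + 1) ^ 2 +
      ((p.1 : ℝ) + p.2 + 2) ^ 2)) ≤ 1 := by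
    rw [div_le_one (by positivity)]
    have ha : (0 : ℝ) ≤ p.1 := Nat.cast_nonneg _
    have hb : (0 : ℝ) ≤ p.2 := Nat.cast_nonneg _
    calc ((p.1 : ℝ) + 1) ≤ ((p.1 : ℝ) + p.2 + 2) * 1 := by linarith
      _ ≤ _ := by
        gcongr
        nlinarith [sq_nonneg ((p.1 : ℝ) + p.2 + 2)]
  exact (mul_le_mul h2 h1 (norm_nonneg _) zero_le_one).trans_eq (one_mul 2)

/-- This is `inv_norm_mul_oscInt` times μ/(2πi): the 1/μ of the end point terms cancels, so the
correction has coefficients bounded independently of μ. -/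
lemma mollTerm_coneFreq {μ : ℝ} (hμ : μ ≠ 0) (ρ : Plane → ℝ) (ε δ : ℝ) (p : ℕ × ℕ) :
    mollTerm ρ μ ε (0, -1 / 4 - 2 * δ) (coneFreq p) =
      μ / (2 * Real.pi * Complex.I) * dualTerm ρ μ ε δ (coneFreq p)
      + (((4 * Real.pi ^ 2)⁻¹ : ℝ) : ℂ) * (coneCorr μ p * rhoHat ρ ε (coneFreq p)
        * cis (dot (coneFreq p) (0, -1 / 4 - 2 * δ))) := by
  have hk : (coneFreq p).2 ≠ 0 := by simp only [coneFreq]; omega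
  have e1 : Complex.exp (-(2 * Real.pi * (1 / 4 + 2 * δ) * (coneFreq p).2 : ℝ) * Complex.I)
      = cis (dot (coneFreq p) (0, -1 / 4 - 2 * δ)) := by
    rw [cis, dot]; congr 1; push_cast; ring
  have e2 : 𝓕 (fun x : Plane => (ρ x : ℂ)) (ε • intVec (coneFreq p)) = rhoHat ρ ε (coneFreq p) :=
    rfl
  rw [dualTerm, inv_norm_mul_oscInt hμ hk, e1, e2, mollTerm, curveCoeff, coneCorr]
  have e3 : ((coneFreq p).1 : ℝ) = p.1 + 1 := by simp only [coneFreq]; push_cast; ring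
  have e4 : ((coneFreq p).2 : ℝ) = p.1 + p.2 + 2 := by simp only [coneFreq]; push_cast; ring
  have e5 : ((coneFreq p).2 : ℂ) = ((((p.1 : ℝ) + p.2 + 2 : ℝ)) : ℂ) := by
    rw [← e4]; norm_cast
  have hb : (p.1 : ℝ) + p.2 + 2 ≠ 0 := by positivity
  rw [e3, e4, e5, show (p.1 : ℝ) + p.2 + 2 - (p.1 + 1) = p.2 + 1 by ring]
  set J := curveInt μ ((p.1 : ℝ) + 1) (p.1 + p.2 + 2)
  set R := rhoHat ρ ε (coneFreq p)
  set Z := cis (dot (coneFreq p) (0, -1 / 4 - 2 * δ))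
  set D := ((p.1 : ℝ) + 1) / ((p.1 + p.2 + 2) * ((p.1 + 1) ^ 2 + (p.1 + p.2 + 2) ^ 2))
  set A := cis (-(μ * (p.1 + 1))) - cis (-(μ * (p.2 + 1)))
  have hb' : (((p.1 : ℝ) + p.2 + 2 : ℝ) : ℂ) ≠ 0 := Complex.ofReal_ne_zero.mpr hb
  set b := (((p.1 : ℝ) + p.2 + 2 : ℝ) : ℂ)
  have hμ' : (μ : ℂ) ≠ 0 := Complex.ofReal_ne_zero.mpr hμ
  have hpi : (Real.pi : ℂ) ≠ 0 := Complex.ofReal_ne_zero.mpr Real.pi_ne_zero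
  have hI := Complex.I_ne_zero
  push_cast
  field_simp
  simp only [Complex.I_sq]
  ring

lemma IsMollifier.summable_coneCorr {ρ : Plane → ℝ} (hρ : IsMollifier ρ) {ε : ℝ} (hε : 0 < ε)
    (μ : ℝ) (z : ℝ × ℝ) :
    Summable fun p => coneCorr μ p * rhoHat ρ ε (coneFreq p) * cis (dot (coneFreq p) z) := by
  refine Summable.of_norm_bounded
    (((hρ.summable_norm_rhoHat hε).comp_injective coneFreq_injective).mul_left 2) fun p => ?_
  rw [norm_mul, norm_mul, norm_cis, mul_one]
  exact mul_le_mul_of_nonneg_right (norm_coneCorr_le μ p) (norm_nonneg _)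

/-- Read off from `mollTerm_coneFreq`, whose other two terms have bounded coefficients times ρ̂(εk);
the oscillatory integral itself need not be estimated. -/
lemma IsMollifier.summable_dualTerm_coneFreq {ρ : Plane → ℝ} (hρ : IsMollifier ρ) {ε : ℝ}
    (hε : 0 < ε) {μ : ℝ} (hμ : 0 < μ) (δ : ℝ) :
    Summable fun p => dualTerm ρ μ ε δ (coneFreq p) := by
  have h1 := ((hρ.summable_mollTerm hε hμ.le (0, -1 / 4 - 2 * δ)).comp_injective
    coneFreq_injective).sub ((hρ.summable_coneCorr hε μ (0, -1 / 4 - 2 * δ)).mul_left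
    (((4 * Real.pi ^ 2)⁻¹ : ℝ) : ℂ))
  have h2 := h1.mul_left (μ / (2 * Real.pi * Complex.I))⁻¹
  refine h2.congr fun p => ?_
  have hpi : (Real.pi : ℂ) ≠ 0 := Complex.ofReal_ne_zero.mpr Real.pi_ne_zero
  have hne : (μ : ℂ) / (2 * Real.pi * Complex.I) ≠ 0 :=
    div_ne_zero (Complex.ofReal_ne_zero.mpr hμ.ne')
      (mul_ne_zero (mul_ne_zero two_ne_zero hpi) Complex.I_ne_zero)
  rw [Function.comp, mollTerm_coneFreq hμ.ne', add_sub_cancel_right, inv_mul_cancel_left₀ hne]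

lemma IsMollifier.summable_dualTerm {ρ : Plane → ℝ} (hρ : IsMollifier ρ) {ε : ℝ}
    (hε : 0 < ε) {μ : ℝ} (hμ : 0 < μ) (δ : ℝ) :
    Summable fun k : {k : ℤ × ℤ // intVec k ∈ cone} => dualTerm ρ μ ε δ k := by
  rw [← coneEquiv.summable_iff]
  exact hρ.summable_dualTerm_coneFreq hε hμ δ

lemma dualSum_eq (ρ : Plane → ℝ) (μ ε δ : ℝ) :
    dualSum ρ μ ε δ = ∑' p, dualTerm ρ μ ε δ (coneFreq p) := by
  rw [dualSum, ← coneEquiv.tsum_eq]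
  rfl

/-- The second coordinate moves from −1/4 by at most 3ε and the sum of the coordinates by at most 4ε
≤ 1/8. This fixes the threshold 1/32. -/
lemma mem_offLattice {ε δ u v : ℝ} (hε : ε ≤ 1 / 32) (hδ : |δ| ≤ ε) (hu : |u| ≤ ε) (hv : |v| ≤ ε) :
    (0 - u, -1 / 4 - 2 * δ - v) ∈ offLattice := by
  rw [abs_le] at hδ hu hv
  obtain ⟨_, _⟩ := hδ
  obtain ⟨_, _⟩ := hu
  obtain ⟨_, _⟩ := hv
  simp only [offLattice, Set.mem_ofPred_eq]
  refine ⟨?_, ?_, ?_, ?_⟩ <;> linarith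

/-- In the first exponential the sum over j has frequency y; in the second, after regrouping, the
sum over i has frequency x + y. The constant is (2 + 4) · 4. -/
lemma norm_coneCorr_sum_le {μ : ℝ} {x : ℝ × ℝ} (hx : x ∈ offLattice) (n m : ℕ) :
    ‖∑ p ∈ Finset.range n ×ˢ Finset.range m, coneCorr μ p * cis (dot (coneFreq p) x)‖ ≤ 24 := by
  obtain ⟨x, y⟩ := x
  obtain ⟨h1, h2, h3, h4⟩ := hx
  simp only at h1 h2 h3 h4
  have hl1 := le_abs_sin_pi_mul (y := y) (by linarith) (by linarith)
  have hl2 := le_abs_sin_pi_mul (y := x + y) (by linarith) (by linarith)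
  have hi : ∀ s : ℝ, 1 / 4 ≤ s → s⁻¹ ≤ 4 := fun s hs => by
    rw [inv_le_comm₀ (by linarith) (by norm_num)]; linarith
  have hb1 := norm_cone_sum_fst_le (y := y) (abs_pos.mp (by linarith)) (x - μ) n m
  have hb2 := norm_cone_sum_snd_le (y := x + y) (abs_pos.mp (by linarith)) (y - μ) n m
  have e : ∑ p ∈ Finset.range n ×ˢ Finset.range m, coneCorr μ p * cis (dot (coneFreq p) (x, y))
      = (∑ i ∈ Finset.range n, ∑ j ∈ Finset.range m,
      ((((i : ℝ) + 1) / (((i : ℝ) + j + 2) * (((i : ℝ) + 1) ^ 2 + ((i : ℝ) + j + 2) ^ 2)) : ℝ) : ℂ)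
        * cis ((i + 1) * (x - μ) + (i + j + 2) * y))
      - ∑ i ∈ Finset.range n, ∑ j ∈ Finset.range m,
      ((((i : ℝ) + 1) / (((i : ℝ) + j + 2) * (((i : ℝ) + 1) ^ 2 + ((i : ℝ) + j + 2) ^ 2)) : ℝ) : ℂ)
        * cis ((i + 1) * (x + y) + (j + 1) * (y - μ)) := by
    simp only [Finset.sum_product, ← Finset.sum_sub_distrib]
    refine Finset.sum_congr rfl fun i _ => Finset.sum_congr rfl fun j _ => ?_
    rw [coneCorr, mul_assoc, ← mul_sub, sub_mul, ← cis_add, ← cis_add]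
    simp only [dot, coneFreq]
    congr 3
    · push_cast; ring
    · push_cast; ring
  rw [e]
  have := hi _ hl1
  have := hi _ hl2
  refine (norm_sub_le _ _).trans ((add_le_add hb1 hb2).trans ?_)
  linarith

/-! ### The axis and the diagonal -/

/-- The stationary phase bound gives √μ (j+1)^{-3/2}; the exponent is weakened to 5/4 so that
`zetaConst` serves here too. -/
lemma norm_curveCoeff_axisFreq_le {μ : ℝ} (hμ : 1 ≤ μ) (j : ℕ) :
    ‖curveCoeff μ (axisFreq j)‖ ≤ √μ * ((j : ℝ) + 1) ^ (-(5 / 4) : ℝ) := by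
  have hμ0 : 0 < μ := by linarith
  have hj : (1 : ℝ) ≤ (j : ℝ) + 1 := by linarith [(Nat.cast_nonneg j : (0 : ℝ) ≤ j)]
  have hj0 : (0 : ℝ) < (j : ℝ) + 1 := by linarith
  have h := norm_curveInt_zero_le (μ := μ) (b := (j : ℝ) + 1) (by nlinarith)
  have e1 : ((axisFreq j).1 : ℝ) = 0 := by simp [axisFreq]
  have e2 : ((axisFreq j).2 : ℝ) = j + 1 := by simp [axisFreq]
  have e3 : ((axisFreq j).2 : ℂ) = (((j : ℝ) + 1 : ℝ) : ℂ) := by simp [axisFreq]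
  rw [curveCoeff, e1, e2, e3, norm_mul, norm_div, norm_mul, norm_mul, norm_mul, Complex.norm_I,
    Complex.norm_real, Complex.norm_real, Complex.norm_real, Real.norm_of_nonneg hμ0.le,
    Complex.norm_ofNat, Real.norm_of_nonneg Real.pi_pos.le, mul_one, Real.norm_of_nonneg hj0.le]
  have hsm : √μ * √μ = μ := Real.mul_self_sqrt hμ0.le
  have hsμ : 0 < √μ := Real.sqrt_pos.mpr hμ0
  have hsj : 0 < √((j : ℝ) + 1) := Real.sqrt_pos.mpr hj0
  calc _ ≤ μ / (2 * Real.pi * (j + 1)) * (4 / √(μ * (j + 1))) := by gcongr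
    _ = √μ * ((4 / (2 * Real.pi)) * (((j : ℝ) + 1) * √((j : ℝ) + 1))⁻¹) := by
        rw [Real.sqrt_mul hμ0.le]
        nth_rewrite 1 [← hsm]
        have := Real.pi_ne_zero
        field_simp
    _ ≤ √μ * (1 * (((j : ℝ) + 1) * √((j : ℝ) + 1))⁻¹) := by
        gcongr
        rw [div_le_one (by positivity)]
        nlinarith [Real.pi_gt_three]
    _ ≤ _ := by
        rw [one_mul]
        refine mul_le_mul_of_nonneg_left ?_ hsμ.le
        have : ((j : ℝ) + 1) * √((j : ℝ) + 1) = ((j : ℝ) + 1) ^ (3 / 2 : ℝ) := by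
          rw [Real.sqrt_eq_rpow]
          nth_rewrite 1 [← Real.rpow_one ((j : ℝ) + 1)]
          rw [← Real.rpow_add hj0]; norm_num
        rw [this, ← Real.rpow_neg hj0.le]
        exact Real.rpow_le_rpow_of_exponent_le hj (by norm_num)

lemma curveCoeff_diagFreq (μ : ℝ) (j : ℕ) :
    curveCoeff μ (diagFreq j) = curveCoeff μ (axisFreq j) := by
  have h := curveInt_symm μ ((axisFreq j).1) ((axisFreq j).2)
  rw [curveCoeff, curveCoeff, ← h]
  simp only [axisFreq, diagFreq]
  congr 2
  push_cast; ring

lemma IsMollifier.norm_tsum_line_le {ρ : Plane → ℝ} (hρ : IsMollifier ρ) {ε : ℝ} (z : ℝ × ℝ)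
    {μ : ℝ} (hμ : 1 ≤ μ) (κ : ℕ → ℤ × ℤ)
    (hκ : ∀ j, curveCoeff μ (κ j) = curveCoeff μ (axisFreq j)) :
    ‖∑' j, mollTerm ρ μ ε z (κ j)‖ ≤ zetaConst * √μ := by
  have hb : ∀ j, ‖mollTerm ρ μ ε z (κ j)‖ ≤ √μ * ((j : ℝ) + 1) ^ (-(5 / 4) : ℝ) := by
    intro j
    rw [mollTerm, norm_mul, norm_mul, norm_cis, mul_one, hκ]
    calc _ ≤ ‖curveCoeff μ (axisFreq j)‖ * 1 := by
          gcongr; exact hρ.norm_rhoHat_le _ _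
      _ ≤ _ := by rw [mul_one]; exact norm_curveCoeff_axisFreq_le hμ j
  have h := tsum_of_norm_bounded (summable_zetaConst.mul_left (√μ)).hasSum hb
  rw [tsum_mul_left] at h
  rw [mul_comm]; exact h

/-- The frequency side estimate: up to `O(√μ)` the mollified sum is controlled by the
frequencies in the cone. -/
lemma IsMollifier.norm_tsum_mollTerm_le {ρ : Plane → ℝ} (hρ : IsMollifier ρ) {ε δ : ℝ}
    (hε : 0 < ε) (hε1 : ε ≤ 1 / 32) (hδ : |δ| ≤ ε) {μ : ℝ} (hμ : 1 ≤ μ) :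
    ‖∑' k, mollTerm ρ μ ε (0, -1 / 4 - 2 * δ) k‖ ≤
      μ * ‖dualSum ρ μ ε δ‖ + (240 + 772 * zetaConst) * √μ := by
  have hμ0 : 0 < μ := by linarith
  set z : ℝ × ℝ := (0, -1 / 4 - 2 * δ) with hz
  have hs1 : 1 ≤ √μ := Real.one_le_sqrt.mpr hμ
  have hZ := zetaConst_nonneg
  have hsum := hρ.summable_mollTerm hε hμ0.le z
  have hreg : ∀ u v : ℝ, |u| ≤ ε → |v| ≤ ε → (z.1 - u, z.2 - v) ∈ offLattice :=
    fun u v hu hv => mem_offLattice hε1 hδ hu hv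
  have hcorr : ‖∑' p, coneCorr μ p * rhoHat ρ ε (coneFreq p) * cis (dot (coneFreq p) z)‖ ≤ 24 :=
    norm_tsum_prod_le (hρ.summable_coneCorr hε μ z) fun n =>
      hρ.norm_sum_le hε _ _ _ _ fun u v hu hv => norm_coneCorr_sum_le (hreg u v hu hv) n n
  have hcone : ‖∑' p, mollTerm ρ μ ε z (coneFreq p)‖ ≤ μ / (2 * Real.pi) * ‖dualSum ρ μ ε δ‖ + 24 := by
    simp_rw [hz, mollTerm_coneFreq hμ0.ne']
    rw [Summable.tsum_add ((hρ.summable_dualTerm_coneFreq hε hμ0 δ).mul_left _)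
      ((hρ.summable_coneCorr hε μ _).mul_left _), tsum_mul_left, tsum_mul_left, ← dualSum_eq]
    refine (norm_add_le _ _).trans (add_le_add (le_of_eq ?_) ?_)
    · rw [norm_mul, norm_div, norm_mul, norm_mul, Complex.norm_I, Complex.norm_real,
        Complex.norm_real, Complex.norm_ofNat, mul_one, Real.norm_of_nonneg hμ0.le,
        Real.norm_of_nonneg Real.pi_pos.le]
    · rw [norm_mul, Complex.norm_real, Real.norm_of_nonneg (by positivity)]
      have hc : (4 * Real.pi ^ 2)⁻¹ ≤ 1 := by
        refine inv_le_one_of_one_le₀ ?_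
        nlinarith [Real.pi_gt_three]
      exact (mul_le_mul hc hcorr (norm_nonneg _) zero_le_one).trans_eq (one_mul 24)
  have hoff : ‖∑' p, (mollTerm ρ μ ε z (leftFreq p) + mollTerm ρ μ ε z (rightFreq p))‖
      ≤ (96 + 384 * zetaConst) * √μ := by
    refine norm_tsum_prod_le ((hsum.comp_injective leftFreq_injective).add
      (hsum.comp_injective rightFreq_injective)) fun n => ?_
    have h := hρ.norm_sum_le hε ((Finset.range n ×ˢ Finset.range n).disjSum
      (Finset.range n ×ˢ Finset.range n)) (fun s => curveCoeff μ (Sum.elim leftFreq rightFreq s))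
      (Sum.elim leftFreq rightFreq) z (B := (96 + 384 * zetaConst) * √μ) ?_
    · rw [Finset.sum_disjSum, ← Finset.sum_add_distrib] at h
      exact h
    · intro u v hu hv
      rw [Finset.sum_disjSum, ← Finset.sum_add_distrib, Finset.sum_product]
      exact norm_off_cone_sum_le hμ (hreg u v hu hv) n n
  have hax := hρ.norm_tsum_line_le (ε := ε) z hμ axisFreq fun _ => rfl
  have hdi := hρ.norm_tsum_line_le (ε := ε) z hμ diagFreq (curveCoeff_diagFreq μ)
  refine (norm_tsum_le_two_mul_upper hsum (fun k hk => ?_) (mollTerm_neg ρ μ ε z)).trans ?_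
  · simp [mollTerm, curveCoeff, hk]
  rw [tsum_upper hsum]
  have h4 : μ / (2 * Real.pi) * ‖dualSum ρ μ ε δ‖ ≤ μ / 2 * ‖dualSum ρ μ ε δ‖ := by
    gcongr
    nlinarith [Real.pi_gt_three]
  -- The outer 2 accounts for k₂ < 0. With √μ ≥ 1 the constants are 240 = 2(24 + 96) and 772 = 2(384
  -- + 1 + 1).
  calc _ ≤ 2 * ((μ / 2 * ‖dualSum ρ μ ε δ‖ + 24) + ((96 + 384 * zetaConst) * √μ +
        (zetaConst * √μ + zetaConst * √μ))) := by
        refine mul_le_mul_of_nonneg_left ?_ (by norm_num)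
        refine (norm_add_le _ _).trans (add_le_add (hcone.trans (by linarith)) ?_)
        refine (norm_add_le _ _).trans (add_le_add hoff ?_)
        exact (norm_add_le _ _).trans (add_le_add hax hdi)
    _ ≤ _ := by nlinarith


/-! ### Parseval's identity on a fundamental domain -/

/-- The fundamental domain `(-1/2, 1/2] × (-1, 0]` of `ℤ²`. -/
def unitBox : Set (ℝ × ℝ) := Set.Ioc (-1 / 2) (1 / 2) ×ˢ Set.Ioc (-1) 0

/-- Fourier coefficients over the fundamental domain. -/
noncomputable def boxCoeff (f : ℝ × ℝ → ℂ) (k : ℤ × ℤ) : ℂ :=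
  ∫ x in unitBox, cis (-dot k x) * f x

section Torus

open UnitAddTorus

noncomputable local instance : MeasureTheory.MeasureSpace UnitAddCircle := ⟨AddCircle.haarAddCircle⟩

local instance : MeasureTheory.IsProbabilityMeasure
    (MeasureTheory.volume : MeasureTheory.Measure UnitAddCircle) :=
  inferInstanceAs (MeasureTheory.IsProbabilityMeasure AddCircle.haarAddCircle)

lemma setIntegral_finTwo_eq (h : ℝ × ℝ → ℂ) :
    ∫ x in {x : Fin 2 → ℝ | ∀ i, x i ∈ Set.Ioc ((![-1 / 2, -1] : Fin 2 → ℝ) i)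
      ((![-1 / 2, -1] : Fin 2 → ℝ) i + 1)}, h (x 0, x 1) = ∫ x in unitBox, h x := by
  have hmp := MeasureTheory.volume_preserving_finTwoArrow ℝ
  rw [← hmp.setIntegral_preimage_emb (MeasurableEquiv.measurableEmbedding _)]
  have : (MeasurableEquiv.finTwoArrow (α := ℝ)) ⁻¹' unitBox = {x : Fin 2 → ℝ | ∀ i, x i ∈
      Set.Ioc ((![-1 / 2, -1] : Fin 2 → ℝ) i) ((![-1 / 2, -1] : Fin 2 → ℝ) i + 1)} := by
    ext x
    simp only [unitBox, Set.mem_preimage, Set.mem_prod, Set.mem_ofPred_eq, Fin.forall_fin_two]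
    simp only [Matrix.cons_val_zero, Matrix.cons_val_one, MeasurableEquiv.finTwoArrow]
    norm_num
  rw [this]
  rfl

lemma mFourier_coe (n : Fin 2 → ℤ) (x : Fin 2 → ℝ) :
    mFourier n (fun i => (x i : UnitAddCircle)) = cis (dot (n 0, n 1) (x 0, x 1)) := by
  simp only [mFourier, ContinuousMap.coe_mk, Fin.prod_univ_two, fourier_coe_apply, dot]
  rw [cis_add, cis, cis]
  congr 2
  · push_cast; ring
  · push_cast; ring

/-- Parseval's identity on the fundamental domain, for bounded functions. -/
lemma hasSum_conj_boxCoeff_mul {f h : ℝ × ℝ → ℂ} (hf : Measurable f) (hh : Measurable h)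
    {A B : ℝ} (hfA : ∀ x, ‖f x‖ ≤ A) (hhB : ∀ x, ‖h x‖ ≤ B) :
    HasSum (fun k : ℤ × ℤ => (starRingEnd ℂ) (boxCoeff f k) * boxCoeff h k)
      (∫ x in unitBox, (starRingEnd ℂ) (f x) * h x) := by
  set b : Fin 2 → ℝ := ![-1 / 2, -1] with hb
  set s : UnitAddTorus (Fin 2) → ℝ × ℝ := fun a =>
    ((measurableEquivPiIoc b a).1 0, (measurableEquivPiIoc b a).1 1) with hs
  have hsm : Measurable s := by
    have h1 : Measurable fun a => (measurableEquivPiIoc b a).1 :=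
      measurable_subtype_coe.comp (measurableEquivPiIoc b).measurable
    exact ((measurable_pi_apply 0).comp h1).prodMk ((measurable_pi_apply 1).comp h1)
  have hscoe : ∀ x : Fin 2 → ℝ, (∀ i, x i ∈ Set.Ioc (b i) (b i + 1)) →
      s (fun i => (x i : UnitAddCircle)) = (x 0, x 1) := by
    intro x hx
    have := (measurableEquivPiIoc b).apply_symm_apply ⟨x, hx⟩
    rw [coe_symm_measurableEquivPiIoc_apply] at this
    simp only [hs]
    rw [this]
  have hset : MeasurableSet {x : Fin 2 → ℝ | ∀ i, x i ∈ Set.Ioc (b i) (b i + 1)} :=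
    MeasurableSet.univ_pi' fun i => measurableSet_Ioc
  have hLp : ∀ {f : ℝ × ℝ → ℂ} {A : ℝ}, Measurable f → (∀ x, ‖f x‖ ≤ A) →
      MeasureTheory.MemLp (fun a => f (s a)) 2
        (MeasureTheory.volume : MeasureTheory.Measure (UnitAddTorus (Fin 2))) :=
    fun hf hA => MeasureTheory.MemLp.of_bound (hf.comp hsm).aestronglyMeasurable _
      (Filter.Eventually.of_forall fun a => hA (s a))
  have hcoef : ∀ {f : ℝ × ℝ → ℂ} {A : ℝ} (hf : Measurable f) (hA : ∀ x, ‖f x‖ ≤ A)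
      (n : Fin 2 → ℤ), mFourierCoeff ((hLp hf hA).toLp _) n = boxCoeff f (n 0, n 1) := by
    intro f A hf hA n
    have h1 : mFourierCoeff ((hLp hf hA).toLp _) n = mFourierCoeff (fun a => f (s a)) n := by
      refine MeasureTheory.integral_congr_ae ?_
      filter_upwards [(hLp hf hA).coeFn_toLp] with a ha
      rw [ha]
    rw [h1, mFourierCoeff_eq_integral _ _ b, boxCoeff, ← setIntegral_finTwo_eq]
    refine MeasureTheory.setIntegral_congr_fun hset fun x hx => ?_
    simp only [smul_eq_mul]
    rw [hscoe x hx, mFourier_coe]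
    congr 2
    simp [dot]; ring
  have hP := hasSum_prod_mFourierCoeff ((hLp hf hfA).toLp _) ((hLp hh hhB).toLp _)
  have hint : ∫ t, (starRingEnd ℂ) (((hLp hf hfA).toLp _) t) * ((hLp hh hhB).toLp _) t
      = ∫ x in unitBox, (starRingEnd ℂ) (f x) * h x := by
    have h1 : ∫ t, (starRingEnd ℂ) (((hLp hf hfA).toLp _) t) * ((hLp hh hhB).toLp _) t
        = ∫ t, (starRingEnd ℂ) (f (s t)) * h (s t) := by
      refine MeasureTheory.integral_congr_ae ?_
      filter_upwards [(hLp hf hfA).coeFn_toLp, (hLp hh hhB).coeFn_toLp] with a ha ha'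
      rw [ha, ha']
    rw [h1, integral_preimage _ b, ← setIntegral_finTwo_eq]
    refine MeasureTheory.setIntegral_congr_fun hset fun x hx => ?_
    rw [hscoe x hx]
  rw [hint] at hP
  simp_rw [hcoef hf hfA, hcoef hh hhB] at hP
  exact ((finTwoArrowEquiv ℤ).hasSum_iff
    (f := fun k => (starRingEnd ℂ) (boxCoeff f k) * boxCoeff h k)).mp hP

end Torus

/-- The plane as a product. -/
noncomputable def planeEquiv : ℝ × ℝ ≃ᵐ Plane :=
  (MeasurableEquiv.finTwoArrow (α := ℝ)).symm.trans (MeasurableEquiv.toLp 2 (Fin 2 → ℝ))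
lemma planeEquiv_zero (p : ℝ × ℝ) : planeEquiv p 0 = p.1 := rfl
lemma planeEquiv_one (p : ℝ × ℝ) : planeEquiv p 1 = p.2 := rfl

lemma measurePreserving_planeEquiv : MeasureTheory.MeasurePreserving planeEquiv :=
  (MeasureTheory.volume_preserving_finTwoArrow ℝ).symm.trans (PiLp.volume_preserving_toLp (Fin 2))

lemma integral_plane_eq {E : Type*} [NormedAddCommGroup E] [NormedSpace ℝ E] (h : Plane → E) :
    ∫ v, h v = ∫ p : ℝ × ℝ, h (planeEquiv p) :=
  (measurePreserving_planeEquiv.integral_comp' h).symm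

/-- The substitution v = (z − p)/ε, in the form needed to read an average over v as an integral over
the fundamental domain. -/
lemma integral_scaled (ε : ℝ) (hε : 0 < ε) (z : Plane) (H : Plane → ℂ) :
    ∫ p : ℝ × ℝ, ((ε ^ 2)⁻¹ : ℝ) * H (ε⁻¹ • (z - planeEquiv p)) = ∫ v, H v := by
  rw [← integral_plane_eq fun v => ((ε ^ 2)⁻¹ : ℝ) * H (ε⁻¹ • (z - v)),
    MeasureTheory.integral_const_mul,
    MeasureTheory.integral_sub_left_eq_self (fun v => H (ε⁻¹ • v)),
    MeasureTheory.Measure.integral_comp_inv_smul, finrank_euclideanSpace_fin,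
    abs_of_pos (by positivity), Complex.real_smul, ← mul_assoc, ← Complex.ofReal_mul,
    inv_mul_cancel₀ (by positivity), Complex.ofReal_one, one_mul]

/-! ### The sawtooth sum -/

/-- The sawtooth function. -/
noncomputable def saw (u : ℝ) : ℝ := Int.fract u - 1 / 2

lemma abs_saw_le (u : ℝ) : |saw u| ≤ 1 / 2 := by
  rw [saw, abs_le]
  constructor <;> linarith [Int.fract_nonneg u, Int.fract_lt_one u]

/-- One term of the sawtooth sum along the curve `μ Γ`. -/
noncomputable def sawTerm (μ : ℝ) (x : ℝ × ℝ) : ℝ :=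
  if |x.1| ≤ μ then saw (μ * g (x.1 / μ) - x.2) else 0

lemma abs_sawTerm_le (μ : ℝ) (x : ℝ × ℝ) : |sawTerm μ x| ≤ 1 / 2 := by
  rw [sawTerm]
  split_ifs
  · exact abs_saw_le _
  · norm_num

lemma measurable_saw : Measurable saw := measurable_fract.sub_const _

lemma measurable_sawTerm (μ : ℝ) : Measurable (sawTerm μ) := by
  unfold sawTerm
  refine Measurable.ite (measurableSet_le (by fun_prop) measurable_const) ?_ measurable_const
  have := continuous_g.measurable
  exact measurable_saw.comp (by fun_prop)

/-- The sawtooth sum along the curve. -/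
noncomputable def sawSum (μ : ℝ) (M : ℕ) (x : ℝ × ℝ) : ℝ :=
  ∑ m ∈ Finset.Icc (-(M : ℤ)) M, sawTerm μ (m + x.1, x.2)

lemma abs_sawSum_le (μ : ℝ) (M : ℕ) (x : ℝ × ℝ) : |sawSum μ M x| ≤ (2 * M + 1) / 2 := by
  refine (Finset.abs_sum_le_sum_abs _ _).trans ((Finset.sum_le_sum fun m _ =>
    abs_sawTerm_le μ _).trans (le_of_eq ?_))
  rw [Finset.sum_const, Int.card_Icc, nsmul_eq_mul]
  have : ((((M : ℤ) + 1 - -(M : ℤ)).toNat : ℕ) : ℝ) = 2 * M + 1 := by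
    have : ((M : ℤ) + 1 - -(M : ℤ)).toNat = 2 * M + 1 := by omega
    rw [this]; push_cast; ring
  rw [this]; ring

lemma measurable_sawSum (μ : ℝ) (M : ℕ) : Measurable (sawSum μ M) := by
  unfold sawSum
  refine Finset.measurable_fun_sum _ fun m _ => (measurable_sawTerm μ).comp (by fun_prop)

/-- By periodicity the window moves to [0, 1], where the sawtooth is u − 1/2. For k = 0 the left
side is its mean, which vanishes, and the right side is a division by zero. -/
lemma integral_cis_mul_saw (G : ℝ) (k : ℤ) :
    ∫ y in (-1 : ℝ)..0, cis (-(k * y)) * (saw (G - y) : ℂ) =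
      cis (-(k * G)) / (2 * Real.pi * Complex.I * k) := by
  have hper : Function.Periodic (fun u => cis (k * u) * (saw u : ℂ)) 1 := by
    intro u
    have : (k : ℝ) * (u + 1) = k * u + k := by ring
    simp only [this, cis_add_int, saw, Int.fract_add_one]
  have h1 : ∫ y in (-1 : ℝ)..0, cis (-(k * y)) * (saw (G - y) : ℂ)
      = cis (-(k * G)) * ∫ u in (0 : ℝ)..1, cis (k * u) * (saw u : ℂ) := by
    have h2 := hper.intervalIntegral_add_eq G 0
    rw [zero_add] at h2
    rw [← h2, ← intervalIntegral.integral_const_mul]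
    have h3 := intervalIntegral.integral_comp_sub_left (a := (-1 : ℝ)) (b := 0)
      (fun u => cis (-(k * G)) * (cis (k * u) * (saw u : ℂ))) G
    rw [sub_zero, sub_neg_eq_add] at h3
    rw [← h3]
    refine intervalIntegral.integral_congr fun y _ => ?_
    rw [← mul_assoc, ← cis_add]
    congr 2; ring
  have h4 : ∫ u in (0 : ℝ)..1, cis (k * u) * (saw u : ℂ)
      = ∫ u in (0 : ℝ)..1, cis (k * u) * ((u - 1 / 2 : ℝ) : ℂ) := by
    refine intervalIntegral.integral_congr_ae ?_
    have h1 : ∀ᵐ u : ℝ, u ≠ 1 := by simp [MeasureTheory.ae_iff]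
    filter_upwards [h1] with u hu hmem
    rw [Set.uIoc_of_le zero_le_one] at hmem
    rw [saw, Int.fract_eq_self.mpr ⟨hmem.1.le, lt_of_le_of_ne hmem.2 hu⟩]
  rw [h1, h4, div_eq_mul_inv (cis _)]
  congr 1
  rcases eq_or_ne k 0 with rfl | hk
  · simp only [Int.cast_zero, zero_mul, cis_zero, one_mul, mul_zero, inv_zero]
    rw [intervalIntegral.integral_ofReal, intervalIntegral.integral_sub (by simp) (by simp)]
    simp
  · have hk' : (k : ℂ) ≠ 0 := Int.cast_ne_zero.mpr hk
    have hpi : (Real.pi : ℂ) ≠ 0 := Complex.ofReal_ne_zero.mpr Real.pi_ne_zero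
    set c : ℂ := 2 * Real.pi * Complex.I * k with hc
    have hc0 : c ≠ 0 := by
      rw [hc]; exact mul_ne_zero (mul_ne_zero (mul_ne_zero two_ne_zero hpi) Complex.I_ne_zero) hk'
    have hd : ∀ u : ℝ, HasDerivAt (fun u : ℝ => cis (k * u) * ((u - 1 / 2 : ℝ) : ℂ) / c
        - cis (k * u) / c ^ 2) (cis (k * u) * ((u - 1 / 2 : ℝ) : ℂ)) u := by
      intro u
      have e1 : HasDerivAt (fun u : ℝ => cis (k * u)) (c * cis (k * u)) u := by
        have h := ((hasDerivAt_id u).const_mul (k : ℝ)).cis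
        refine h.congr_deriv ?_
        rw [hc]; simp
      have e2 : HasDerivAt (fun u : ℝ => ((u - 1 / 2 : ℝ) : ℂ)) 1 u := by
        simpa using ((hasDerivAt_id u).sub_const (1 / 2)).ofReal_comp
      refine (((e1.mul e2).div_const c).sub (e1.div_const (c ^ 2))).congr_deriv ?_
      field_simp
      ring
    have hcc := continuous_cis
    rw [intervalIntegral.integral_eq_sub_of_hasDerivAt (fun u _ => hd u)
      (Continuous.intervalIntegrable (by fun_prop) _ _)]
    have e1 : cis ((k : ℝ) * 1) = 1 := by rw [mul_one, cis_int]
    have e0 : cis ((k : ℝ) * 0) = 1 := by rw [mul_zero, cis_zero]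
    rw [e1, e0]
    push_cast
    field_simp
    ring

lemma sum_Icc_neg_eq_sum_range {E : Type*} [AddCommMonoid E] (M : ℕ) (f : ℤ → E) :
    ∑ m ∈ Finset.Icc (-(M : ℤ)) M, f m = ∑ i ∈ Finset.range (2 * M + 1), f ((i : ℤ) - M) := by
  refine Finset.sum_nbij' (fun m => (m + M).toNat) (fun i => (i : ℤ) - M) ?_ ?_ ?_ ?_ ?_
  · intro m hm
    simp only [Finset.mem_Icc, Finset.mem_range] at hm ⊢; omega
  · intro m hm
    simp only [Finset.mem_Icc, Finset.mem_range] at hm ⊢; omega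
  · intro m hm
    simp only [Finset.mem_Icc] at hm; omega
  · intro m hm
    simp
  · intro m hm
    simp only [Finset.mem_Icc] at hm
    congr 1; omega

lemma sum_integral_translates {G : ℝ → ℂ} (hG : ∀ a b, IntervalIntegrable G MeasureTheory.volume a b)
    (M : ℕ) : ∑ m ∈ Finset.Icc (-(M : ℤ)) M, ∫ x in (-1 / 2 : ℝ)..(1 / 2), G (m + x)
      = ∫ u in (-(M : ℝ) - 1 / 2)..(M + 1 / 2), G u := by
  rw [sum_Icc_neg_eq_sum_range]
  have h := intervalIntegral.sum_integral_adjacent_intervals (μ := MeasureTheory.volume) (f := G)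
    (a := fun i : ℕ => (i : ℝ) - M - 1 / 2) (n := 2 * M + 1) (fun i _ => hG _ _)
  have e : ((2 * M + 1 : ℕ) : ℝ) - M - 1 / 2 = M + 1 / 2 := by push_cast; ring
  rw [e, Nat.cast_zero, zero_sub] at h
  rw [← h]
  refine Finset.sum_congr rfl fun i _ => ?_
  rw [intervalIntegral.integral_comp_add_left]
  congr 1 <;> push_cast <;> ring

/-- The Fourier coefficients of the sawtooth sum. -/
lemma boxCoeff_sawSum {μ : ℝ} (hμ : 0 < μ) {M : ℕ} (hM : μ ≤ M) (k : ℤ × ℤ) :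
    boxCoeff (fun x => (sawSum μ M x : ℂ)) k = curveCoeff μ k := by
  have hcc := continuous_cis
  have hcg := continuous_g
  set c : ℂ := (2 * Real.pi * Complex.I * k.2)⁻¹ with hc
  set E : ℝ → ℂ := fun u => c * cis (-(k.1 * u + k.2 * (μ * g (u / μ)))) with hE
  have hEc : Continuous E := by fun_prop
  set G : ℝ → ℂ := (Set.Icc (-μ) μ).indicator E with hG
  have hGi : ∀ a b, IntervalIntegrable G MeasureTheory.volume a b := fun a b => by
    rw [intervalIntegrable_iff]
    exact (intervalIntegrable_iff.mp (hEc.intervalIntegrable a b)).indicator measurableSet_Icc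
  have hbox : MeasureTheory.volume.restrict unitBox =
      (MeasureTheory.volume.restrict (Set.Ioc (-1 / 2 : ℝ) (1 / 2))).prod
      (MeasureTheory.volume.restrict (Set.Ioc (-1 : ℝ) 0)) := by
    rw [MeasureTheory.Measure.prod_restrict]; rfl
  have hint : ∀ m : ℤ, MeasureTheory.Integrable
      (fun x : ℝ × ℝ => cis (-dot k x) * (sawTerm μ (m + x.1, x.2) : ℂ))
      ((MeasureTheory.volume.restrict (Set.Ioc (-1 / 2 : ℝ) (1 / 2))).prod
      (MeasureTheory.volume.restrict (Set.Ioc (-1 : ℝ) 0))) := by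
    intro m
    refine MeasureTheory.Integrable.of_bound (C := 1 / 2) ?_ (Filter.Eventually.of_forall fun x => ?_)
    · refine Measurable.aestronglyMeasurable (Measurable.mul ?_ ?_)
      · unfold dot
        exact Continuous.measurable (by fun_prop)
      · exact Complex.measurable_ofReal.comp ((measurable_sawTerm μ).comp (by fun_prop))
    · rw [norm_mul, norm_cis, one_mul, Complex.norm_real]
      exact abs_sawTerm_le _ _
  have hterm : ∀ (m : ℤ) (x : ℝ), ∫ y in (-1 : ℝ)..0, cis (-dot k (x, y)) *
      (sawTerm μ (m + x, y) : ℂ) = G (m + x) := by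
    intro m x
    by_cases hx : |(m : ℝ) + x| ≤ μ
    · have hmem : (m : ℝ) + x ∈ Set.Icc (-μ) μ := abs_le.mp hx
      rw [hG, Set.indicator_of_mem hmem]
      have h := integral_cis_mul_saw (μ * g ((m + x) / μ)) k.2
      simp only [hE, sawTerm, hx, if_true]
      have e : cis (-(k.1 * (m + x) + k.2 * (μ * g ((m + x) / μ))))
          = cis (-(k.1 * x)) * cis (-(k.2 * (μ * g ((m + x) / μ)))) := by
        rw [← cis_add, ← cis_add_int _ (k.1 * m)]
        congr 1; push_cast; ring
      rw [e, mul_left_comm, hc, mul_comm _⁻¹, ← div_eq_mul_inv, ← h,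
        ← intervalIntegral.integral_const_mul]
      refine intervalIntegral.integral_congr fun y _ => ?_
      simp only [dot]
      rw [← mul_assoc, ← cis_add]
      congr 2; ring
    · have hmem : (m : ℝ) + x ∉ Set.Icc (-μ) μ := fun h => hx (abs_le.mpr h)
      rw [hG, Set.indicator_of_notMem hmem]
      simp [sawTerm, hx]
  have h1 : boxCoeff (fun x => (sawSum μ M x : ℂ)) k
      = ∑ m ∈ Finset.Icc (-(M : ℤ)) M, ∫ x in (-1 / 2 : ℝ)..(1 / 2), G (m + x) := by
    rw [boxCoeff, hbox]
    simp only [sawSum, Complex.ofReal_sum, Finset.mul_sum]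
    rw [MeasureTheory.integral_finsetSum _ fun m _ => hint m]
    refine Finset.sum_congr rfl fun m _ => ?_
    rw [MeasureTheory.integral_prod _ (hint m), intervalIntegral.integral_of_le (by norm_num)]
    refine MeasureTheory.setIntegral_congr_fun measurableSet_Ioc fun x _ => ?_
    simp only
    rw [← hterm, intervalIntegral.integral_of_le (by norm_num)]
  rw [h1, sum_integral_translates hGi, intervalIntegral.integral_of_le (by linarith), hG,
    MeasureTheory.setIntegral_indicator measurableSet_Icc]
  -- As M ≥ μ, the translates |m| ≤ M cover the whole projection [−μ, μ] of the curve, so truncating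
  -- the sum at M loses nothing on the fundamental domain.
  have hinter : Set.Ioc (-(M : ℝ) - 1 / 2) (M + 1 / 2) ∩ Set.Icc (-μ) μ = Set.Icc (-μ) μ := by
    refine Set.inter_eq_right.mpr fun u hu => ⟨?_, ?_⟩
    · linarith [hu.1]
    · linarith [hu.2]
  rw [hinter, MeasureTheory.integral_Icc_eq_integral_Ioc,
    ← intervalIntegral.integral_of_le (by linarith)]
  have h2 := intervalIntegral.integral_comp_mul_left (a := (-1 : ℝ)) (b := 1) E hμ.ne'
  rw [mul_neg, mul_one] at h2
  rw [curveCoeff, curveInt]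
  have h3 : ∫ u in (-μ)..μ, E u = μ * ∫ t in (-1 : ℝ)..1, E (μ * t) := by
    rw [h2, Complex.real_smul, ← mul_assoc, ← Complex.ofReal_mul, mul_inv_cancel₀ hμ.ne',
      Complex.ofReal_one, one_mul]
  rw [h3]
  have h4 : ∀ t, E (μ * t) = c * cis (-(μ * (k.1 * t + k.2 * g t))) := by
    intro t
    simp only [hE]
    rw [mul_div_cancel_left₀ _ hμ.ne']
    congr 2; ring
  simp_rw [h4]
  rw [intervalIntegral.integral_const_mul, hc]
  ring

/-- The Fourier series of the mollified sawtooth sum. -/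
lemma IsMollifier.integral_sawSum_eq {ρ : Plane → ℝ} (hρ : IsMollifier ρ) {ε δ : ℝ}
    (hε : 0 < ε) (hε1 : ε ≤ 1 / 32) (hδ : |δ| ≤ ε) {μ : ℝ} (hμ : 0 < μ) {M : ℕ} (hM : μ ≤ M) :
    ∫ v, (ρ v : ℂ) * (sawSum μ M (0 - ε * v 0, -1 / 4 - 2 * δ - ε * v 1) : ℂ) =
      ∑' k, mollTerm ρ μ ε (0, -1 / 4 - 2 * δ) k := by
  set z : Plane := !₂[0, -1 / 4 - 2 * δ] with hz
  have hz0 : z 0 = 0 := rfl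
  have hz1 : z 1 = -1 / 4 - 2 * δ := rfl
  set f : ℝ × ℝ → ℂ := fun p => (((ε ^ 2)⁻¹ : ℝ) : ℂ) * (ρ (ε⁻¹ • (z - planeEquiv p)) : ℂ) with hf
  have hfm : Measurable f := by
    have h1 := hρ.contDiff.continuous.measurable
    have h2 := planeEquiv.measurable
    refine Measurable.const_mul (Complex.measurable_ofReal.comp (h1.comp ?_)) _
    have h3 : Measurable fun p => z - planeEquiv p := measurable_const.sub h2
    exact h3.const_smul ε⁻¹
  obtain ⟨A, hA⟩ := hρ.contDiff.continuous.bounded_above_of_compact_support hρ.hasCompactSupport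
  have hfA : ∀ p, ‖f p‖ ≤ (ε ^ 2)⁻¹ * A := by
    intro p
    simp only [hf]
    rw [norm_mul, Complex.norm_real, Complex.norm_real, Real.norm_of_nonneg (by positivity)]
    gcongr
    exact hA _
  -- The fundamental domain is placed so that it contains the disc of radius ε about (0, −1/4 − 2δ);
  -- the rescaled mollifier then needs no periodisation.
  have hsupp : ∀ p ∉ unitBox, f p = 0 := by
    intro p hp
    by_contra hne
    apply hp
    have h1 : ρ (ε⁻¹ • (z - planeEquiv p)) ≠ 0 := by
      intro h0; apply hne; simp [hf, h0]
    have h2 := hρ.norm_le_one _ h1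
    have h3 := (abs_apply_le_norm _ 0).trans h2
    have h4 := (abs_apply_le_norm _ 1).trans h2
    rw [PiLp.smul_apply, smul_eq_mul, abs_mul, abs_of_pos (inv_pos.mpr hε),
      inv_mul_le_iff₀ hε, mul_one, PiLp.sub_apply] at h3 h4
    rw [hz0, planeEquiv_zero, abs_le] at h3
    rw [hz1, planeEquiv_one, abs_le] at h4
    rw [abs_le] at hδ
    refine Set.mem_prod.mpr ⟨⟨?_, ?_⟩, ⟨?_, ?_⟩⟩ <;> linarith [h3.1, h3.2, h4.1, h4.2, hδ.1, hδ.2]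
  have hpull : ∀ (H : ℝ × ℝ → ℂ), ∫ p in unitBox, H p * f p
      = ∫ v, (ρ v : ℂ) * H (0 - ε * v 0, -1 / 4 - 2 * δ - ε * v 1) := by
    intro H
    rw [MeasureTheory.setIntegral_eq_integral_of_forall_compl_eq_zero
      (fun p hp => by rw [hsupp p hp, mul_zero]), ← integral_scaled ε hε z]
    refine MeasureTheory.integral_congr_ae (Filter.Eventually.of_forall fun p => ?_)
    simp only [hf]
    have e0 : 0 - ε * (ε⁻¹ • (z - planeEquiv p)) 0 = p.1 := by
      rw [PiLp.smul_apply, PiLp.sub_apply, hz0, planeEquiv_zero, smul_eq_mul]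
      field_simp; ring
    have e1 : -1 / 4 - 2 * δ - ε * (ε⁻¹ • (z - planeEquiv p)) 1 = p.2 := by
      rw [PiLp.smul_apply, PiLp.sub_apply, hz1, planeEquiv_one, smul_eq_mul]
      field_simp; ring
    rw [e0, e1]
    ring
  have hB : ∀ x, ‖((sawSum μ M x : ℝ) : ℂ)‖ ≤ (2 * M + 1) / 2 := fun x => by
    rw [Complex.norm_real]; exact abs_sawSum_le μ M x
  have hP := hasSum_conj_boxCoeff_mul hfm
    (Complex.measurable_ofReal.comp (measurable_sawSum μ M)) hfA hB
  have hconj : ∀ x, (starRingEnd ℂ) (f x) = f x := fun x => by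
    simp only [hf, map_mul, Complex.conj_ofReal]
  have hcoef : ∀ k, (starRingEnd ℂ) (boxCoeff f k) = rhoHat ρ ε k * cis (dot k (0, -1 / 4 - 2 * δ)) := by
    intro k
    rw [boxCoeff, hpull, rhoHat_eq, ← integral_conj, ← MeasureTheory.integral_mul_const]
    refine MeasureTheory.integral_congr_ae (Filter.Eventually.of_forall fun v => ?_)
    simp only [map_mul, Complex.conj_ofReal]
    rw [← cis_neg, mul_assoc, ← cis_add]
    congr 2
    simp only [dot]
    ring
  rw [← hpull (fun p => (sawSum μ M p : ℂ))]
  have hfin : ∫ p in unitBox, (sawSum μ M p : ℂ) * f p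
      = ∫ x in unitBox, (starRingEnd ℂ) (f x) * ((Complex.ofReal ∘ sawSum μ M) x) := by
    refine MeasureTheory.integral_congr_ae (Filter.Eventually.of_forall fun v => ?_)
    simp only [hconj, Function.comp]
    ring
  rw [hfin, ← hP.tsum_eq]
  refine tsum_congr fun k => ?_
  rw [hcoef, mollTerm, ← boxCoeff_sawSum hμ hM k]
  simp only [Function.comp_def]
  ring


/-! ### Counting lattice points column by column -/

lemma abs_intCast_le_iff {μ : ℝ} (hμ : 0 ≤ μ) (m : ℤ) :
    |(m : ℝ)| ≤ μ ↔ m ∈ Finset.Icc (-(⌊μ⌋₊ : ℤ)) ⌊μ⌋₊ := by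
  rw [Finset.mem_Icc, ← abs_le, ← Int.cast_abs, Int.natCast_floor_eq_floor hμ, Int.le_floor]

lemma mem_smul_Omega_iff {μ : ℝ} (hμ : 0 < μ) (x : Plane) :
    x ∈ μ • Omega ↔ |x 0| ≤ μ ∧ max 0 (-x 0) ≤ x 1 ∧ x 1 ≤ μ * g (x 0 / μ) := by
  rw [Set.mem_smul_set_iff_inv_smul_mem₀ hμ.ne']
  simp only [Omega, Set.mem_ofPred_eq, PiLp.smul_apply, smul_eq_mul]
  rw [← and_assoc, ← abs_le, abs_mul, abs_of_pos (inv_pos.mpr hμ), inv_mul_le_iff₀ hμ, mul_one,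
    inv_mul_le_iff₀ hμ, inv_mul_eq_div]
  have : max 0 (-(x 0 / μ)) = μ⁻¹ * max 0 (-x 0) := by
    rw [mul_max_of_nonneg _ _ (inv_pos.mpr hμ).le, mul_zero]
    congr 1; field_simp
  rw [this, mul_le_mul_iff_right₀ (inv_pos.mpr hμ)]

/-- In column m the ordinates are j − 1/4. The shift makes the lower condition strict, j > max(0,
−m), so lattice points on the lower boundary cause no ambiguity. -/
lemma latticeCount_Omega {μ : ℝ} (hμ : 0 < μ) :
    (latticeCount Omega 0 (-1 / 4) μ : ℝ) = ∑ m ∈ Finset.Icc (-(⌊μ⌋₊ : ℤ)) ⌊μ⌋₊,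
      ((⌊μ * g (m / μ) + 1 / 4⌋ : ℝ) - max 0 (-(m : ℝ))) := by
  set F : (Σ _ : ℤ, ℤ) → Plane := fun p => intVec (p.1, p.2) + !₂[(0 : ℝ), -1 / 4] with hF
  have hF0 : ∀ p, F p 0 = p.1 := fun p => by simp [hF, intVec_apply_zero]
  have hF1 : ∀ p, F p 1 = p.2 - 1 / 4 := fun p => by simp [hF, intVec_apply_one]; ring
  have hinj : Function.Injective F := by
    rintro ⟨a, b⟩ ⟨c, d⟩ h
    have h0 := congrArg (fun x : Plane => x 0) h
    have h1 := congrArg (fun x : Plane => x 1) h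
    simp only [hF0, hF1, Int.cast_inj, sub_left_inj] at h0 h1
    rw [h0, h1]
  set T : Finset (Σ _ : ℤ, ℤ) := (Finset.Icc (-(⌊μ⌋₊ : ℤ)) ⌊μ⌋₊).sigma fun m =>
    Finset.Ioc (max 0 (-m)) ⌊μ * g (m / μ) + 1 / 4⌋ with hT
  have hS : (μ • Omega) ∩ shiftedLattice 0 (-1 / 4) = F '' (T : Set (Σ _ : ℤ, ℤ)) := by
    have key : ∀ p, F p ∈ μ • Omega ↔ p ∈ T := by
      intro p
      rw [mem_smul_Omega_iff hμ, hF0, hF1, hT, Finset.mem_sigma, abs_intCast_le_iff hμ.le,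
        Finset.mem_Ioc, Int.le_floor]
      refine and_congr_right fun _ => and_congr ?_ (by rw [sub_le_iff_le_add])
      rw [max_le_iff, max_lt_iff]
      refine and_congr ?_ ?_
      · constructor
        · intro h
          have : (0 : ℝ) < p.2 := by linarith
          exact_mod_cast this
        · intro h
          have : (1 : ℝ) ≤ p.2 := by exact_mod_cast h
          linarith
      · constructor
        · intro h
          have : (-p.1 : ℝ) < p.2 := by linarith
          exact_mod_cast this
        · intro h
          have : (-p.1 : ℝ) + 1 ≤ p.2 := by exact_mod_cast h
          linarith
    ext x
    constructor
    · rintro ⟨hx, k, rfl⟩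
      exact ⟨⟨k.1, k.2⟩, (key ⟨k.1, k.2⟩).mp hx, rfl⟩
    · rintro ⟨p, hp, rfl⟩
      exact ⟨(key p).mpr hp, (p.1, p.2), rfl⟩
  rw [latticeCount, hS, Set.ncard_image_of_injective _ hinj, Set.ncard_coe_finset, hT,
    Finset.card_sigma, Nat.cast_sum]
  refine Finset.sum_congr rfl fun m _ => ?_
  rw [Int.card_Ioc]
  have hle : max 0 (-m) ≤ ⌊μ * g (m / μ) + 1 / 4⌋ := by
    rw [Int.le_floor]
    push_cast
    have h1 := g_nonneg (m / μ)
    have h2 := neg_le_g (m / μ)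
    have h3 : μ * (-(m / μ)) ≤ μ * g (m / μ) := by gcongr
    have h4 : μ * (-(m / μ)) = -m := by field_simp
    refine max_le (by positivity) (by linarith)
  have : ((⌊μ * g (m / μ) + 1 / 4⌋ - max 0 (-m)).toNat : ℝ)
      = (((⌊μ * g (m / μ) + 1 / 4⌋ - max 0 (-m)).toNat   : ℤ) : ℝ) := (Int.cast_natCast _).symm
  rw [this, Int.toNat_of_nonneg (by linarith)]
  push_cast
  rfl

lemma sawSum_zero_eq {μ : ℝ} (hμ : 0 ≤ μ) {M : ℕ} (hM : μ ≤ M) (y : ℝ) :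
    sawSum μ M (0, y) = ∑ m ∈ Finset.Icc (-(⌊μ⌋₊ : ℤ)) ⌊μ⌋₊, saw (μ * g (m / μ) - y) := by
  have hn : ⌊μ⌋₊ ≤ M := Nat.floor_le_of_le hM
  rw [sawSum]
  symm
  refine Finset.sum_subset_zero_on_sdiff ?_ ?_ ?_
  · intro m hm
    rw [Finset.mem_Icc] at hm ⊢
    omega
  · intro m hm
    rw [Finset.mem_sdiff, ← abs_intCast_le_iff hμ] at hm
    simp [sawTerm, hm.2]
  · intro m hm
    rw [← abs_intCast_le_iff hμ] at hm
    simp [sawTerm, hm]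

lemma sum_Icc_neg_symm (n : ℕ) (f : ℤ → ℝ) (h : ∀ m, f (-m) = f m) :
    ∑ m ∈ Finset.Icc (-(n : ℤ)) n, f m = f 0 + 2 * ∑ m ∈ Finset.range n, f (m + 1) := by
  induction n with
  | zero => simp
  | succ n ih =>
    have : Finset.Icc (-((n + 1 : ℕ) : ℤ)) (n + 1 : ℕ)
        = insert (-((n : ℤ) + 1)) (insert ((n : ℤ) + 1) (Finset.Icc (-(n : ℤ)) n)) := by
      ext m
      simp only [Finset.mem_insert, Finset.mem_Icc]
      omega
    rw [this, Finset.sum_insert, Finset.sum_insert, ih, Finset.sum_range_succ, h]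
    · ring
    · simp only [Finset.mem_Icc]; omega
    · simp only [Finset.mem_insert, Finset.mem_Icc]; omega

/-- Each column contributes 1/4 − 1/2 = −1/4 besides its smooth part and its sawtooth. By `g_neg`
the smooth parts of the columns m and −m agree. -/
lemma latticeCount_Omega_eq {μ : ℝ} (hμ : 0 < μ) {M : ℕ} (hM : μ ≤ M) :
    (latticeCount Omega 0 (-1 / 4) μ : ℝ) = μ * g 0
      + 2 * ∑ m ∈ Finset.range ⌊μ⌋₊, μ * g ((m + 1) / μ) - (2 * ⌊μ⌋₊ + 1) / 4
      - sawSum μ M (0, -1 / 4) := by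
  have h1 : ∀ m : ℤ, μ * g ((-m : ℤ) / μ) - max 0 (-((-m : ℤ) : ℝ))
      = μ * g (m / μ) - max 0 (-(m : ℝ)) := by
    intro m
    have : max 0 (m : ℝ) - max 0 (-(m : ℝ)) = m := by
      rcases le_total 0 (m : ℝ) with h | h
      · rw [max_eq_right h, max_eq_left (by linarith), sub_zero]
      · rw [max_eq_left h, max_eq_right (by linarith)]; ring
    push_cast
    rw [neg_neg, neg_div, g_neg, mul_add, mul_div_cancel₀ _ hμ.ne']
    linarith
  have h2 := sum_Icc_neg_symm ⌊μ⌋₊ (fun m => μ * g (m / μ) - max 0 (-(m : ℝ))) h1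
  have h3 : ∀ m : ℕ, μ * g (((m : ℤ) + 1 : ℤ) / μ) - max 0 (-(((m : ℤ) + 1 : ℤ) : ℝ))
      = μ * g ((m + 1) / μ) := by
    intro m
    push_cast
    rw [max_eq_left (by have : (0 : ℝ) ≤ m := m.cast_nonneg
                        linarith), sub_zero]
  simp only [h3] at h2
  rw [latticeCount_Omega hμ, sawSum_zero_eq hμ.le hM]
  have h4 : ∀ m ∈ Finset.Icc (-(⌊μ⌋₊ : ℤ)) ⌊μ⌋₊, (⌊μ * g (m / μ) + 1 / 4⌋ : ℝ) - max 0 (-(m : ℝ))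
      = (μ * g (m / μ) - max 0 (-(m : ℝ))) - 1 / 4 - saw (μ * g (m / μ) - -1 / 4) := by
    intro m _
    have : μ * g (m / μ) - -1 / 4 = μ * g (m / μ) + 1 / 4 := by ring
    rw [this, saw, Int.fract]
    ring
  rw [Finset.sum_congr rfl h4, Finset.sum_sub_distrib, Finset.sum_sub_distrib, h2]
  simp only [Int.cast_zero, zero_div, neg_zero, max_self, sub_zero, Finset.sum_const, Int.card_Icc,
    nsmul_eq_mul]
  have : ((((⌊μ⌋₊ : ℤ) + 1 - -(⌊μ⌋₊ : ℤ)).toNat : ℕ) : ℝ) = 2 * ⌊μ⌋₊ + 1 := by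
    have : ((⌊μ⌋₊ : ℤ) + 1 - -(⌊μ⌋₊ : ℤ)).toNat = 2 * ⌊μ⌋₊ + 1 := by omega
    rw [this]; push_cast; ring
  rw [this]
  ring

/-! ### The area -/

/-- By `g_neg` the length g(t) − max(0, −t) of the vertical section is even in t. -/
lemma volume_real_Omega : MeasureTheory.volume.real Omega = 2 * ∫ t in (0 : ℝ)..1, g t := by
  have hcg := continuous_g
  set S : Set (ℝ × ℝ) := planeEquiv ⁻¹' Omega with hS
  have hmem : ∀ p, p ∈ S ↔ p.1 ∈ Set.Icc (-1 : ℝ) 1 ∧ p.2 ∈ Set.Icc (max 0 (-p.1)) (g p.1) := by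
    intro p
    simp only [hS, Set.mem_preimage, Omega, Set.mem_ofPred_eq, planeEquiv_zero, planeEquiv_one,
      Set.mem_Icc, and_assoc]
  have hSm : MeasurableSet S := by
    have : S = {p | p.1 ∈ Set.Icc (-1 : ℝ) 1} ∩ ({p | max 0 (-p.1) ≤ p.2} ∩ {p | p.2 ≤ g p.1}) := by
      ext p
      rw [hmem]; rfl
    rw [this]
    refine (measurable_fst measurableSet_Icc).inter (MeasurableSet.inter ?_ ?_)
    · exact measurableSet_le (by fun_prop) (by fun_prop)
    · exact measurableSet_le (by fun_prop) (hcg.measurable.comp measurable_fst)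
  set H : ℝ → ℝ := fun t => g t - max 0 (-t) with hH
  have hHc : Continuous H := by fun_prop
  have hH0 : ∀ t, 0 ≤ H t := fun t => sub_nonneg.mpr (max_le (g_nonneg t) (neg_le_g t))
  have h1 : MeasureTheory.volume Omega = ENNReal.ofReal (∫ t in Set.Icc (-1 : ℝ) 1, H t) := by
    rw [← measurePreserving_planeEquiv.measure_preimage_equiv Omega, ← hS,
      MeasureTheory.Measure.volume_eq_prod, MeasureTheory.Measure.prod_apply hSm,
      MeasureTheory.ofReal_integral_eq_lintegral_ofReal (hHc.integrableOn_Icc)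
        (Filter.Eventually.of_forall hH0), ← MeasureTheory.lintegral_indicator measurableSet_Icc]
    refine MeasureTheory.lintegral_congr fun t => ?_
    by_cases ht : t ∈ Set.Icc (-1 : ℝ) 1
    · rw [Set.indicator_of_mem ht, hH, ← Real.volume_Icc]
      congr 1
      ext y
      rw [Set.mem_preimage, hmem]
      simp [Set.mem_Icc.mp ht]
    · rw [Set.indicator_of_notMem ht]
      convert MeasureTheory.measure_empty (μ := MeasureTheory.volume)
      ext y
      rw [Set.mem_preimage, hmem]
      simp only [ht, false_and, Set.mem_empty_iff_false]
  rw [MeasureTheory.Measure.real, h1, ENNReal.toReal_ofReal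
    (MeasureTheory.integral_nonneg hH0), MeasureTheory.integral_Icc_eq_integral_Ioc,
    ← intervalIntegral.integral_of_le (by norm_num),
    ← intervalIntegral.integral_add_adjacent_intervals (b := 0)
      (hHc.intervalIntegrable _ _) (hHc.intervalIntegrable _ _), two_mul]
  have h2 : ∫ t in (0 : ℝ)..1, H t = ∫ t in (0 : ℝ)..1, g t := by
    refine intervalIntegral.integral_congr fun t ht => ?_
    rw [Set.uIcc_of_le zero_le_one] at ht
    simp only [hH]
    rw [max_eq_left (by linarith [ht.1]), sub_zero]
  have h3 : ∫ t in (-1 : ℝ)..0, H t = ∫ t in (0 : ℝ)..1, g t := by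
    have h := intervalIntegral.integral_comp_neg (a := (0 : ℝ)) (b := 1) H
    rw [neg_zero] at h
    rw [← h]
    refine intervalIntegral.integral_congr fun t ht => ?_
    rw [Set.uIcc_of_le zero_le_one] at ht
    simp only [hH]
    rw [neg_neg, max_eq_right ht.1, g_neg]
    ring
  rw [h2, h3]

/-! ### The trapezoidal and midpoint rules for convex functions -/

lemma integral_unit_le_trapezoid {f : ℝ → ℝ} (hf : ConvexOn ℝ Set.univ f) (hc : Continuous f)
    (a : ℝ) : ∫ u in a..(a + 1), f u ≤ (f a + f (a + 1)) / 2 := by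
  have h0 : ∫ u in a..(a + 1), f u = ∫ s in (0 : ℝ)..1, f (a + s) := by
    rw [intervalIntegral.integral_comp_add_left, add_zero]
  have h1 : ∫ s in (0 : ℝ)..1, f (a + s) ≤ ∫ s in (0 : ℝ)..1, (f a + s * (f (a + 1) - f a)) := by
    refine intervalIntegral.integral_mono_on zero_le_one
      (Continuous.intervalIntegrable (by fun_prop) _ _)
      (Continuous.intervalIntegrable (by fun_prop) _ _) fun s hs => ?_
    have h := hf.2 (Set.mem_univ a) (Set.mem_univ (a + 1)) (sub_nonneg.mpr hs.2) hs.1 (by ring)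
    simp only [smul_eq_mul] at h
    have e : (1 - s) * a + s * (a + 1) = a + s := by ring
    rw [e] at h
    linarith
  rw [h0]
  refine h1.trans (le_of_eq ?_)
  rw [intervalIntegral.integral_add (by simp) (Continuous.intervalIntegrable (by fun_prop) _ _),
    intervalIntegral.integral_mul_const, integral_id]
  simp
  ring

lemma midpoint_le_integral_unit {f : ℝ → ℝ} (hf : ConvexOn ℝ Set.univ f) (hc : Continuous f)
    (a : ℝ) : f a ≤ ∫ u in (a - 1 / 2)..(a + 1 / 2), f u := by
  have h0 : ∫ u in (a - 1 / 2)..(a + 1 / 2), f u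
      = ∫ s in (-(1 / 2) : ℝ)..(1 / 2), f (a + s) := by
    rw [intervalIntegral.integral_comp_add_left, ← sub_eq_add_neg]
  have h1 : ∫ s in (-(1 / 2) : ℝ)..(1 / 2), f (a + s)
      = ∫ s in (-(1 / 2) : ℝ)..(1 / 2), f (a - s) := by
    have h := intervalIntegral.integral_comp_neg (a := (-(1 / 2) : ℝ)) (b := 1 / 2)
      (fun s => f (a + s))
    rw [neg_neg] at h
    rw [← h]
    simp only [sub_eq_add_neg]
  have h2 : ∫ _ in (-(1 / 2) : ℝ)..(1 / 2), 2 * f a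
      ≤ ∫ s in (-(1 / 2) : ℝ)..(1 / 2), (f (a + s) + f (a - s)) := by
    refine intervalIntegral.integral_mono_on (by norm_num) (by simp)
      (Continuous.intervalIntegrable (by fun_prop) _ _) fun s _ => ?_
    have h := hf.2 (Set.mem_univ (a + s)) (Set.mem_univ (a - s))
      (by norm_num : (0 : ℝ) ≤ 1 / 2) (by norm_num : (0 : ℝ) ≤ 1 / 2) (by norm_num)
    simp only [smul_eq_mul] at h
    have e : 1 / 2 * (a + s) + 1 / 2 * (a - s) = a := by ring
    rw [e] at h
    linarith
  rw [intervalIntegral.integral_add (Continuous.intervalIntegrable (by fun_prop) _ _)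
    (Continuous.intervalIntegrable (by fun_prop) _ _), ← h1, ← h0,
    intervalIntegral.integral_const] at h2
  norm_num at h2
  linarith

/-- Comparison of a sum with an integral for a convex, nonnegative function with Lipschitz
constant one which vanishes from `n + 1` on. -/
lemma abs_sum_sub_integral_le {f : ℝ → ℝ} (hf : ConvexOn ℝ Set.univ f) (hc : Continuous f)
    (hf0 : ∀ u, 0 ≤ f u) (hl : ∀ u v, |f u - f v| ≤ |u - v|) (n : ℕ) (hn : f (n + 1) = 0) :
    |f 0 + 2 * ∑ m ∈ Finset.range n, f (m + 1) - 2 * ∫ u in (0 : ℝ)..(n + 1), f u| ≤ 1 / 2 := by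
  have hi : ∀ a b, IntervalIntegrable f MeasureTheory.volume a b := fun a b =>
    hc.intervalIntegrable a b
  have h1 : ∫ u in (0 : ℝ)..(n + 1), f u ≤ f 0 / 2 + ∑ m ∈ Finset.range n, f (m + 1) := by
    have h := intervalIntegral.sum_integral_adjacent_intervals (μ := MeasureTheory.volume) (f := f)
      (a := fun i : ℕ => (i : ℝ)) (n := n + 1) (fun i _ => hi _ _)
    rw [Nat.cast_zero, Nat.cast_succ] at h
    rw [← h]
    have h2 : ∑ k ∈ Finset.range (n + 1), ∫ u in (k : ℝ)..((k + 1 : ℕ) : ℝ), f u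
        ≤ ∑ k ∈ Finset.range (n + 1), (f k + f (k + 1)) / 2 := by
      refine Finset.sum_le_sum fun k _ => ?_
      push_cast
      exact integral_unit_le_trapezoid hf hc k
    refine h2.trans (le_of_eq ?_)
    rw [← Finset.sum_div, Finset.sum_add_distrib, Finset.sum_range_succ', Finset.sum_range_succ, hn]
    push_cast
    ring
  -- The midpoint rule accounts for [1/2, n + 1/2]. On [0, 1/2] the Lipschitz bound f ≥ f(0) − 1/2
  -- loses 1/4.
  have h2 : f 0 / 2 + ∑ m ∈ Finset.range n, f (m + 1) ≤ (∫ u in (0 : ℝ)..(n + 1), f u) + 1 / 4 := by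
    have h := intervalIntegral.sum_integral_adjacent_intervals (μ := MeasureTheory.volume) (f := f)
      (a := fun i : ℕ => (i : ℝ) + 1 / 2) (n := n) (fun i _ => hi _ _)
    have h3 : ∑ m ∈ Finset.range n, f (m + 1)
        ≤ ∑ k ∈ Finset.range n, ∫ u in ((k : ℝ) + 1 / 2)..(((k + 1 : ℕ) : ℝ) + 1 / 2), f u := by
      refine Finset.sum_le_sum fun k _ => ?_
      have := midpoint_le_integral_unit hf hc (k + 1)
      have e : (k : ℝ) + 1 - 1 / 2 = k + 1 / 2 := by ring
      rw [e] at this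
      exact_mod_cast this
    rw [h] at h3
    have h4 : f 0 / 2 - 1 / 4 ≤ ∫ u in (0 : ℝ)..(1 / 2), f u := by
      have h5 : ∫ _ in (0 : ℝ)..(1 / 2), (f 0 - 1 / 2) ≤ ∫ u in (0 : ℝ)..(1 / 2), f u := by
        refine intervalIntegral.integral_mono_on (by norm_num) (by simp) (hi _ _) fun u hu => ?_
        have := (abs_le.mp (hl u 0)).1
        rw [sub_zero, abs_of_nonneg hu.1] at this
        linarith [hu.2]
      rw [intervalIntegral.integral_const, smul_eq_mul] at h5
      linarith
    have h5 : 0 ≤ ∫ u in ((n : ℝ) + 1 / 2)..(n + 1), f u :=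
      intervalIntegral.integral_nonneg (by linarith) fun u _ => hf0 u
    have h6 := intervalIntegral.integral_add_adjacent_intervals (hi 0 (1 / 2)) (hi (1 / 2) (n + 1 / 2))
    have h7 := intervalIntegral.integral_add_adjacent_intervals (hi 0 (n + 1 / 2))
      (hi (n + 1 / 2) (n + 1))
    rw [Nat.cast_zero, zero_add] at h3
    linarith
  rw [abs_le]
  constructor <;> linarith

/-- The lattice point count in terms of the sawtooth sum. -/
lemma abs_latticeCount_add_sawSum_le {μ : ℝ} (hμ : 0 < μ) {M : ℕ} (hM : μ ≤ M) :
    |(latticeCount Omega 0 (-1 / 4) μ : ℝ) - MeasureTheory.volume.real Omega * μ ^ 2 + μ / 2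
      + sawSum μ M (0, -1 / 4)| ≤ 1 := by
  have hcg := continuous_g
  have hconv : ConvexOn ℝ Set.univ fun u => μ * g (u / μ) := by
    refine ⟨convex_univ, fun x _ y _ a b ha hb hab => ?_⟩
    have h := convexOn_g.2 (Set.mem_univ (x / μ)) (Set.mem_univ (y / μ)) ha hb hab
    simp only [smul_eq_mul] at h ⊢
    have e : (a * x + b * y) / μ = a * (x / μ) + b * (y / μ) := by ring
    rw [e]
    calc μ * g (a * (x / μ) + b * (y / μ)) ≤ μ * (a * g (x / μ) + b * g (y / μ)) := by gcongr
      _ = _ := by ring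
  have hlip : ∀ u v, |μ * g (u / μ) - μ * g (v / μ)| ≤ |u - v| := by
    intro u v
    rw [← mul_sub, abs_mul, abs_of_pos hμ]
    calc μ * |g (u / μ) - g (v / μ)| ≤ μ * |u / μ - v / μ| :=
          mul_le_mul_of_nonneg_left (abs_g_sub_le _ _) hμ.le
      _ = |u - v| := by
          rw [← sub_div, abs_div, abs_of_pos hμ, mul_div_cancel₀ _ hμ.ne']
  have hlt := Nat.lt_floor_add_one μ
  have hfl := Nat.floor_le hμ.le
  have hz : ∀ u, μ ≤ u → μ * g (u / μ) = 0 := fun u hu => by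
    rw [g_of_one_le ((one_le_div hμ).mpr hu), mul_zero]
  have h1 := abs_sum_sub_integral_le hconv (by fun_prop)
    (fun u => mul_nonneg hμ.le (g_nonneg _)) hlip ⌊μ⌋₊ (hz _ hlt.le)
  have hc : Continuous fun u => μ * g (u / μ) := by fun_prop
  have h2 : ∫ u in (0 : ℝ)..(⌊μ⌋₊ + 1), μ * g (u / μ) = μ ^ 2 * ∫ t in (0 : ℝ)..1, g t := by
    rw [← intervalIntegral.integral_add_adjacent_intervals (b := μ) (hc.intervalIntegrable _ _)
      (hc.intervalIntegrable _ _)]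
    have h3 : ∫ u in μ..(⌊μ⌋₊ + 1), μ * g (u / μ) = 0 := by
      rw [intervalIntegral.integral_congr (g := fun _ => 0), intervalIntegral.integral_zero]
      intro u hu
      rw [Set.uIcc_of_le hlt.le] at hu
      exact hz u hu.1
    rw [h3, add_zero, intervalIntegral.integral_const_mul, intervalIntegral.integral_comp_div _ hμ.ne',
      zero_div, div_self hμ.ne', smul_eq_mul]
    ring
  rw [zero_div, h2] at h1
  rw [latticeCount_Omega_eq hμ hM, volume_real_Omega]
  rw [abs_le] at h1 ⊢
  -- 1/2 is lost in replacing the sum by the integral and at most 1/4 in replacing (2⌊μ⌋ + 1)/4 by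
  -- μ/2.
  constructor <;> linarith [h1.1, h1.2]

lemma integral_g_le_one : ∫ t in (0 : ℝ)..1, g t ≤ 1 := by
  have h : ∫ t in (0 : ℝ)..1, g t ≤ ∫ _ in (0 : ℝ)..1, (1 : ℝ) := by
    refine intervalIntegral.integral_mono_on zero_le_one (continuous_g.intervalIntegrable _ _)
      (by simp) fun t ht => ?_
    have h1 := g_sub_le ht.1
    have h2 : (Real.pi)⁻¹ ≤ 1 := inv_le_one_of_one_le₀ (by linarith [Real.pi_gt_three])
    rw [g_zero] at h1
    rw [one_div] at h1
    linarith
  simpa using h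


/-! ### Comparison of the sawtooth sum with its averages -/

/-- The jumps of the sawtooth go downwards, so an increase of the argument raises the value by at
most as much. This one-sided continuity makes the squeeze between averages possible. -/
lemma saw_add_le {d : ℝ} (hd : 0 ≤ d) (u : ℝ) : saw (u + d) ≤ saw u + d := by
  have h : (⌊u⌋ : ℝ) ≤ ⌊u + d⌋ := by exact_mod_cast Int.floor_mono (by linarith)
  simp only [saw, Int.fract]
  linarith

/-- The four outermost columns, where translation may cross the end of the curve, are estimated
trivially by 1 each. -/
lemma sum_Icc_neg_le_add {K : ℕ} {a b : ℤ → ℝ} {η : ℝ}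
    (h1 : ∀ m ∈ Finset.Icc (-(K : ℤ)) K, a m ≤ b m + η) (h2 : ∀ m, a m ≤ b m + 1) :
    ∑ m ∈ Finset.Icc (-((K + 2 : ℕ) : ℤ)) (K + 2 : ℕ), a m
      ≤ ∑ m ∈ Finset.Icc (-((K + 2 : ℕ) : ℤ)) (K + 2 : ℕ), b m + ((2 * K + 1) * η + 4) := by
  have hsub : Finset.Icc (-(K : ℤ)) K ⊆ Finset.Icc (-((K + 2 : ℕ) : ℤ)) (K + 2 : ℕ) := by
    intro m hm
    rw [Finset.mem_Icc] at hm ⊢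
    omega
  have hcard : (Finset.Icc (-((K + 2 : ℕ) : ℤ)) (K + 2 : ℕ) \ Finset.Icc (-(K : ℤ)) K).card = 4 := by
    rw [Finset.card_sdiff_of_subset hsub, Int.card_Icc, Int.card_Icc]
    omega
  have hcard' : ((Finset.Icc (-(K : ℤ)) K).card : ℝ) = 2 * K + 1 := by
    have : (Finset.Icc (-(K : ℤ)) K).card = 2 * K + 1 := by rw [Int.card_Icc]; omega
    rw [this]; push_cast; ring
  rw [← Finset.sum_sdiff hsub, ← Finset.sum_sdiff hsub (f := b)]
  have e1 := Finset.sum_le_sum h1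
  have e2 := Finset.sum_le_sum (s := Finset.Icc (-((K + 2 : ℕ) : ℤ)) (K + 2 : ℕ) \
    Finset.Icc (-(K : ℤ)) K) fun m _ => h2 m
  rw [Finset.sum_add_distrib, Finset.sum_const, nsmul_eq_mul] at e1 e2
  rw [hcard'] at e1
  rw [hcard] at e2
  push_cast at e1 e2 ⊢
  linarith

/-- The increment of the argument of the sawtooth function under a small translation. -/
lemma abs_curve_sub_le {μ : ℝ} (hμ : 0 < μ) (m x : ℝ) :
    |μ * g ((m + x) / μ) - μ * g (m / μ)| ≤ |x| := by
  rw [← mul_sub, abs_mul, abs_of_pos hμ]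
  calc μ * |g ((m + x) / μ) - g (m / μ)| ≤ μ * |(m + x) / μ - m / μ| :=
        mul_le_mul_of_nonneg_left (abs_g_sub_le _ _) hμ.le
    _ = |x| := by
        rw [← sub_div, abs_div, abs_of_pos hμ, mul_div_cancel₀ _ hμ.ne', add_sub_cancel_left]

/-- The sawtooth sum is almost monotone under translations. -/
lemma sawSum_le_sawSum_add {μ : ℝ} {K : ℕ} (hK : K + 1 ≤ μ) {ε : ℝ} (hε : ε ≤ 1) {x y : ℝ}
    (hx : |x| ≤ ε) (hy : |y| ≤ ε) :
    sawSum μ (K + 2) (x, -1 / 4 - 2 * ε - y) ≤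
        sawSum μ (K + 2) (0, -1 / 4) + ((2 * K + 1) * (4 * ε) + 4) ∧
      sawSum μ (K + 2) (0, -1 / 4) ≤
        sawSum μ (K + 2) (x, -1 / 4 - 2 * (-ε) - y) + ((2 * K + 1) * (4 * ε) + 4) := by
  have hK0 : (0 : ℝ) ≤ K := K.cast_nonneg
  have hμ : 0 < μ := by linarith
  have htriv : ∀ p q, sawTerm μ p ≤ sawTerm μ q + 1 := fun p q => by
    linarith [(abs_le.mp (abs_sawTerm_le μ p)).2, (abs_le.mp (abs_sawTerm_le μ q)).1]
  have hin : ∀ m ∈ Finset.Icc (-(K : ℤ)) K, ∀ x : ℝ, |x| ≤ ε → |(m : ℝ) + x| ≤ μ := by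
    intro m hm x hx
    rw [Finset.mem_Icc] at hm
    have h1 : -(K : ℝ) ≤ m := by exact_mod_cast hm.1
    have h2 : (m : ℝ) ≤ K := by exact_mod_cast hm.2
    rw [abs_le] at hx ⊢
    constructor <;> linarith [hx.1, hx.2]
  have hε0 : 0 ≤ ε := (abs_nonneg x).trans hx
  have h0 : |(0 : ℝ)| ≤ ε := by rwa [abs_zero]
  rw [abs_le] at hy
  constructor
  · refine sum_Icc_neg_le_add (fun m hm => ?_) fun m => htriv _ _
    have hm0 := hin m hm 0 h0
    rw [add_zero] at hm0
    simp only [sawTerm, hin m hm x hx, add_zero, hm0, if_true]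
    have hd := abs_le.mp ((abs_curve_sub_le hμ m x).trans hx)
    -- The curve and the point each move by at most ε, so the shift 2ε makes the increment
    -- nonnegative, and it is at most 4ε.
    have h := saw_add_le (d := μ * g ((m + x) / μ) - μ * g (m / μ) + 2 * ε + y)
      (by linarith [hd.1, hy.1]) (μ * g (m / μ) - -1 / 4)
    have e : μ * g (m / μ) - -1 / 4 + (μ * g ((m + x) / μ) - μ * g (m / μ) + 2 * ε + y)
        = μ * g ((m + x) / μ) - (-1 / 4 - 2 * ε - y) := by ring
    rw [e] at h
    linarith [hd.2, hy.2]
  · refine sum_Icc_neg_le_add (fun m hm => ?_) fun m => htriv _ _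
    have hm0 := hin m hm 0 h0
    rw [add_zero] at hm0
    simp only [sawTerm, hin m hm x hx, add_zero, hm0, if_true]
    have hd := abs_le.mp ((abs_curve_sub_le hμ m x).trans hx)
    have h := saw_add_le (d := μ * g (m / μ) - μ * g ((m + x) / μ) + 2 * ε - y)
      (by linarith [hd.2, hy.2]) (μ * g ((m + x) / μ) - (-1 / 4 - 2 * (-ε) - y))
    have e : μ * g ((m + x) / μ) - (-1 / 4 - 2 * (-ε) - y)
        + (μ * g (m / μ) - μ * g ((m + x) / μ) + 2 * ε - y) = μ * g (m / μ) - -1 / 4 := by ring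
    rw [e] at h
    linarith [hd.1, hy.1]

/-- As ρ is a probability density on the unit ball, the average is at most c. The norm appears
because the Fourier side supplies a bound for the norm of a complex series. -/
lemma IsMollifier.neg_norm_integral_le {ρ : Plane → ℝ} (hρ : IsMollifier ρ) {h : Plane → ℝ}
    (hm : Measurable h) {B c : ℝ} (hB : ∀ v, |h v| ≤ B) (hc : ∀ v, ‖v‖ ≤ 1 → h v ≤ c) :
    -‖∫ v, (ρ v : ℂ) * (h v : ℂ)‖ ≤ c := by
  have e : ∫ v, (ρ v : ℂ) * (h v : ℂ) = ((∫ v, ρ v * h v : ℝ) : ℂ) := by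
    simp_rw [← Complex.ofReal_mul]
    exact integral_ofReal
  have hint : MeasureTheory.Integrable fun v => ρ v * h v :=
    hρ.integrable.mul_bdd hm.aestronglyMeasurable (Filter.Eventually.of_forall hB)
  have hle : ∫ v, ρ v * h v ≤ ∫ v, ρ v * c := by
    refine MeasureTheory.integral_mono hint (hρ.integrable.mul_const c) fun v => ?_
    by_cases h0 : ρ v = 0
    · simp [h0]
    · exact mul_le_mul_of_nonneg_left (hc v (hρ.norm_le_one v h0)) (hρ.nonneg v)
  rw [MeasureTheory.integral_mul_const, hρ.integral_eq_one, one_mul] at hle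
  rw [e, Complex.norm_real]
  exact (neg_abs_le _).trans hle

lemma IsMollifier.le_norm_integral {ρ : Plane → ℝ} (hρ : IsMollifier ρ) {h : Plane → ℝ}
    (hm : Measurable h) {B c : ℝ} (hB : ∀ v, |h v| ≤ B) (hc : ∀ v, ‖v‖ ≤ 1 → c ≤ h v) :
    c ≤ ‖∫ v, (ρ v : ℂ) * (h v : ℂ)‖ := by
  have h1 := hρ.neg_norm_integral_le hm.neg (c := -c) (fun v => by rw [Pi.neg_apply, abs_neg]; exact hB v)
    fun v hv => neg_le_neg (hc v hv)
  simp only [Pi.neg_apply, Complex.ofReal_neg, mul_neg, MeasureTheory.integral_neg, norm_neg] at h1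
  linarith

/-- The estimate of the sawtooth sum by the dual sums. -/
lemma IsMollifier.abs_sawSum_le {ρ : Plane → ℝ} (hρ : IsMollifier ρ) {ε μ : ℝ} (hε : 0 < ε)
    (hε1 : ε ≤ 1 / 32) {K : ℕ} (hK : K + 1 ≤ μ) (hK' : μ ≤ K + 2) :
    |sawSum μ (K + 2) (0, -1 / 4)| ≤ μ * max ‖dualSum ρ μ ε ε‖ ‖dualSum ρ μ ε (-ε)‖
      + (240 + 772 * zetaConst) * √μ + (8 * (μ * ε) + 4) := by
  have hK0 : (0 : ℝ) ≤ K := K.cast_nonneg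
  have hμ : 1 ≤ μ := by linarith
  have hM : μ ≤ (K + 2 : ℕ) := by push_cast; exact hK'
  have hE : (2 * K + 1) * (4 * ε) + 4 ≤ 8 * (μ * ε) + 4 := by
    have : (2 * K + 1) * (4 * ε) ≤ (2 * μ) * (4 * ε) := by gcongr; linarith
    linarith
  have hmeas : ∀ δ : ℝ, Measurable fun v : Plane =>
      sawSum μ (K + 2) (0 - ε * v 0, -1 / 4 - 2 * δ - ε * v 1) := fun δ =>
    (measurable_sawSum μ (K + 2)).comp (by fun_prop)
  have hsmall : ∀ v : Plane, ‖v‖ ≤ 1 → ∀ i, |ε * v i| ≤ ε := fun v hv i => by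
    rw [abs_mul, abs_of_pos hε]
    exact mul_le_of_le_one_right hε.le ((abs_apply_le_norm v i).trans hv)
  have hsmall' : ∀ v : Plane, ‖v‖ ≤ 1 → |0 - ε * v 0| ≤ ε := fun v hv => by
    rw [zero_sub, abs_neg]; exact hsmall v hv 0
  -- The shift δ = ε bounds the sawtooth sum from below, δ = −ε from above.
  have hlo := hρ.neg_norm_integral_le (hmeas ε) (fun v => DiskLattice.abs_sawSum_le _ _ _) fun v hv =>
    (sawSum_le_sawSum_add hK (by linarith) (hsmall' v hv) (hsmall v hv 1)).1
  have hhi := hρ.le_norm_integral (hmeas (-ε)) (fun v => DiskLattice.abs_sawSum_le _ _ _) fun v hv =>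
    sub_le_iff_le_add.mpr
      (sawSum_le_sawSum_add hK (by linarith) (hsmall' v hv) (hsmall v hv 1)).2
  have hδ1 : |ε| ≤ ε := (abs_of_pos hε).le
  have hδ2 : |-ε| ≤ ε := by rw [abs_neg]; exact hδ1
  rw [hρ.integral_sawSum_eq hε hε1 hδ1 (by linarith) hM] at hlo
  rw [hρ.integral_sawSum_eq hε hε1 hδ2 (by linarith) hM] at hhi
  have b1 := hρ.norm_tsum_mollTerm_le hε hε1 hδ1 hμ
  have b2 := hρ.norm_tsum_mollTerm_le hε hε1 hδ2 hμ
  have m1 : μ * ‖dualSum ρ μ ε ε‖ ≤ μ * max ‖dualSum ρ μ ε ε‖ ‖dualSum ρ μ ε (-ε)‖ := by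
    gcongr; exact le_max_left _ _
  have m2 : μ * ‖dualSum ρ μ ε (-ε)‖ ≤ μ * max ‖dualSum ρ μ ε ε‖ ‖dualSum ρ μ ε (-ε)‖ := by
    gcongr; exact le_max_right _ _
  rw [abs_le]
  constructor <;> linarith

lemma volume_real_Omega_nonneg_le_two :
    0 ≤ MeasureTheory.volume.real Omega ∧ MeasureTheory.volume.real Omega ≤ 2 :=
  ⟨MeasureTheory.measureReal_nonneg, by rw [volume_real_Omega]; linarith [integral_g_le_one]⟩

/-- Only the column m = 0 remains, and μ/π + 1/4 < 1. -/
lemma latticeCount_Omega_eq_zero {μ : ℝ} (hμ : 0 < μ) (hμ1 : μ < 1) :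
    (latticeCount Omega 0 (-1 / 4) μ : ℝ) = 0 := by
  have h : ⌊μ * g 0 + 1 / 4⌋ = 0 := by
    rw [Int.floor_eq_zero_iff, Set.mem_Ico, g_zero]
    have h1 : 1 / Real.pi ≤ 1 / 3 := by
      gcongr; exact Real.pi_gt_three.le
    have h2 : μ * (1 / Real.pi) ≤ 1 * (1 / 3) := by gcongr
    constructor
    · positivity
    · linarith
  rw [latticeCount_Omega hμ, Nat.floor_eq_zero.mpr hμ1]
  simp [-one_div, h]

/-- The arithmetic-geometric mean inequality for ε⁻¹ and με, whose product is μ. It absorbs all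
errors O(√μ) into the terms allowed by the theorem. -/
lemma sqrt_le_inv_add_mul {μ ε : ℝ} (hμ : 0 ≤ μ) (hε : 0 < ε) : √μ ≤ ε⁻¹ + μ * ε := by
  have h : μ * ε = √μ * (√μ * ε) := by rw [← mul_assoc, Real.mul_self_sqrt hμ]
  have h1 : ε⁻¹ * ε = 1 := inv_mul_cancel₀ hε.ne'
  have h2 : 0 ≤ ε⁻¹ * (1 - √μ * ε) ^ 2 := by positivity
  have h3 : ε⁻¹ * (1 - √μ * ε) ^ 2 = ε⁻¹ - 2 * √μ + √μ * (√μ * ε) := by field_simp; ring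
  linarith [Real.sqrt_nonneg μ]

end DiskLattice

theorem mainTheorem6 :
    ∃ C : ℝ, 0 < C ∧
      ∀ ρ : DiskLattice.Plane → ℝ,
        ContDiff ℝ ∞ ρ → HasCompactSupport ρ →
        (∀ x, 0 ≤ ρ x) →
        (∀ x y, ‖x‖ = ‖y‖ → ρ x = ρ y) →
        (∫ x, ρ x) = 1 →
        tsupport ρ ⊆ Metric.closedBall 0 1 →
        ∀ μ : ℝ, 0 < μ → ∀ ε : ℝ, 0 < ε →
          (∀ δ ∈ ({ε, -ε} : Set ℝ),
            Summable fun k : {k : ℤ × ℤ // DiskLattice.intVec k ∈ DiskLattice.cone} =>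
              DiskLattice.dualTerm ρ μ ε δ k) ∧
          |(DiskLattice.latticeCount DiskLattice.Omega 0 (-1 / 4) μ : ℝ)
              - MeasureTheory.volume.real DiskLattice.Omega * μ ^ 2 + μ / 2| ≤
            C * (ε⁻¹ + μ * ε +
              μ * max ‖DiskLattice.dualSum ρ μ ε ε‖ ‖DiskLattice.dualSum ρ μ ε (-ε)‖) := by
  have hζ := DiskLattice.zetaConst_nonneg
  -- 240 + 772 `zetaConst` comes from the frequency sums, 8 from the term 8με of the squeeze, and 5
  -- from its additive 4 and the error 1 of the count, for which 1 ≤ √μ is used.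
  refine ⟨253 + 772 * DiskLattice.zetaConst, by positivity, ?_⟩
  intro ρ hsm hcs hnn _ hint hsupp μ hμ ε hε
  have hρ : DiskLattice.IsMollifier ρ :=
    ⟨hsm, hcs, hnn, hint, fun x hx => mem_closedBall_zero_iff.mp (hsupp (subset_tsupport ρ hx))⟩
  refine ⟨fun δ _ => hρ.summable_dualTerm hε hμ δ, ?_⟩
  set D := max ‖DiskLattice.dualSum ρ μ ε ε‖ ‖DiskLattice.dualSum ρ μ ε (-ε)‖ with hD
  set A := MeasureTheory.volume.real DiskLattice.Omega with hA
  have hμD : 0 ≤ μ * D := mul_nonneg hμ.le ((norm_nonneg _).trans (le_max_left _ _))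
  have hμε : 0 < μ * ε := mul_pos hμ hε
  have hεi : 0 < ε⁻¹ := inv_pos.mpr hε
  have hsq := DiskLattice.sqrt_le_inv_add_mul hμ.le hε
  set R := ε⁻¹ + μ * ε + μ * D with hR
  have hζR : 0 ≤ DiskLattice.zetaConst * R := by positivity
  -- For μ < 1 there are no lattice points, and the main terms are O(μ), hence O(√μ).
  rcases lt_or_ge μ 1 with hμ1 | hμ1
  · obtain ⟨hA0, hA2⟩ := DiskLattice.volume_real_Omega_nonneg_le_two
    rw [← hA] at hA0 hA2
    rw [DiskLattice.latticeCount_Omega_eq_zero hμ hμ1]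
    have h1 : μ ≤ √μ := Real.le_sqrt_of_sq_le (by nlinarith)
    have h2 : A * μ ^ 2 ≤ 2 * μ := by
      have h3 : μ ^ 2 ≤ μ := by nlinarith
      calc A * μ ^ 2 ≤ 2 * μ := by gcongr
        _ = _ := rfl
    have h3 : 0 ≤ A * μ ^ 2 := by positivity
    rw [abs_le]
    constructor <;> linarith
  -- With K = ⌊μ⌋ − 1 the columns |m| ≤ K remain over the curve after a translation by at most 1,
  -- while K + 2 ≥ μ captures every column.
  · obtain ⟨K, hK⟩ : ∃ K : ℕ, ⌊μ⌋₊ = K + 1 :=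
      Nat.exists_eq_add_of_le' ((Nat.one_le_floor_iff μ).mpr hμ1)
    have hK1 : (K : ℝ) + 1 ≤ μ := by
      have := Nat.floor_le hμ.le
      rw [hK] at this
      exact_mod_cast this
    have hK2 : μ ≤ (K : ℝ) + 2 := by
      have := (Nat.lt_floor_add_one μ).le
      rw [hK] at this
      push_cast at this
      linarith
    have hcount := abs_le.mp (DiskLattice.abs_latticeCount_add_sawSum_le hμ (M := K + 2)
      (by push_cast; exact hK2))
    rw [← hA] at hcount
    rcases le_or_gt ε (1 / 32) with hε1 | hε1
    · have hsaw := abs_le.mp (hρ.abs_sawSum_le hε hε1 hK1 hK2)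
      rw [← hD] at hsaw
      have h1 : 1 ≤ √μ := Real.one_le_sqrt.mpr hμ1
      have h2 : DiskLattice.zetaConst * √μ ≤ DiskLattice.zetaConst * R := by
        gcongr; linarith
      rw [abs_le]
      constructor <;> linarith [hsaw.1, hsaw.2, hcount.1, hcount.2]
    -- For ε > 1/32 the trivial bound O(μ) for the sawtooth sum is already O(με).
    · have hsaw := abs_le.mp (DiskLattice.abs_sawSum_le μ (K + 2) (0, -1 / 4))
      push_cast at hsaw
      have h1 : μ * (1 / 32) ≤ μ * ε := by gcongr
      rw [abs_le]
      constructor <;> linarith [hsaw.1, hsaw.2, hcount.1, hcount.2]
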